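/- **Model.** Let $G$ be a finite group and let $\Lambda=(V,L,P)$ be a finite oriented lattice on the disk: a connected graph with at least one link drawn in the plane (dangling links allowed), with oriented links $L$, whose bounded faces are the plaquettes $P$; the unbounded face is the exterior. Let $V_{\rm bdry}\subseteq V$ and $P_{\rm bdry}\subseteq P$ be the vertices and plaquettes on which no constraint is imposed, $V_{\rm bulk}$ and $P_{\rm bulk}$ their complements. Every plaquette $p$ has a chosen site $(v,p)$, $v$ a vertex (corner) of $p$, and a finite-dimensional Hilbert space $\mathcal H_{(v,p)}$ with a representation $A_{\rm mat}(g),B_{\rm mat}(h)$ of the quantum double algebra of $G$: $A_{\rm mat}$ is a unitary representation of $G$, the $B_{\rm mat}(h)$ are mutually orthogonal projectors with sum $1$, and $A_{\rm mat}(g)B_{\rm mat}(h)=B_{\rm mat}(ghg^{-1})A_{\rm mat}(g)$. The plaquette has no matter if $\mathcal H_{(v,p)}=\mathbb C$, $A_{\rm mat}(g)=1$, $B_{\rm mat}(h)=\delta_{h,e}$. Put $\mathcal H_{\rm pre}=\bigotimes_{\ell\in L}L^2(G)\otimes\bigotimes_{p\in P}\mathcal H_{(v,p)}$. Let $A_v(g)$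 multiply the element of each link leaving $v$ from the left by $g$, that of each link entering $v$ from the right by $g^{-1}$, and act by $A_{\rm mat}(g)$ on the matter at the sites with vertex $v$; let $A_v=\frac1{|G|}\sum_gA_v(g)$. Let $B_p=\sum_{h}\Pi_p(h^{-1})B_{\rm mat}(h)$, where $\Pi_p(k)$ projects onto holonomy $k$ counterclockwise around $p$ from its site. Put $A=\prod_{v\in V_{\rm bulk}}A_v$, $B=\prod_{p\in P_{\rm bulk}}B_p$ and $\mathcal H_{\rm phys}=AB\,\mathcal H_{\rm pre}$. **Region.** Let $b\subseteq V$ and $\bar b=V\setminus b$. The links of the region are those with at least one end in $b$, so the set $\eth b$ of links between $b$ and $\bar b$ is included; its plaquettes are those with all vertices in $b$. Let $\mathcal A_b\subseteq\mathrm{End}(\mathcal H_{\rm phys})$ consist of the restrictions to $\mathcal H_{\rm phys}$ of the operators on $\mathcal H_{\rm pre}$ that commute with $A$ and with $B$ and act trivially on the links and the matter outside the region. **Cut.** Assume that $\eth b$ is an interval that divides the disk into two disks: $\eth b$ can be enumerated $\ell_0,\dots,\ell_n$ ($n\ge0$), $\ell_i$ joining $v_i\in b$ to $w_i\in\bar b$,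 so that one side of $\ell_0$ and the opposite side of $\ell_n$ (seen from $b$ to $\bar b$) are the exterior, and $\ell_{i}$, $\ell_{i+1}$ lie on a plaquette $p_i$, whose boundary consists of $\ell_{i}$, a path in $\bar b$ from $w_i$ to $w_{i+1}$, $\ell_{i+1}$, and a path in $b$ between $v_{i+1}$ and $v_i$. Assume further: 1. every $p_i$ is in $P_{\rm bulk}$ and has no matter; 2. every $w_i$ is in $V_{\rm bulk}$; 3. $\bar b$ is not pinched along the cut: if $i<j$ and $w_i=w_j$, then the closed path in $\bar b$ along $p_i,\dots,p_{j-1}$ from $w_i$ to $w_j$ is contractible across bulk plaquettes without matter. **Ribbon operators.** Let $\gamma$ be the ribbon with spokes $\ell_0,\dots,\ell_n$, whose spine is the path in $b$ from $v_0$ to $v_n$ along $p_0,\dots,p_{n-1}$. For $h,g\in G$ the operator $F_\gamma(h,g)$ projects onto product $g$ along the spine and multiplies the element of $\ell_i$, read from $v_i$ to $w_i$, from the left by $s_i^{-1}hs_i$, where $s_i$ is the product along the spine from $v_0$ to $v_i$. For $h\in G$ with conjugacy class $[h]$ put $$F_{\eth b}([h])=\frac1{|[h]|}\sum_{w\in[h]}\sum_{g\in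 G}F_\gamma(w,g).$$ **Theorem.** Every $F_{\eth b}([h])$ commutes with $A$ and $B$ and acts trivially outside the region, so it defines an element of $\mathcal A_b$; and the center $\mathcal A_b\cap\mathcal A_b'$ of $\mathcal A_b$ is the algebra generated by the operators $F_{\eth b}([h])$, $h\in G$, on $\mathcal H_{\rm phys}$. Indeed it is their linear span. -/

import Mathlib

open scoped Kronecker

noncomputable section

namespace DoublyGauged

/-! ### Oriented lattices on the disk -/

section Lattice

variable {V L P : Type*}

/-- A dart is a link together with a direction of travel: `(ℓ, true)` follows the orientation of
`ℓ`, and `(ℓ, false)` goes against it. -/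
abbrev Dart (L : Type*) := L × Bool

/-- The same link travelled in the opposite direction. -/
def rev (d : Dart L) : Dart L := (d.1, !d.2)

/-- Reversal as a permutation of the darts. -/
def revPerm (L : Type*) : Equiv.Perm (Dart L) where
  toFun := rev
  invFun := rev
  left_inv d := by simp [rev]
  right_inv d := by simp [rev]

/-- Where a dart starts. -/
def dartSrc (src tgt : L → V) (d : Dart L) : V := if d.2 then src d.1 else tgt d.1

/-- Where a dart ends. -/
def dartTgt (src tgt : L → V) (d : Dart L) : V := if d.2 then tgt d.1 else src d.1

/-- A finite oriented lattice on the disk, with vertices `V`, links `L`, plaquettes `P`, as a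
combinatorial map: a connected graph drawn on the sphere, one of whose faces is the exterior of
the lattice (`none`) and is not a plaquette; the other faces are the plaquettes.
`next d` is the dart that follows `d` on the boundary of the face to the left of `d`, so that the
boundary of a plaquette is followed counterclockwise. Dangling links are allowed. -/
structure DiskLattice (V L P : Type*) [Fintype V] [Fintype L] [Fintype P] where
  src : L → V
  tgt : L → V
  next : Equiv.Perm (Dart L)
  /-- The face to the left of a dart. -/
  face : Dart L → Option P
  src_next : ∀ d, dartSrc src tgt (next d) = dartTgt src tgt d
  /-- The rotation `d ↦ next (rev d)` goes once around each vertex. -/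
  rotation : ∀ d d', dartSrc src tgt d = dartSrc src tgt d' →
    (next * revPerm L).SameCycle d d'
  face_eq_iff : ∀ d d', face d = face d' ↔ next.SameCycle d d'
  face_surjective : Function.Surjective face
  connected : ∀ u v, Relation.ReflTransGen
    (fun a b => ∃ d, dartSrc src tgt d = a ∧ dartTgt src tgt d = b) u v
  /-- Euler's formula `|V| - |L| + (|P| + 1) = 2`: the surface is the sphere, and so the disk once
  the exterior face is taken away. -/
  euler : Fintype.card V + Fintype.card P = Fintype.card L + 1

variable [Fintype V] [Fintype L] [Fintype P]

namespace DiskLattice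

variable (Λ : DiskLattice V L P)

/-- Start of a dart. -/
def dsrc (d : Dart L) : V := dartSrc Λ.src Λ.tgt d

/-- End of a dart. -/
def dtgt (d : Dart L) : V := dartTgt Λ.src Λ.tgt d

/-- The closed path once around the face to the left of `d`, beginning with `d`. -/
def bdryWalk (d : Dart L) : List (Dart L) :=
  List.iterate Λ.next d (Function.minimalPeriod Λ.next d)

end DiskLattice

/-- The group element read off when a link is travelled along a dart. -/
def dartVal {G : Type*} [Group G] (x : L → G) (d : Dart L) : G := if d.2 then x d.1 else (x d.1)⁻¹

/-- The path-ordered product along a path. -/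
def hol {G : Type*} [Group G] (x : L → G) (ρ : List (Dart L)) : G := (ρ.map (dartVal x)).prod

end Lattice

/-! ### Matter -/

/-- A finite-dimensional Hilbert space, with orthonormal basis indexed by `κ`, that carries a
(unital, star-) representation of the quantum double algebra of `G`. -/
structure Matter (G κ : Type*) [Group G] [Fintype G] [DecidableEq G] [Fintype κ]
    [DecidableEq κ] where
  A : G →* Matrix κ κ ℂ
  B : G → Matrix κ κ ℂ
  A_inv : ∀ g, A g⁻¹ = (A g).conjTranspose
  B_herm : ∀ h, (B h).IsHermitian
  B_mul : ∀ g h, B g * B h = if g = h then B h else 0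
  B_sum : ∑ h, B h = 1
  A_mul_B : ∀ g h, A g * B h = B (g * h * g⁻¹) * A g

/-- No matter: the Hilbert space is `ℂ` with the trivial representation. -/
def Matter.IsTrivial {G κ : Type*} [Group G] [Fintype G] [DecidableEq G] [Fintype κ]
    [DecidableEq κ] (m : Matter G κ) : Prop :=
  Fintype.card κ = 1 ∧ (∀ g, m.A g = 1) ∧ ∀ h, m.B h = if h = 1 then 1 else 0

/-! ### The model -/

/-- The data of a doubly gauged model with gauge group `G`: a lattice on the disk, the vertices and
plaquettes on which no constraint is imposed, and for every plaquette `p` a site (given by the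
dart with which the boundary path of `p` begins; its start is the vertex of the site) and the
matter at that site, which may be trivial. -/
structure Model (G V L P : Type*) [Group G] [Fintype G] [DecidableEq G] [Fintype V]
    [DecidableEq V] [Fintype L] [DecidableEq L] [Fintype P] [DecidableEq P] (κ : P → Type*)
    [∀ p, Fintype (κ p)] [∀ p, DecidableEq (κ p)] extends DiskLattice V L P where
  Vbdry : Finset V
  Pbdry : Finset P
  site : P → Dart L
  face_site : ∀ p, face (site p) = some p
  matter : ∀ p, Matter G (κ p)

/-- Labels of the standard basis of the pre-gauged Hilbert space
`⨂_ℓ L²(G) ⊗ ⨂_p H_p`: a group element on every link and a basis label of every matter space.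
The pre-gauged Hilbert space is `Config G L κ → ℂ`, and its operators are the matrices
`O x' x = ⟨x'| O |x⟩`. -/
abbrev Config (G L : Type*) {P : Type*} (κ : P → Type*) := (L → G) × (∀ p, κ p)

section Operators

variable {G L P : Type*} {κ : P → Type*} [Fintype G] [DecidableEq G]
  [Fintype L] [DecidableEq L] [Fintype P] [DecidableEq P] [∀ p, Fintype (κ p)]

/-- The operator `|g⟩ ⊗ |m⟩ ↦ |f g⟩ ⊗ (⨂_p N p) |m⟩`. -/
def linkMatterOp (f : (L → G) → (L → G)) (N : ∀ p, Matrix (κ p) (κ p) ℂ) :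
    Matrix (Config G L κ) (Config G L κ) ℂ :=
  Matrix.of fun x' x => if x'.1 = f x.1 then ∏ p, N p (x'.2 p) (x.2 p) else 0

/-- The operator that acts by `N` on the matter at `p` and trivially on everything else. -/
def matterOp [∀ p, DecidableEq (κ p)] (p : P) (N : Matrix (κ p) (κ p) ℂ) : Matrix (Config G L κ) (Config G L κ) ℂ :=
  linkMatterOp id (Function.update 1 p N)

theorem linkMatterOp_mul (f f' : (L → G) → (L → G)) (N N' : ∀ p, Matrix (κ p) (κ p) ℂ) :
    linkMatterOp f N * linkMatterOp f' N' = linkMatterOp (f ∘ f') (fun p => N p * N' p) := by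
  ext x'' x
  simp only [Matrix.mul_apply, linkMatterOp, Matrix.of_apply, Fintype.sum_prod_type,
    Function.comp_apply]
  rw [Finset.sum_eq_single (f' x.1)]
  · by_cases h : x''.1 = f (f' x.1)
    · simp only [h, if_true]
      rw [Finset.prod_univ_sum]
      simp [Finset.prod_mul_distrib]
    · simp [h]
  · intro y _ hy
    simp [hy]
  · simp

end Operators

section Model

variable {G V L P : Type*} [Group G] [Fintype G] [DecidableEq G] [Fintype V] [DecidableEq V]
  [Fintype L] [DecidableEq L] [Fintype P] [DecidableEq P] {κ : P → Type*}
  [∀ p, Fintype (κ p)] [∀ p, DecidableEq (κ p)]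

namespace Model

variable (M : Model G V L P κ)

/-- The gauge transformation by `g` at `v`: left multiplication by `g` on the links oriented away
from `v`, right multiplication by `g⁻¹` on those oriented towards `v`. -/
def gauge (v : V) (g : G) (x : L → G) : L → G := fun ℓ =>
  (if M.src ℓ = v then g else 1) * x ℓ * (if M.tgt ℓ = v then g⁻¹ else 1)

/-- `A_v(g)`, which includes the action of `g` on the matter at the sites with vertex `v`. -/
def vertexOp (v : V) (g : G) : Matrix (Config G L κ) (Config G L κ) ℂ :=
  linkMatterOp (M.gauge v g) (fun p => if M.dsrc (M.site p) = v then (M.matter p).A g else 1)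

/-- The Gauss projector `A_v`. -/
def vertexProj (v : V) : Matrix (Config G L κ) (Config G L κ) ℂ :=
  (Fintype.card G : ℂ)⁻¹ • ∑ g, M.vertexOp v g

/-- The projector onto holonomy `h` around `p`, counterclockwise from the site of `p`. -/
def holProj (p : P) (h : G) : Matrix (Config G L κ) (Config G L κ) ℂ :=
  Matrix.diagonal fun x => if hol x.1 (M.bdryWalk (M.site p)) = h then 1 else 0

/-- `B_{(v,p)}(g)`, with the flux of the matter at the site included. -/
def plaqOp (p : P) (g : G) : Matrix (Config G L κ) (Config G L κ) ℂ :=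
  ∑ h, M.holProj p (g * h⁻¹) * matterOp p ((M.matter p).B h)

/-- The flatness projector `B_p`. -/
def plaqProj (p : P) : Matrix (Config G L κ) (Config G L κ) ℂ := M.plaqOp p 1

theorem gauge_comm {v w : V} (hvw : v ≠ w) (g h : G) (x : L → G) :
    M.gauge v g (M.gauge w h x) = M.gauge w h (M.gauge v g x) := by
  funext ℓ
  simp only [gauge]
  by_cases h1 : M.src ℓ = v
  · by_cases h2 : M.tgt ℓ = v
    · simp [h1, h2, hvw]
    · by_cases h3 : M.tgt ℓ = w <;> simp [h1, h2, h3, hvw, hvw.symm, mul_assoc]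
  · by_cases h2 : M.tgt ℓ = v
    · by_cases h3 : M.src ℓ = w <;> simp [h2, h3, hvw, hvw.symm, mul_assoc]
    · simp [h1, h2]

theorem vertexProj_commute {v w : V} (hvw : v ≠ w) :
    Commute (M.vertexProj v) (M.vertexProj w) := by
  refine Commute.smul_left (Commute.smul_right ?_ _) _
  refine Commute.sum_left _ _ _ fun g _ => Commute.sum_right _ _ _ fun h _ => ?_
  simp only [Commute, SemiconjBy, vertexOp, linkMatterOp_mul]
  congr 1
  · funext x
    exact M.gauge_comm hvw g h x
  · funext p
    by_cases h1 : M.dsrc (M.site p) = v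
    · simp [h1, hvw]
    · simp [h1]

theorem holProj_commute_matterOp (p q : P) (h : G) (N : Matrix (κ q) (κ q) ℂ) :
    Commute (M.holProj p h) (matterOp q N) := by
  ext x' x
  simp only [holProj, Matrix.diagonal_mul, Matrix.mul_diagonal, matterOp, linkMatterOp,
    Matrix.of_apply, id]
  by_cases hx : x'.1 = x.1
  · simp [hx, mul_comm]
  · simp [hx]

theorem plaqProj_commute {p q : P} (hpq : p ≠ q) : Commute (M.plaqProj p) (M.plaqProj q) := by
  refine Commute.sum_left _ _ _ fun g _ => Commute.sum_right _ _ _ fun h _ => ?_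
  refine Commute.mul_left (Commute.mul_right ?_ (M.holProj_commute_matterOp _ _ _ _))
    (Commute.mul_right (M.holProj_commute_matterOp _ _ _ _).symm ?_)
  · simp only [Commute, SemiconjBy, holProj, Matrix.diagonal_mul_diagonal, mul_comm]
  · simp only [Commute, SemiconjBy, matterOp, linkMatterOp_mul]
    congr 1
    funext r
    by_cases h1 : r = p
    · subst h1
      simp [Function.update_of_ne hpq]
    · simp [Function.update_of_ne h1]

/-- The projector `A`, the product of the `A_v` over the bulk vertices. -/
def gaussProj : Matrix (Config G L κ) (Config G L κ) ℂ :=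
  (M.Vbdryᶜ).noncommProd M.vertexProj fun _ _ _ _ h => M.vertexProj_commute h

/-- The projector `B`, the product of the `B_p` over the bulk plaquettes. -/
def flatProj : Matrix (Config G L κ) (Config G L κ) ℂ :=
  (M.Pbdryᶜ).noncommProd M.plaqProj fun _ _ _ _ h => M.plaqProj_commute h

/-- The physical Hilbert space `A B H_pre`. -/
def physSpace : Submodule ℂ (Config G L κ → ℂ) :=
  LinearMap.range (M.gaussProj * M.flatProj).mulVecLin

/-! ### The algebra of a region

A region is given by its set `b` of vertices. -/

/-- The links of the region: those with at least one end in `b`; the cut links are included. -/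
def regionLinks (b : Finset V) : Finset L := Finset.univ.filter fun ℓ => M.src ℓ ∈ b ∨ M.tgt ℓ ∈ b

open Classical in
/-- The plaquettes of the region: those all of whose vertices are in `b`. -/
def regionPlaqs (b : Finset V) : Finset P :=
  Finset.univ.filter fun p => ∀ d, M.face d = some p → M.dsrc d ∈ b

end Model

/-- The basis labels of the links in `S` and the matter in `T`, and those of the rest. -/
def splitConfig (κ : P → Type*) (S : Finset L) (T : Finset P) : Config G L κ ≃
    (({ℓ // ℓ ∈ S} → G) × (∀ p : {p // p ∈ T}, κ p)) ×
    (({ℓ // ℓ ∉ S} → G) × (∀ p : {p // p ∉ T}, κ p)) :=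
  ((Equiv.piEquivPiSubtypeProd (· ∈ S) (fun _ => G)).prodCongr
    (Equiv.piEquivPiSubtypeProd (· ∈ T) κ)).trans (Equiv.prodProdProdComm _ _ _ _)

/-- The operators `o ⊗ 1`, where `o` acts on the links in `S` and on the matter in `T`: those that
act trivially on all other links and matter. -/
def localAlgebra (κ : P → Type*) [∀ p, Fintype (κ p)] [∀ p, DecidableEq (κ p)]
    (S : Finset L) (T : Finset P) :
    Subalgebra ℂ (Matrix (Config G L κ) (Config G L κ) ℂ) where
  carrier := {O | ∃ o : Matrix (({ℓ // ℓ ∈ S} → G) × (∀ p : {p // p ∈ T}, κ p))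
      (({ℓ // ℓ ∈ S} → G) × (∀ p : {p // p ∈ T}, κ p)) ℂ,
      O = (o ⊗ₖ 1).submatrix (splitConfig κ S T) (splitConfig κ S T)}
  mul_mem' := by
    rintro _ _ ⟨o, rfl⟩ ⟨o', rfl⟩
    refine ⟨o * o', ?_⟩
    rw [Matrix.submatrix_mul_equiv, ← Matrix.mul_kronecker_mul, one_mul]
  add_mem' := by
    rintro _ _ ⟨o, rfl⟩ ⟨o', rfl⟩
    refine ⟨o + o', ?_⟩
    rw [Matrix.add_kronecker]
    rfl
  algebraMap_mem' c := by
    refine ⟨c • 1, ?_⟩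
    ext x' x
    have h : x' = x ↔ (splitConfig κ S T x').1 = (splitConfig κ S T x).1 ∧
        (splitConfig κ S T x').2 = (splitConfig κ S T x).2 := by
      rw [← Prod.ext_iff, (splitConfig κ S T).injective.eq_iff]
    simp only [Algebra.algebraMap_eq_smul_one, Matrix.smul_apply, Matrix.submatrix_apply,
      Matrix.kroneckerMap_apply, Matrix.one_apply, h, smul_eq_mul]
    split_ifs <;> simp_all

namespace Model

variable (M : Model G V L P κ)

/-- The operators on the pre-gauged Hilbert space that commute with `A` and `B` and act trivially
on the links and matter outside the region. -/
def preAlgebra (b : Finset V) : Subalgebra ℂ (Matrix (Config G L κ) (Config G L κ) ℂ) :=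
  localAlgebra κ (M.regionLinks b) (M.regionPlaqs b) ⊓
    Subalgebra.centralizer ℂ {M.gaussProj, M.flatProj}

theorem preAlgebra_maps (b : Finset V) (O : M.preAlgebra b) (ψ : Config G L κ → ℂ)
    (hψ : ψ ∈ M.physSpace) : O.1.mulVecLin ψ ∈ M.physSpace := by
  obtain ⟨φ, rfl⟩ := hψ
  obtain ⟨-, hO⟩ := O.2
  have hO := Subalgebra.mem_centralizer_iff ℂ |>.1 hO
  refine ⟨O.1.mulVecLin φ, ?_⟩
  have h1 := hO _ (Set.mem_insert _ _)
  have h2 := hO _ (Set.mem_insert_of_mem _ rfl)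
  simp only [Matrix.mulVecLin_apply, Matrix.mulVec_mulVec]
  rw [mul_assoc, h2, ← mul_assoc, h1, mul_assoc]

/-- The action of these operators on the physical Hilbert space. -/
def physRep (b : Finset V) : M.preAlgebra b →ₐ[ℂ] Module.End ℂ M.physSpace :=
  AlgHom.ofLinearMap
    { toFun := fun O => O.1.mulVecLin.restrict (M.preAlgebra_maps b O)
      map_add' := fun O O' => by
        ext ψ : 2
        exact Matrix.add_mulVec O.1 O'.1 ψ.1
      map_smul' := fun c O => by
        ext ψ : 2
        exact Matrix.smul_mulVec c O.1 ψ.1 }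
    (by
      ext ψ : 2
      exact Matrix.one_mulVec ψ.1)
    (fun O O' => by
      ext ψ : 2
      exact (Matrix.mulVec_mulVec ψ.1 O.1 O'.1).symm)

/-- The algebra `𝒜_b` of physical operators of the region `b`. -/
def regionAlgebra (b : Finset V) : Subalgebra ℂ (Module.End ℂ M.physSpace) := (M.physRep b).range

/-- The center `𝒵_b = 𝒜_b ∩ 𝒜_b'`. -/
def regionCenter (b : Finset V) : Subalgebra ℂ (Module.End ℂ M.physSpace) :=
  M.regionAlgebra b ⊓ Subalgebra.centralizer ℂ (M.regionAlgebra b : Set _)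

end Model

/-! ### Ribbons -/

/-- A ribbon that begins and ends on a spoke: the spokes, as darts that point away from the spine,
and the piece of the spine between each spoke and the next. -/
structure Ribbon (L : Type*) where
  n : ℕ
  spoke : Fin (n + 1) → Dart L
  spine : Fin n → List (Dart L)

namespace Ribbon

/-- The part of the spine between the first spoke and the `i`-th. -/
def spineTo (γ : Ribbon L) (i : Fin (γ.n + 1)) : List (Dart L) :=
  ((List.finRange γ.n).filter fun k => k.castSucc < i).flatMap γ.spine

/-- The whole spine. -/
def fullSpine (γ : Ribbon L) : List (Dart L) := γ.spineTo (Fin.last γ.n)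

open Classical in
/-- The ribbon operator `F_γ(h, g)`: it projects onto product `g` along the spine, and multiplies
the element of the `i`-th spoke, read away from the spine, from the left by `s⁻¹ h s`, where `s` is
the product along the spine up to that spoke. -/
def op (γ : Ribbon L) (h g : G) : Matrix (Config G L κ) (Config G L κ) ℂ :=
  Matrix.of fun x' x =>
    if hol x.1 γ.fullSpine = g ∧
      (∀ i, dartVal x'.1 (γ.spoke i) =
        (hol x.1 (γ.spineTo i))⁻¹ * h * hol x.1 (γ.spineTo i) * dartVal x.1 (γ.spoke i)) ∧
      (∀ ℓ, (∀ i, (γ.spoke i).1 ≠ ℓ) → x'.1 ℓ = x.1 ℓ) ∧ x'.2 = x.2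
    then 1 else 0

open Classical in
/-- `F([h]) = 1/|[h]| ∑_{w ∈ [h]} ∑_{g ∈ G} F_γ(w, g)`. -/
def classOp (κ : P → Type*) [∀ p, DecidableEq (κ p)] (γ : Ribbon L) (h : G) :
    Matrix (Config G L κ) (Config G L κ) ℂ :=
  ((Finset.univ.filter fun w => IsConj h w).card : ℂ)⁻¹ •
    ∑ w ∈ Finset.univ.filter (fun w => IsConj h w), ∑ g, γ.op w g

end Ribbon

/-! ### Interval cuts -/

/-- The links between `b` and its complement form a dual path that is an interval: it enters from
the exterior of the lattice through the first cut link, passes from the `i`-th cut link to the next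
inside the plaquette `plaq i`, and leaves to the exterior through the last cut link. Each of these
plaquettes is crossed once: its boundary is a cut link (followed away from `b`), a path `outer i`
outside `b`, the next cut link (followed towards `b`), and a path `inner i` in `b`. -/
structure IntervalCut (Λ : DiskLattice V L P) (b : Finset V) where
  n : ℕ
  spoke : Fin (n + 1) → Dart L
  plaq : Fin n → P
  outer : Fin n → List (Dart L)
  inner : Fin n → List (Dart L)
  spoke_injective : Function.Injective spoke
  exists_spoke_iff : ∀ d, (∃ i, spoke i = d) ↔ Λ.dsrc d ∈ b ∧ Λ.dtgt d ∉ b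
  face_first : Λ.face (rev (spoke 0)) = none
  face_last : Λ.face (spoke (Fin.last n)) = none
  face_spoke : ∀ i : Fin n, Λ.face (spoke i.castSucc) = some (plaq i)
  walk : ∀ i : Fin n, Λ.bdryWalk (spoke i.castSucc) =
    spoke i.castSucc :: (outer i ++ rev (spoke i.succ) :: inner i)
  outer_notMem : ∀ i, ∀ d ∈ outer i, Λ.dsrc d ∉ b ∧ Λ.dtgt d ∉ b
  inner_mem : ∀ i, ∀ d ∈ inner i, Λ.dsrc d ∈ b ∧ Λ.dtgt d ∈ b

namespace IntervalCut

variable {Λ : DiskLattice V L P} {b : Finset V}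

/-- The ribbon of the cut: its spokes are the cut links, and its spine is the path in `b`, along
the crossed plaquettes, through the ends of the cut links in `b`. -/
def ribbon (c : IntervalCut Λ b) : Ribbon L where
  n := c.n
  spoke := c.spoke
  spine i := ((c.inner i).map rev).reverse

/-- The path outside `b`, along the crossed plaquettes, from the outer end of the `i`-th cut link to
the outer end of the `j`-th. -/
def outerPath (c : IntervalCut Λ b) (i j : Fin (c.n + 1)) : List (Dart L) :=
  ((List.finRange c.n).filter fun k => i ≤ k.castSucc ∧ k.castSucc < j).flatMap c.outer

end IntervalCut

/-- A closed path can be contracted by moving it across bulk plaquettes without matter only: the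
word that it spells is a consequence of the boundary words of these plaquettes. -/
def Model.IsContractible (M : Model G V L P κ) (ρ : List (Dart L)) : Prop :=
  FreeGroup.mk ρ ∈ Subgroup.normalClosure
    {r : FreeGroup L | ∃ d p, M.face d = some p ∧ p ∉ M.Pbdry ∧ (M.matter p).IsTrivial ∧
      r = FreeGroup.mk (M.bdryWalk d)}

/-- The complement of `b` is not pinched along the cut: where its side of the cut comes back to the
outer end of an earlier cut link, it has not gone around matter. -/
def Model.Unpinched (M : Model G V L P κ) {b : Finset V}
    (c : IntervalCut M.toDiskLattice b) : Prop :=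
  ∀ i j, i < j → M.dtgt (c.spoke i) = M.dtgt (c.spoke j) → M.IsContractible (c.outerPath i j)

end Model

end DoublyGauged

end

/-! Write `P = AB` and `Q` for the product of the constraints that lie wholly in the region. The
other constraints that touch the region are cut in two along `ð b`. A Gauss operator at an outer end
`w_i` is a gauge transformation `R(g)` of the cut links (`cutOp`) times an operator local outside.
The flatness of a crossed plaquette says that the parallel transport through the region between
consecutive outer ends (`flux`) equals one that is read outside; `E(k)` (`fluxProj`) projects onto
given values of these fluxes. The `R(g)` permute the `E(k)`, and both commute with `Q`.

Let `S` be the algebra of the local operators that commute with all `R(g)`, all `E(k)` and `Q`.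
Every `s` in `S` gives a physical operator `sQ` (`mul_regionProj_mem_preAlgebra`). Conversely every
operator of the region agrees on physical states with a member of `S`: since `R(g)` and `E(k)` act
on the range of `P` like operators outside the region, one may average over them
(`exists_commute_cutConstraints`). Hence `𝒜_b` is the quotient of `S` by the ideal of operators that
vanish on physical states.

A central element of such a quotient lifts to a central element of `S`, by orthogonal projection
away from the ideal for the trace form (`exists_central_lift`). Since `S` is the commutant of a
star-closed set, the double commutant theorem puts the lift in the span of the products `R(g)E(k)`
and `R(g)E(k)Q`. The lift is fixed by the average `cutAvg`, so it remains to average these products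
on physical states, where `Q` is absorbed.

The average of `R(g)E(k)` vanishes unless `g` fixes `k`. On flat labels the fluxes form a pure gauge
`t·1`; the absence of pinching is what makes `t` well defined on vertices (`exists_flux_eq`). So one
may take `k = t·1`, and then `t⁻¹gt` fixes the trivial fluxes, that is, it takes one value `a` at
all outer ends. A gauge transformation that fixes the fluxes acts on the spokes as a ribbon twist,
and the average runs over the conjugates of `a⁻¹`: the result is a multiple of the class operator of
`a⁻¹` (`sum_cutOp_mul_fluxProj`). Read backwards, the same identity expresses each class operator,
on physical states, through the `R(g)E(k)`, which commute with `S`; therefore class operators are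
central. -/

namespace Matrix

/-! ### Trace projections, double commutants and lifts of central elements. -/

variable {n : Type*} [Fintype n]

/-- The orthogonal projection onto a space of matrices, for the trace form. -/
theorem exists_trace_projection (N : Submodule ℂ (Matrix n n ℂ)) :
    ∃ p : Matrix n n ℂ →ₗ[ℂ] Matrix n n ℂ, (∀ x, p x ∈ N) ∧
      ∀ x, ∀ y ∈ N, (yᴴ * (x - p x)).trace = 0 := by
  let e : Matrix n n ℂ ≃ₗ[ℂ] EuclideanSpace ℂ (n × n) :=
    (LinearEquiv.curry ℂ ℂ n n).symm.trans (WithLp.linearEquiv 2 ℂ (n × n → ℂ)).symm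
  have he : ∀ x y : Matrix n n ℂ, inner ℂ (e x) (e y) = (xᴴ * y).trace := by
    intro x y
    simp only [e, PiLp.inner_apply, Matrix.trace, Matrix.diag, Matrix.mul_apply,
      Matrix.conjTranspose_apply, Fintype.sum_prod_type]
    rw [Finset.sum_comm]
    refine Finset.sum_congr rfl fun i _ => Finset.sum_congr rfl fun j _ => ?_
    exact mul_comm _ _
  let K : Submodule ℂ (EuclideanSpace ℂ (n × n)) := N.map e.toLinearMap
  refine ⟨e.symm.toLinearMap ∘ₗ K.starProjection.toLinearMap ∘ₗ e.toLinearMap, fun x => ?_,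
    fun x y hy => ?_⟩
  · obtain ⟨z, hz, hze⟩ := K.starProjection_apply_mem (e x)
    have : e.symm (K.starProjection (e x)) = z := by
      rw [← hze]
      exact e.symm_apply_apply z
    simpa [this] using hz
  · rw [← he]
    have h := K.sub_starProjection_mem_orthogonal (e x)
    have := (Submodule.mem_orthogonal _ _).1 h (e y) ⟨y, hy, rfl⟩
    simpa only [LinearMap.coe_comp, LinearEquiv.coe_coe, Function.comp_apply, map_sub,
      LinearEquiv.apply_symm_apply, ContinuousLinearMap.coe_coe] using this

open scoped ComplexOrder in
theorem eq_zero_of_trace_orthogonal {N : Submodule ℂ (Matrix n n ℂ)} {d : Matrix n n ℂ}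
    (hd : d ∈ N) (h : ∀ y ∈ N, (yᴴ * d).trace = 0) : d = 0 :=
  Matrix.trace_conjTranspose_mul_self_eq_zero_iff.1 (h d hd)

variable [DecidableEq n]

/-- A linear map on matrices that commutes with left multiplication by `X` also commutes with left
multiplication by the double commutant of `X`. -/
theorem map_mul_of_mem_double_commutant (p : Matrix n n ℂ →ₗ[ℂ] Matrix n n ℂ)
    (X : Set (Matrix n n ℂ)) (hp : ∀ x ∈ X, ∀ m, p (x * m) = x * p m) {z : Matrix n n ℂ}
    (hz : ∀ y, (∀ x ∈ X, Commute x y) → Commute y z) (m : Matrix n n ℂ) :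
    p (z * m) = z * p m := by
  -- The coefficients of `p`: the `b`-th column of `p y` is the sum over `a` of `q a b` applied to
  -- the `a`-th column of `y`. Thus `p` commutes with left multiplication by `x` only if every `q a
  -- b` commutes with `x`.
  let q : n → n → Matrix n n ℂ := fun a b => Matrix.of fun c i => p (Matrix.single i a 1) c b
  have hq : ∀ y c b, p y c b = ∑ a, (q a b * y) c a := by
    intro y c b
    conv_lhs => rw [Matrix.matrix_eq_sum_single y]
    rw [Finset.sum_comm]
    simp only [map_sum, Matrix.sum_apply, Matrix.mul_apply, q, Matrix.of_apply]
    refine Finset.sum_congr rfl fun a _ => Finset.sum_congr rfl fun i _ => ?_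
    have : Matrix.single i a (y i a) = y i a • Matrix.single i a (1 : ℂ) := by simp
    rw [this, map_smul, Matrix.smul_apply, smul_eq_mul, mul_comm]
  have hcomm : ∀ a b, ∀ x ∈ X, Commute x (q a b) := by
    intro a b x hx
    ext c i
    have h1 := congrFun (congrFun (hp x hx (Matrix.single i a 1)) c) b
    rw [hq, Matrix.mul_apply] at h1
    rw [Matrix.mul_apply, ← show _ = ∑ j, x c j * q a b j i from h1]
    rw [Finset.sum_eq_single a]
    · rw [← mul_assoc, Matrix.mul_single_apply_same, mul_one]
    · intro a' _ ha'
      rw [← mul_assoc, Matrix.mul_single_apply_of_ne _ _ _ _ _ ha']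
    · simp
  ext c b
  rw [hq, Matrix.mul_apply]
  simp only [hq]
  calc ∑ a, (q a b * (z * m)) c a = ∑ a, (z * (q a b * m)) c a := by
        refine Finset.sum_congr rfl fun a _ => ?_
        rw [← mul_assoc, (hz _ (hcomm a b)).eq, mul_assoc]
    _ = ∑ a, ∑ x, z c x * (q a b * m) x a := Finset.sum_congr rfl fun a _ => Matrix.mul_apply
    _ = _ := by
        rw [Finset.sum_comm]
        simp only [Finset.mul_sum]

/-- A form of the double commutant theorem. -/
theorem mem_of_mem_double_commutant (X : Set (Matrix n n ℂ)) (hX : ∀ x ∈ X, xᴴ ∈ X)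
    (N : Submodule ℂ (Matrix n n ℂ)) (h1 : 1 ∈ N) (hN : ∀ x ∈ X, ∀ y ∈ N, x * y ∈ N)
    {z : Matrix n n ℂ} (hz : ∀ y, (∀ x ∈ X, Commute x y) → Commute y z) : z ∈ N := by
  obtain ⟨p, hpN, hp⟩ := exists_trace_projection N
  -- Since `X` is star-closed, the orthogonal complement of `N` is stable under `X` as well, so the
  -- projection onto `N` commutes with left multiplication by `X`.
  have hpX : ∀ x ∈ X, ∀ m, p (x * m) = x * p m := by
    intro x hx m
    rw [← sub_eq_zero]
    refine eq_zero_of_trace_orthogonal (N.sub_mem (hpN _) (hN x hx _ (hpN m))) fun y hy => ?_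
    have h2 := hp (x * m) y hy
    have h3 := hp m (xᴴ * y) (hN _ (hX x hx) y hy)
    rw [Matrix.conjTranspose_mul, Matrix.conjTranspose_conjTranspose] at h3
    have : yᴴ * (p (x * m) - x * p m) = yᴴ * x * (m - p m) - yᴴ * (x * m - p (x * m)) := by
      noncomm_ring
    rw [this, Matrix.trace_sub, h2, h3, sub_zero]
  have hp1 : p 1 = 1 := by
    rw [eq_comm, ← sub_eq_zero]
    exact eq_zero_of_trace_orthogonal (N.sub_mem h1 (hpN 1)) fun y hy => hp 1 y hy
  -- Now `p z = p (z * 1) = z * p 1 = z`, and the values of `p` lie in `N`.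
  have := map_mul_of_mem_double_commutant p X hpX hz 1
  rw [hp1, mul_one] at this
  exact this ▸ hpN z

/-- Let `J` be an ideal of the commutant of a star-closed set `X`. An element of this commutant
that is central modulo `J` is congruent modulo `J` to a central element. -/
theorem exists_central_lift (X : Set (Matrix n n ℂ)) (hX : ∀ x ∈ X, xᴴ ∈ X)
    (N : Submodule ℂ (Matrix n n ℂ)) (h1 : 1 ∈ N) (hN : ∀ x ∈ X, ∀ y ∈ N, x * y ∈ N)
    (J : Submodule ℂ (Matrix n n ℂ)) (hJ : ∀ j ∈ J, ∀ x ∈ X, Commute x j)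
    (hl : ∀ s, (∀ x ∈ X, Commute x s) → ∀ j ∈ J, s * j ∈ J)
    (hr : ∀ s, (∀ x ∈ X, Commute x s) → ∀ j ∈ J, j * s ∈ J) {z : Matrix n n ℂ}
    (hz : ∀ x ∈ X, Commute x z)
    (hzs : ∀ s, (∀ x ∈ X, Commute x s) → z * s - s * z ∈ J) :
    ∃ z' ∈ N, (∀ x ∈ X, Commute x z') ∧ z - z' ∈ J := by
  obtain ⟨p, hpJ, hp⟩ := exists_trace_projection J
  have hstar : ∀ s, (∀ x ∈ X, Commute x s) → ∀ x ∈ X, Commute x sᴴ := by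
    intro s hs x hx
    have := hs _ (hX x hx)
    have := congrArg Matrix.conjTranspose this.eq
    simp only [Matrix.conjTranspose_mul, Matrix.conjTranspose_conjTranspose] at this
    exact this.symm
  refine ⟨z - p z, mem_of_mem_double_commutant X hX N h1 hN fun s hs => ?_,
    fun x hx => (hz x hx).sub_right (hJ _ (hpJ z) x hx), by simpa using hpJ z⟩
  -- The commutator of `s` with the component `z - p z` lies in `J`, because `z` is central modulo
  -- the ideal `J`. It is also orthogonal to `J`, because multiplication by `sᴴ` preserves `J`. So
  -- it vanishes.
  suffices h : (z - p z) * s - s * (z - p z) = 0 by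
    exact (sub_eq_zero.1 h).symm
  refine eq_zero_of_trace_orthogonal (N := J) ?_ fun y hy => ?_
  · have : (z - p z) * s - s * (z - p z) = (z * s - s * z) - (p z * s - s * p z) := by
      noncomm_ring
    rw [this]
    exact J.sub_mem (hzs s hs) (J.sub_mem (hr s hs _ (hpJ z)) (hl s hs _ (hpJ z)))
  · have h2 := hp z (y * sᴴ) (hr _ (hstar s hs) y hy)
    have h3 := hp z (sᴴ * y) (hl _ (hstar s hs) y hy)
    simp only [Matrix.conjTranspose_mul, Matrix.conjTranspose_conjTranspose] at h2 h3
    rw [mul_sub, Matrix.trace_sub, ← mul_assoc, Matrix.trace_mul_comm, ← mul_assoc, h2,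
      ← mul_assoc, h3, sub_zero]

end Matrix

set_option linter.unusedSectionVars false

namespace DoublyGauged

/-! ### Operators that are local on a set of links and matter. -/

section Local

variable {G L P : Type*} [Fintype G] [DecidableEq G]
  [Fintype L] [DecidableEq L] [Fintype P] [DecidableEq P] {κ : P → Type*}
  [∀ p, Fintype (κ p)] [∀ p, DecidableEq (κ p)]

/-- Two basis labels agree on the links in `S` and on the matter in `T`. -/
def AgreeOn (S : Finset L) (T : Finset P) (x y : Config G L κ) : Prop :=
  (∀ ℓ ∈ S, x.1 ℓ = y.1 ℓ) ∧ ∀ p ∈ T, x.2 p = y.2 p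

theorem AgreeOn.symm {S : Finset L} {T : Finset P} {x y : Config G L κ} (h : AgreeOn S T x y) :
    AgreeOn S T y x :=
  ⟨fun ℓ hℓ => (h.1 ℓ hℓ).symm, fun p hp => (h.2 p hp).symm⟩

theorem AgreeOn.trans {S : Finset L} {T : Finset P} {x y z : Config G L κ} (h : AgreeOn S T x y)
    (h' : AgreeOn S T y z) : AgreeOn S T x z :=
  ⟨fun ℓ hℓ => (h.1 ℓ hℓ).trans (h'.1 ℓ hℓ), fun p hp => (h.2 p hp).trans (h'.2 p hp)⟩

theorem splitConfig_fst_eq_iff (S : Finset L) (T : Finset P) (x y : Config G L κ) :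
    (splitConfig κ S T x).1 = (splitConfig κ S T y).1 ↔ AgreeOn S T x y := by
  constructor
  · intro h
    exact ⟨fun ℓ hℓ => congrFun (congrArg Prod.fst h) ⟨ℓ, hℓ⟩,
      fun p hp => congrFun (congrArg Prod.snd h) ⟨p, hp⟩⟩
  · intro h
    exact Prod.ext (funext fun ℓ => h.1 ℓ.1 ℓ.2) (funext fun p => h.2 p.1 p.2)

theorem splitConfig_snd_eq_iff (S : Finset L) (T : Finset P) (x y : Config G L κ) :
    (splitConfig κ S T x).2 = (splitConfig κ S T y).2 ↔ AgreeOn Sᶜ Tᶜ x y := by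
  constructor
  · intro h
    exact ⟨fun ℓ hℓ => congrFun (congrArg Prod.fst h) ⟨ℓ, Finset.mem_compl.1 hℓ⟩,
      fun p hp => congrFun (congrArg Prod.snd h) ⟨p, Finset.mem_compl.1 hp⟩⟩
  · intro h
    exact Prod.ext (funext fun ℓ => h.1 ℓ.1 (Finset.mem_compl.2 ℓ.2))
      (funext fun p => h.2 p.1 (Finset.mem_compl.2 p.2))

/-- A criterion for locality in terms of matrix elements. -/
theorem mem_localAlgebra_iff (S : Finset L) (T : Finset P)
    (O : Matrix (Config G L κ) (Config G L κ) ℂ) :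
    O ∈ localAlgebra κ S T ↔ (∀ x' x, O x' x ≠ 0 → AgreeOn Sᶜ Tᶜ x' x) ∧
      ∀ x' x y' y, AgreeOn S T x' y' → AgreeOn S T x y → AgreeOn Sᶜ Tᶜ x' x →
        AgreeOn Sᶜ Tᶜ y' y → O x' x = O y' y := by
  constructor
  · rintro ⟨o, rfl⟩
    refine ⟨fun x' x h => ?_, fun x' x y' y h1 h2 h3 h4 => ?_⟩
    · rw [← splitConfig_snd_eq_iff]
      by_contra hne
      exact h (by simp [Matrix.kroneckerMap_apply, hne])
    · rw [← splitConfig_snd_eq_iff] at h3 h4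
      rw [← splitConfig_fst_eq_iff] at h1 h2
      simp [Matrix.kroneckerMap_apply, Matrix.one_apply, h1, h2, h3, h4]
  · rintro ⟨h0, h1⟩
    by_cases hne : Nonempty (Config G L κ)
    · obtain ⟨c⟩ := hne
      let e := splitConfig (G := G) κ S T
      refine ⟨Matrix.of fun r' r => O (e.symm (r', (e c).2)) (e.symm (r, (e c).2)), ?_⟩
      ext x' x
      simp only [Matrix.submatrix_apply, Matrix.kroneckerMap_apply, Matrix.one_apply,
        Matrix.of_apply]
      by_cases h : (splitConfig κ S T x').2 = (splitConfig κ S T x).2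
      · rw [if_pos h, mul_one]
        refine h1 _ _ _ _ ?_ ?_ ((splitConfig_snd_eq_iff _ _ _ _).1 h) ?_
        · rw [← splitConfig_fst_eq_iff, Equiv.apply_symm_apply]
        · rw [← splitConfig_fst_eq_iff, Equiv.apply_symm_apply]
        · rw [← splitConfig_snd_eq_iff, Equiv.apply_symm_apply, Equiv.apply_symm_apply]
      · rw [if_neg h, mul_zero]
        by_contra hO
        exact h ((splitConfig_snd_eq_iff _ _ _ _).2 (h0 _ _ hO))
    · refine ⟨0, ?_⟩
      ext x' x
      exact (hne ⟨x⟩).elim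

theorem AgreeOn.eq_of_agreeOn_compl {S : Finset L} {T : Finset P} {x y : Config G L κ}
    (h : AgreeOn S T x y) (h' : AgreeOn Sᶜ Tᶜ x y) : x = y := by
  rw [← splitConfig_fst_eq_iff] at h
  rw [← splitConfig_snd_eq_iff] at h'
  exact (splitConfig κ S T).injective (Prod.ext h h')

/-- The label that agrees with `x` on the links in `S` and the matter in `T`, and with `y`
elsewhere. -/
def mixConfig (S : Finset L) (T : Finset P) (x y : Config G L κ) : Config G L κ :=
  (fun ℓ => if ℓ ∈ S then x.1 ℓ else y.1 ℓ, fun p => if p ∈ T then x.2 p else y.2 p)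

theorem agreeOn_mixConfig (S : Finset L) (T : Finset P) (x y : Config G L κ) :
    AgreeOn S T (mixConfig S T x y) x :=
  ⟨fun ℓ hℓ => by simp [mixConfig, hℓ], fun p hp => by simp [mixConfig, hp]⟩

theorem agreeOn_compl_mixConfig (S : Finset L) (T : Finset P) (x y : Config G L κ) :
    AgreeOn Sᶜ Tᶜ (mixConfig S T x y) y :=
  ⟨fun ℓ hℓ => by simp [mixConfig, Finset.mem_compl.1 hℓ],
    fun p hp => by simp [mixConfig, Finset.mem_compl.1 hp]⟩

theorem AgreeOn.eq_mixConfig {S : Finset L} {T : Finset P} {x y z : Config G L κ}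
    (h1 : AgreeOn S T z x) (h2 : AgreeOn Sᶜ Tᶜ z y) : z = mixConfig S T x y := by
  refine Prod.ext (funext fun ℓ => ?_) (funext fun p => ?_)
  · by_cases h : ℓ ∈ S
    · simp [mixConfig, h, h1.1 ℓ h]
    · simp [mixConfig, h, h2.1 ℓ (Finset.mem_compl.2 h)]
  · by_cases h : p ∈ T
    · simp [mixConfig, h, h1.2 p h]
    · simp [mixConfig, h, h2.2 p (Finset.mem_compl.2 h)]

/-- Operators on complementary sets of links and matter commute. -/
theorem commute_of_mem_localAlgebra {S : Finset L} {T : Finset P}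
    {O O' : Matrix (Config G L κ) (Config G L κ) ℂ} (h : O ∈ localAlgebra κ S T)
    (h' : O' ∈ localAlgebra κ Sᶜ Tᶜ) : Commute O O' := by
  rw [mem_localAlgebra_iff] at h h'
  simp only [compl_compl] at h'
  ext x' x
  -- In each of the two products only one intermediate label contributes: the one in which the first
  -- operator to act has already changed its half of the label and the other has not.
  have a1 := agreeOn_mixConfig S T x x'
  have a2 := agreeOn_compl_mixConfig S T x x'
  have a3 := agreeOn_mixConfig S T x' x
  have a4 := agreeOn_compl_mixConfig S T x' x
  rw [Matrix.mul_apply, Matrix.mul_apply, Finset.sum_eq_single (mixConfig S T x x'),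
    Finset.sum_eq_single (mixConfig S T x' x)]
  · rw [mul_comm, h.2 x' (mixConfig S T x x') (mixConfig S T x' x) x a3.symm a1 a2.symm a4,
      h'.2 (mixConfig S T x x') x x' (mixConfig S T x' x) a2 a4.symm a1 a3.symm]
  · intro y _ hy
    by_contra hne
    exact hy (AgreeOn.eq_mixConfig (h'.1 _ _ (left_ne_zero_of_mul hne)).symm
      (h.1 _ _ (right_ne_zero_of_mul hne)))
  · simp
  · intro y _ hy
    by_contra hne
    exact hy (AgreeOn.eq_mixConfig (h'.1 _ _ (right_ne_zero_of_mul hne))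
      (h.1 _ _ (left_ne_zero_of_mul hne)).symm)
  · simp

theorem linkMatterOp_mem_localAlgebra {S : Finset L} {T : Finset P} {f : (L → G) → L → G}
    {N : ∀ p, Matrix (κ p) (κ p) ℂ} (hf : ∀ x, ∀ ℓ ∉ S, f x ℓ = x ℓ)
    (hf' : ∀ x y, (∀ ℓ ∈ S, x ℓ = y ℓ) → ∀ ℓ ∈ S, f x ℓ = f y ℓ) (hN : ∀ p ∉ T, N p = 1) :
    linkMatterOp f N ∈ localAlgebra (G := G) κ S T := by
  rw [mem_localAlgebra_iff]
  refine ⟨fun x' x h => ?_, fun x' x y' y h1 h2 h3 h4 => ?_⟩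
  · simp only [linkMatterOp, Matrix.of_apply, ne_eq, ite_eq_right_iff, Classical.not_imp,
      Finset.prod_eq_zero_iff, not_exists, not_and] at h
    refine ⟨fun ℓ hℓ => ?_, fun p hp => ?_⟩
    · rw [h.1, hf _ _ (Finset.mem_compl.1 hℓ)]
    · by_contra hne
      exact h.2 p (Finset.mem_univ p) (by
        rw [hN p (Finset.mem_compl.1 hp), Matrix.one_apply_ne hne])
  · simp only [linkMatterOp, Matrix.of_apply]
    congr 1
    · refine propext ⟨fun h => funext fun ℓ => ?_, fun h => funext fun ℓ => ?_⟩
      · by_cases hℓ : ℓ ∈ S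
        · rw [← h1.1 ℓ hℓ, h, hf' _ _ h2.1 ℓ hℓ]
        · rw [hf _ _ hℓ, h4.1 ℓ (Finset.mem_compl.2 hℓ)]
      · by_cases hℓ : ℓ ∈ S
        · rw [h1.1 ℓ hℓ, h, hf' _ _ h2.1 ℓ hℓ]
        · rw [hf _ _ hℓ, h3.1 ℓ (Finset.mem_compl.2 hℓ)]
    · refine Finset.prod_congr rfl fun p _ => ?_
      by_cases hp : p ∈ T
      · rw [h1.2 p hp, h2.2 p hp]
      · rw [hN p hp, h3.2 p (Finset.mem_compl.2 hp), h4.2 p (Finset.mem_compl.2 hp)]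
        simp

/-- Multiplication by a function of the links. -/
def linkDiag (κ : P → Type*) [∀ p, DecidableEq (κ p)] (φ : (L → G) → ℂ) :
    Matrix (Config G L κ) (Config G L κ) ℂ :=
  Matrix.diagonal fun x => φ x.1

theorem linkDiag_mem_localAlgebra {S : Finset L} (T : Finset P) {φ : (L → G) → ℂ}
    (hφ : ∀ x y, (∀ ℓ ∈ S, x ℓ = y ℓ) → φ x = φ y) :
    linkDiag κ φ ∈ localAlgebra (G := G) κ S T := by
  rw [mem_localAlgebra_iff]
  refine ⟨fun x' x h => ?_, fun x' x y' y h1 h2 h3 h4 => ?_⟩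
  · have : x' = x := by
      by_contra hne
      exact h (Matrix.diagonal_apply_ne _ hne)
    exact this ▸ ⟨fun _ _ => rfl, fun _ _ => rfl⟩
  · have : x' = x ↔ y' = y :=
      ⟨fun h => (h1.symm.trans (h ▸ h2)).eq_of_agreeOn_compl h4,
        fun h => (h1.trans (h ▸ h2.symm)).eq_of_agreeOn_compl h3⟩
    simp only [linkDiag, Matrix.diagonal_apply, this, hφ _ _ h1.1]

theorem linkMatterOp_mul_linkDiag {f : (L → G) → L → G} (N : ∀ p, Matrix (κ p) (κ p) ℂ)
    {φ ψ : (L → G) → ℂ} (h : ∀ x, φ x = ψ (f x)) :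
    linkMatterOp f N * linkDiag κ φ = linkDiag κ ψ * linkMatterOp f N := by
  ext x' x
  simp only [linkDiag, Matrix.mul_diagonal, Matrix.diagonal_mul, linkMatterOp, Matrix.of_apply]
  by_cases hx : x'.1 = f x.1
  · rw [if_pos hx, hx, h, mul_comm]
  · simp [hx]

theorem linkDiag_mul (φ ψ : (L → G) → ℂ) :
    linkDiag κ φ * linkDiag κ ψ = linkDiag κ fun x => φ x * ψ x := by
  simp [linkDiag]

theorem linkDiag_commute (φ ψ : (L → G) → ℂ) : Commute (linkDiag κ φ) (linkDiag κ ψ) := by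
  simp only [Commute, SemiconjBy, linkDiag_mul, mul_comm]

theorem linkMatterOp_one : linkMatterOp id 1 = (1 : Matrix (Config G L κ) (Config G L κ) ℂ) := by
  ext x' x
  simp only [linkMatterOp, Matrix.of_apply, id, Pi.one_apply, Matrix.one_apply,
    Finset.prod_ite_zero, Finset.prod_const_one, Prod.ext_iff, funext_iff, Finset.mem_univ,
    true_implies]
  split_ifs <;> simp_all

theorem linkMatterOp_conjTranspose {f f' : (L → G) → L → G} {N N' : ∀ p, Matrix (κ p) (κ p) ℂ}
    (h : ∀ x y, x = f y ↔ y = f' x) (hN : ∀ p, (N p).conjTranspose = N' p) :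
    (linkMatterOp f N : Matrix (Config G L κ) (Config G L κ) ℂ).conjTranspose =
      linkMatterOp f' N' := by
  ext x' x
  simp only [linkMatterOp, Matrix.conjTranspose_apply, Matrix.of_apply, h, apply_ite star,
    star_zero, star_prod, ← hN]

/-- The embedding `o ↦ o ⊗ 1`. -/
def localEmbed (κ : P → Type*) [∀ p, Fintype (κ p)] [∀ p, DecidableEq (κ p)]
    (S : Finset L) (T : Finset P) :
    Matrix (({ℓ // ℓ ∈ S} → G) × (∀ p : {p // p ∈ T}, κ p))
      (({ℓ // ℓ ∈ S} → G) × (∀ p : {p // p ∈ T}, κ p)) ℂ →ₐ[ℂ]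
      Matrix (Config G L κ) (Config G L κ) ℂ :=
  AlgHom.ofLinearMap
    { toFun := fun o => (o ⊗ₖ 1).submatrix (splitConfig κ S T) (splitConfig κ S T)
      map_add' := fun o o' => by rw [Matrix.add_kronecker]; rfl
      map_smul' := fun c o => by rw [Matrix.smul_kronecker]; rfl }
    (by simp)
    (fun o o' => by
      simp only [LinearMap.coe_mk, AddHom.coe_mk]
      rw [Matrix.submatrix_mul_equiv, ← Matrix.mul_kronecker_mul, one_mul])

theorem mem_localAlgebra_iff_exists_localEmbed {S : Finset L} {T : Finset P}
    {O : Matrix (Config G L κ) (Config G L κ) ℂ} :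
    O ∈ localAlgebra κ S T ↔ ∃ o, localEmbed κ S T o = O :=
  ⟨fun ⟨o, h⟩ => ⟨o, h.symm⟩, fun ⟨o, h⟩ => ⟨o, h.symm⟩⟩

theorem localEmbed_conjTranspose (S : Finset L) (T : Finset P)
    (o : Matrix (({ℓ // ℓ ∈ S} → G) × (∀ p : {p // p ∈ T}, κ p))
      (({ℓ // ℓ ∈ S} → G) × (∀ p : {p // p ∈ T}, κ p)) ℂ) :
    localEmbed κ S T o.conjTranspose = (localEmbed κ S T o).conjTranspose := by
  change (o.conjTranspose ⊗ₖ 1).submatrix _ _ = ((o ⊗ₖ 1).submatrix _ _).conjTranspose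
  rw [Matrix.conjTranspose_submatrix, Matrix.conjTranspose_kronecker, Matrix.conjTranspose_one]

theorem localEmbed_injective [Nonempty (Config G L κ)] (S : Finset L) (T : Finset P) :
    Function.Injective (localEmbed (G := G) κ S T) := by
  intro o o' h
  obtain ⟨c⟩ := ‹Nonempty (Config G L κ)›
  let e := splitConfig (G := G) κ S T
  ext r' r
  have := congrFun (congrFun h (e.symm (r', (e c).2))) (e.symm (r, (e c).2))
  change (o ⊗ₖ (1 : Matrix _ _ ℂ)) (e (e.symm _)) (e (e.symm _)) =
    (o' ⊗ₖ (1 : Matrix _ _ ℂ)) (e (e.symm _)) (e (e.symm _)) at this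
  simpa only [Equiv.apply_symm_apply, Matrix.kroneckerMap_apply, Matrix.one_apply_eq,
    mul_one] using this

/-- Let `X` be a star-closed set of local operators, and `N` a space of operators that contains `1`
and is stable under left multiplication by `X`; let `J` be an ideal of the algebra of the local
operators that commute with `X`. A member of this algebra that is central modulo `J` is congruent
modulo `J` to one in `N`. -/
theorem exists_local_central_lift {S : Finset L} {T : Finset P}
    (X : Set (Matrix (Config G L κ) (Config G L κ) ℂ)) (hXl : ∀ x ∈ X, x ∈ localAlgebra κ S T)
    (hX : ∀ x ∈ X, x.conjTranspose ∈ X)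
    (N : Submodule ℂ (Matrix (Config G L κ) (Config G L κ) ℂ)) (h1 : 1 ∈ N)
    (hN : ∀ x ∈ X, ∀ y ∈ N, x * y ∈ N)
    (J : Submodule ℂ (Matrix (Config G L κ) (Config G L κ) ℂ))
    (hl : ∀ s ∈ localAlgebra κ S T, (∀ x ∈ X, Commute x s) → ∀ j ∈ J, s * j ∈ J)
    (hr : ∀ s ∈ localAlgebra κ S T, (∀ x ∈ X, Commute x s) → ∀ j ∈ J, j * s ∈ J)
    {z : Matrix (Config G L κ) (Config G L κ) ℂ}
    (hzl : z ∈ localAlgebra κ S T) (hz : ∀ x ∈ X, Commute x z)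
    (hzs : ∀ s ∈ localAlgebra κ S T, (∀ x ∈ X, Commute x s) → z * s - s * z ∈ J) :
    ∃ z' ∈ N, (∀ x ∈ X, Commute x z') ∧ z - z' ∈ J := by
  -- A matter space may be zero; then there are no basis labels, all operators vanish and the
  -- embedding below is not injective.
  by_cases hne : Nonempty (Config G L κ)
  swap
  · refine ⟨1, h1, fun x _ => Commute.one_right x, ?_⟩
    have : z - 1 = 0 := by
      ext x
      exact (hne ⟨x⟩).elim
    rw [this]
    exact J.zero_mem
  let ι := localEmbed (G := G) κ S T
  have hι : Function.Injective ι := localEmbed_injective S T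
  have hmem : ∀ o, ι o ∈ localAlgebra κ S T := fun o =>
    mem_localAlgebra_iff_exists_localEmbed.2 ⟨o, rfl⟩
  have hc : ∀ s, (∀ x ∈ ι ⁻¹' X, Commute x s) → ∀ x ∈ X, Commute x (ι s) := by
    intro s hs x hx
    obtain ⟨o, rfl⟩ := mem_localAlgebra_iff_exists_localEmbed.1 (hXl x hx)
    exact (hs o hx).map ι
  have hc' : ∀ s, (∀ x ∈ X, Commute x (ι s)) → ∀ x ∈ ι ⁻¹' X, Commute x s := by
    intro s hs x hx
    have := (hs _ hx).eq
    rw [← map_mul, ← map_mul] at this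
    exact hι this
  obtain ⟨o, rfl⟩ := mem_localAlgebra_iff_exists_localEmbed.1 hzl
  -- `J` itself need not consist of local operators, nor of operators that commute with `X`. The
  -- intersection with the commutant makes its preimage an ideal of that commutant.
  let J' := J.comap ι.toLinearMap ⊓
    (Subalgebra.centralizer ℂ (ι ⁻¹' X)).toSubmodule
  have hJ' : ∀ j, j ∈ J' ↔ ι j ∈ J ∧ ∀ x ∈ ι ⁻¹' X, Commute x j := fun j => Iff.rfl
  obtain ⟨z', hz'N, hz', hz'J⟩ := Matrix.exists_central_lift (ι ⁻¹' X)
    (fun x hx => by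
      change ι _ ∈ X
      rw [show ι x.conjTranspose = (ι x).conjTranspose from localEmbed_conjTranspose S T x]
      exact hX _ hx)
    (N.comap ι.toLinearMap)
    (by
      change ι 1 ∈ N
      rwa [map_one])
    (fun x hx y hy => by
      change ι _ ∈ N
      rw [map_mul]
      exact hN _ hx _ hy)
    J' (fun j hj => ((hJ' j).1 hj).2)
    (fun s hs j hj => by
      rw [hJ'] at hj ⊢
      exact ⟨by
        rw [map_mul]
        exact hl _ (hmem s) (hc s hs) _ hj.1, fun x hx => (hs x hx).mul_right (hj.2 x hx)⟩)
    (fun s hs j hj => by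
      rw [hJ'] at hj ⊢
      exact ⟨by
        rw [map_mul]
        exact hr _ (hmem s) (hc s hs) _ hj.1, fun x hx => (hj.2 x hx).mul_right (hs x hx)⟩)
    (z := o) (hc' o hz)
    (fun s hs => by
      rw [hJ']
      refine ⟨?_, fun x hx => ?_⟩
      · rw [map_sub, map_mul, map_mul]
        exact hzs _ (hmem s) (hc s hs)
      · have := hc' o hz x hx
        exact (this.mul_right (hs x hx)).sub_right ((hs x hx).mul_right this))
  refine ⟨ι z', hz'N, hc z' hz', ?_⟩
  have := ((hJ' _).1 hz'J).1
  rwa [map_sub] at this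

end Local

end DoublyGauged

namespace DoublyGauged

/-! ### Paths, holonomies and partial gauge transformations. -/

section Paths

variable {G V L P : Type*} [Group G] [Fintype V] [Fintype L] [Fintype P] [DecidableEq L]

theorem hol_nil (x : L → G) : hol x [] = 1 := rfl

theorem hol_cons (x : L → G) (d : Dart L) (ρ : List (Dart L)) :
    hol x (d :: ρ) = dartVal x d * hol x ρ := by simp [hol]

theorem hol_append (x : L → G) (ρ σ : List (Dart L)) : hol x (ρ ++ σ) = hol x ρ * hol x σ := by
  simp [hol]

theorem dartVal_rev (x : L → G) (d : Dart L) : dartVal x (rev d) = (dartVal x d)⁻¹ := by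
  obtain ⟨ℓ, _ | _⟩ := d <;> simp [dartVal, rev]

theorem hol_reverse (x : L → G) (ρ : List (Dart L)) :
    hol x (ρ.map rev).reverse = (hol x ρ)⁻¹ := by
  induction ρ with
  | nil => simp [hol]
  | cons d ρ ih =>
    rw [List.map_cons, List.reverse_cons, hol_append, ih, hol_cons, hol_cons, hol_nil, mul_one,
      dartVal_rev, mul_inv_rev]

theorem dartVal_congr {x y : L → G} {d : Dart L} (h : x d.1 = y d.1) :
    dartVal x d = dartVal y d := by
  simp only [dartVal, h]

theorem hol_congr {x y : L → G} {ρ : List (Dart L)} (h : ∀ d ∈ ρ, x d.1 = y d.1) :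
    hol x ρ = hol y ρ := by
  unfold hol
  congr 1
  exact List.map_congr_left fun d hd => dartVal_congr (h d hd)

namespace DiskLattice

variable (Λ : DiskLattice V L P)

theorem dsrc_rev (d : Dart L) : Λ.dsrc (rev d) = Λ.dtgt d := by
  obtain ⟨ℓ, _ | _⟩ := d <;> simp [dsrc, dtgt, dartSrc, dartTgt, rev]

theorem dtgt_rev (d : Dart L) : Λ.dtgt (rev d) = Λ.dsrc d := by
  obtain ⟨ℓ, _ | _⟩ := d <;> simp [dsrc, dtgt, dartSrc, dartTgt, rev]

theorem dsrc_next (d : Dart L) : Λ.dsrc (Λ.next d) = Λ.dtgt d := Λ.src_next d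

/-- `ρ` is a path from `u` to `w`. -/
def IsPath : V → List (Dart L) → V → Prop
  | u, [], w => u = w
  | u, d :: ρ, w => Λ.dsrc d = u ∧ IsPath (Λ.dtgt d) ρ w

theorem isPath_append {u w : V} {ρ σ : List (Dart L)} :
    Λ.IsPath u (ρ ++ σ) w ↔ ∃ v, Λ.IsPath u ρ v ∧ Λ.IsPath v σ w := by
  induction ρ generalizing u with
  | nil => simp [IsPath]
  | cons d ρ ih => simp [IsPath, ih, and_assoc]

theorem isPath_iterate (d : Dart L) (n : ℕ) :
    Λ.IsPath (Λ.dsrc d) (List.iterate Λ.next d n) (Λ.dsrc (Λ.next^[n] d)) := by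
  induction n generalizing d with
  | zero => simp [IsPath]
  | succ n ih =>
    refine ⟨rfl, ?_⟩
    rw [Function.iterate_succ_apply, ← Λ.dsrc_next]
    exact ih _

theorem isPath_bdryWalk (d : Dart L) : Λ.IsPath (Λ.dsrc d) (Λ.bdryWalk d) (Λ.dsrc d) := by
  have := Λ.isPath_iterate d (Function.minimalPeriod Λ.next d)
  rwa [Function.iterate_minimalPeriod] at this

theorem face_next (d : Dart L) : Λ.face (Λ.next d) = Λ.face d :=
  (Λ.face_eq_iff _ _).2 ((Equiv.Perm.SameCycle.refl _ _).apply_left)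

theorem face_of_mem_bdryWalk {d d' : Dart L} (h : d' ∈ Λ.bdryWalk d) : Λ.face d' = Λ.face d := by
  obtain ⟨m, -, rfl⟩ := List.mem_iterate.1 h
  clear h
  induction m with
  | zero => rfl
  | succ m ih => rw [Function.iterate_succ_apply', face_next, ih]

/-- A property of darts that passes on to the next dart holds on all of a face if it holds for one
dart. -/
theorem face_induction {q : Dart L → Prop} (hq : ∀ d, q d → q (Λ.next d)) {d d' : Dart L}
    (h : Λ.face d = Λ.face d') (hd : q d) : q d' := by
  obtain ⟨m, -, -, rfl⟩ := ((Λ.face_eq_iff _ _).1 h).exists_pow_eq''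
  clear h
  induction m with
  | zero => exact hd
  | succ m ih =>
    rw [pow_succ', Equiv.Perm.mul_apply]
    exact hq _ ih

theorem hol_bdryWalk_next (x : L → G) (d : Dart L) :
    hol x (Λ.bdryWalk (Λ.next d)) = (dartVal x d)⁻¹ * hol x (Λ.bdryWalk d) * dartVal x d := by
  have hd : d ∈ Function.periodicPts Λ.next :=
    Function.Injective.mem_periodicPts Λ.next.injective d
  have hpos := Function.minimalPeriod_pos_of_mem_periodicPts hd
  obtain ⟨m, hm⟩ := Nat.exists_eq_succ_of_ne_zero hpos.ne'
  have hcl := Function.iterate_minimalPeriod (f := Λ.next) (x := d)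
  simp only [bdryWalk, Function.minimalPeriod_apply hd]
  rw [hm] at hcl ⊢
  have h1 : List.iterate Λ.next d (m + 1) = d :: List.iterate Λ.next (Λ.next d) m := rfl
  have h2 : List.iterate Λ.next (Λ.next d) (m + 1) = List.iterate Λ.next (Λ.next d) m ++ [d] := by
    rw [List.iterate_add]
    congr 1
    change [_] = _
    rw [← Function.iterate_succ_apply, hcl]
  rw [Nat.succ_eq_add_one, h1, h2, hol_append, hol_cons, hol_cons, hol_nil, inv_mul_cancel_left,
    mul_one]

/-- Moving the base point one dart along the face conjugates the holonomy, so flatness is a property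
of the face and not of the chosen site. -/
theorem hol_bdryWalk_eq_one_iff (x : L → G) {d d' : Dart L} (h : Λ.face d = Λ.face d') :
    hol x (Λ.bdryWalk d) = 1 ↔ hol x (Λ.bdryWalk d') = 1 := by
  refine Λ.face_induction (q := fun e => hol x (Λ.bdryWalk d) = 1 ↔ hol x (Λ.bdryWalk e) = 1)
    (fun e he => ?_) h Iff.rfl
  rw [he, hol_bdryWalk_next, mul_assoc, inv_mul_eq_one, eq_comm (a := dartVal x e), mul_eq_right]

/-- The gauge transformation by `g`, applied only to the links in `S`. -/
def gaugeOn (S : Finset L) (g : V → G) (x : L → G) : L → G := fun ℓ =>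
  if ℓ ∈ S then g (Λ.src ℓ) * x ℓ * (g (Λ.tgt ℓ))⁻¹ else x ℓ

theorem gaugeOn_apply_of_notMem {S : Finset L} (g : V → G) (x : L → G) {ℓ : L} (h : ℓ ∉ S) :
    Λ.gaugeOn S g x ℓ = x ℓ := if_neg h

theorem gaugeOn_one (S : Finset L) (x : L → G) : Λ.gaugeOn S 1 x = x := by
  funext ℓ
  simp [gaugeOn]

theorem gaugeOn_mul (S : Finset L) (g h : V → G) (x : L → G) :
    Λ.gaugeOn S (g * h) x = Λ.gaugeOn S g (Λ.gaugeOn S h x) := by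
  funext ℓ
  simp only [gaugeOn]
  split_ifs <;> simp [mul_assoc]

theorem gaugeOn_comm (S T : Finset L) {g h : V → G} (hgh : ∀ v, Commute (g v) (h v))
    (x : L → G) : Λ.gaugeOn S g (Λ.gaugeOn T h x) = Λ.gaugeOn T h (Λ.gaugeOn S g x) := by
  funext ℓ
  simp only [gaugeOn]
  split_ifs
  · calc _ = (g (Λ.src ℓ) * h (Λ.src ℓ)) * x ℓ * (g (Λ.tgt ℓ) * h (Λ.tgt ℓ))⁻¹ := by
          group
      _ = _ := by
          rw [(hgh (Λ.src ℓ)).eq, (hgh (Λ.tgt ℓ)).eq]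
          group
  all_goals rfl

theorem gaugeOn_compl (S : Finset L) (g : V → G) (x : L → G) :
    Λ.gaugeOn S g (Λ.gaugeOn Sᶜ g x) = Λ.gaugeOn Finset.univ g x := by
  funext ℓ
  by_cases h : ℓ ∈ S <;> simp [gaugeOn, h]

theorem dartVal_gaugeOn {S : Finset L} (g : V → G) (x : L → G) {d : Dart L} (h : d.1 ∈ S) :
    dartVal (Λ.gaugeOn S g x) d = g (Λ.dsrc d) * dartVal x d * (g (Λ.dtgt d))⁻¹ := by
  obtain ⟨ℓ, _ | _⟩ := d <;>
    simp_all [dartVal, gaugeOn, dsrc, dtgt, dartSrc, dartTgt, mul_assoc]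

theorem hol_gaugeOn {S : Finset L} (g : V → G) (x : L → G) {u w : V} {ρ : List (Dart L)}
    (hρ : Λ.IsPath u ρ w) (h : ∀ d ∈ ρ, d.1 ∈ S) :
    hol (Λ.gaugeOn S g x) ρ = g u * hol x ρ * (g w)⁻¹ := by
  induction ρ generalizing u with
  | nil =>
    cases hρ
    simp [hol_nil]
  | cons d ρ ih =>
    obtain ⟨rfl, hρ⟩ := hρ
    rw [hol_cons, hol_cons, ih hρ fun e he => h e (List.mem_cons_of_mem _ he),
      dartVal_gaugeOn Λ g x (h d List.mem_cons_self)]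
    group

end DiskLattice

end Paths

/-! ### Algebra of the vertex and plaquette operators. -/

section Model

variable {G V L P : Type*} [Group G] [Fintype G] [DecidableEq G] [Fintype V] [DecidableEq V]
  [Fintype L] [DecidableEq L] [Fintype P] [DecidableEq P] {κ : P → Type*}
  [∀ p, Fintype (κ p)] [∀ p, DecidableEq (κ p)]

namespace Model

variable (M : Model G V L P κ)

theorem gauge_eq_gaugeOn (v : V) (g : G) : M.gauge v g = M.gaugeOn Finset.univ (Pi.mulSingle v g) := by
  funext x ℓ
  simp only [gauge, DiskLattice.gaugeOn, Finset.mem_univ, if_true, Pi.mulSingle_apply]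
  congr 1
  split_ifs <;> simp

theorem dartVal_gauge (v : V) (g : G) (x : L → G) (d : Dart L) :
    dartVal (M.gauge v g x) d = (if M.dsrc d = v then g else 1) * dartVal x d *
      (if M.dtgt d = v then g else 1)⁻¹ := by
  rw [gauge_eq_gaugeOn, DiskLattice.dartVal_gaugeOn _ _ _ (Finset.mem_univ _)]
  simp only [Pi.mulSingle_apply]

theorem hol_gauge (v : V) (g : G) (x : L → G) {u w : V} {ρ : List (Dart L)}
    (hρ : M.IsPath u ρ w) : hol (M.gauge v g x) ρ = (if u = v then g else 1) * hol x ρ *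
      (if w = v then g else 1)⁻¹ := by
  rw [gauge_eq_gaugeOn, DiskLattice.hol_gaugeOn _ _ _ hρ fun _ _ => Finset.mem_univ _]
  simp only [Pi.mulSingle_apply]

theorem vertexOp_mul (v : V) (g h : G) : M.vertexOp v g * M.vertexOp v h = M.vertexOp v (g * h) := by
  simp only [vertexOp, linkMatterOp_mul]
  congr 1
  · funext x
    simp only [gauge_eq_gaugeOn, Pi.mulSingle_mul, DiskLattice.gaugeOn_mul, Function.comp_apply]
  · funext p
    split_ifs <;> simp

theorem vertexOp_conjTranspose (v : V) (g : G) :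
    (M.vertexOp v g).conjTranspose = M.vertexOp v g⁻¹ := by
  refine linkMatterOp_conjTranspose (fun x y => ?_) fun p => ?_
  · simp only [gauge_eq_gaugeOn, Pi.mulSingle_inv]
    constructor
    · rintro rfl
      rw [← DiskLattice.gaugeOn_mul, inv_mul_cancel, DiskLattice.gaugeOn_one]
    · rintro rfl
      rw [← DiskLattice.gaugeOn_mul, mul_inv_cancel, DiskLattice.gaugeOn_one]
  · split_ifs
    · rw [(M.matter p).A_inv]
    · simp

theorem vertexOp_mul_vertexProj (v : V) (g : G) :
    M.vertexOp v g * M.vertexProj v = M.vertexProj v := by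
  simp only [vertexProj, mul_smul_comm, Finset.mul_sum, vertexOp_mul]
  congr 1
  exact Fintype.sum_equiv (Equiv.mulLeft g) _ _ fun h => rfl

theorem vertexProj_mul_of_forall (v : V) {X : Matrix (Config G L κ) (Config G L κ) ℂ}
    (h : ∀ g, M.vertexOp v g * X = X) : M.vertexProj v * X = X := by
  simp only [vertexProj, smul_mul_assoc, Finset.sum_mul, h, Finset.sum_const, Finset.card_univ]
  rw [← Nat.cast_smul_eq_nsmul ℂ, smul_smul, inv_mul_cancel₀, one_smul]
  exact Nat.cast_ne_zero.2 Fintype.card_ne_zero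

theorem vertexProj_mul_self (v : V) : M.vertexProj v * M.vertexProj v = M.vertexProj v :=
  M.vertexProj_mul_of_forall v fun g => M.vertexOp_mul_vertexProj v g

theorem vertexProj_isHermitian (v : V) : (M.vertexProj v).IsHermitian := by
  simp only [Matrix.IsHermitian, vertexProj, Matrix.conjTranspose_smul, Matrix.conjTranspose_sum,
    vertexOp_conjTranspose]
  congr 1
  · simp
  · exact Fintype.sum_equiv (Equiv.inv G) _ _ fun h => rfl

theorem matterOp_mul (p : P) (N N' : Matrix (κ p) (κ p) ℂ) :
    (matterOp p N * matterOp p N' : Matrix (Config G L κ) (Config G L κ) ℂ) =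
      matterOp p (N * N') := by
  simp only [matterOp, linkMatterOp_mul, Function.comp_id]
  congr 1
  funext q
  by_cases h : q = p
  · subst h
    simp
  · simp [h]

theorem matterOp_one (p : P) : (matterOp p 1 : Matrix (Config G L κ) (Config G L κ) ℂ) = 1 := by
  rw [← linkMatterOp_one, matterOp]
  congr 1
  funext q
  by_cases h : q = p
  · subst h
    simp
  · simp [h]

theorem matterOp_zero (p : P) : (matterOp p 0 : Matrix (Config G L κ) (Config G L κ) ℂ) = 0 := by
  ext x' x
  simp only [matterOp, linkMatterOp, Matrix.of_apply, Matrix.zero_apply, ite_eq_right_iff]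
  intro _
  exact Finset.prod_eq_zero (Finset.mem_univ p) (by simp)

theorem matterOp_conjTranspose (p : P) (N : Matrix (κ p) (κ p) ℂ) :
    (matterOp p N : Matrix (Config G L κ) (Config G L κ) ℂ).conjTranspose =
      matterOp p N.conjTranspose := by
  refine linkMatterOp_conjTranspose (fun x y => eq_comm) fun q => ?_
  by_cases h : q = p
  · subst h
    simp
  · simp [h]

theorem holProj_eq_linkDiag (p : P) (h : G) : M.holProj p h =
    linkDiag κ fun x => if hol x (M.bdryWalk (M.site p)) = h then 1 else 0 := rfl

theorem plaqProj_eq (p : P) :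
    M.plaqProj p = ∑ h, M.holProj p h⁻¹ * matterOp p ((M.matter p).B h) := by
  simp [plaqProj, plaqOp]

theorem plaqProj_mul_self (p : P) : M.plaqProj p * M.plaqProj p = M.plaqProj p := by
  rw [plaqProj_eq, Finset.sum_mul]
  refine Finset.sum_congr rfl fun h _ => ?_
  rw [Finset.mul_sum, Finset.sum_eq_single h]
  · rw [mul_assoc, ← mul_assoc (matterOp p _), ← (M.holProj_commute_matterOp p p _ _).eq,
      mul_assoc, matterOp_mul, (M.matter p).B_mul, if_pos rfl, ← mul_assoc]
    congr 1
    rw [holProj_eq_linkDiag, linkDiag_mul]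
    congr 1
    funext x
    split_ifs <;> simp
  · intro k _ hk
    rw [mul_assoc, ← mul_assoc (matterOp p _), ← (M.holProj_commute_matterOp p p _ _).eq,
      mul_assoc, matterOp_mul, (M.matter p).B_mul, if_neg hk.symm, matterOp_zero, mul_zero,
      mul_zero]
  · simp

theorem plaqProj_isHermitian (p : P) : (M.plaqProj p).IsHermitian := by
  rw [plaqProj_eq, Matrix.IsHermitian, Matrix.conjTranspose_sum]
  refine Finset.sum_congr rfl fun h _ => ?_
  rw [Matrix.conjTranspose_mul, matterOp_conjTranspose, (M.matter p).B_herm,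
    (M.holProj_commute_matterOp p p _ _).eq]
  congr 1
  simp only [holProj, Matrix.diagonal_conjTranspose]
  congr 1
  funext x
  simp [apply_ite]

theorem plaqProj_eq_of_isTrivial {p : P} (h : (M.matter p).IsTrivial) :
    M.plaqProj p = linkDiag κ fun x => if hol x (M.bdryWalk (M.site p)) = 1 then 1 else 0 := by
  rw [plaqProj_eq, Finset.sum_eq_single 1]
  · rw [h.2.2, if_pos rfl, matterOp_one, mul_one, inv_one, holProj_eq_linkDiag]
  · intro k _ hk
    rw [h.2.2, if_neg hk, matterOp_zero, mul_zero]
  · simp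

/-- A link operator that does not change the holonomy of a plaquette commutes with its
projector. -/
theorem linkMatterOp_commute_plaqProj {f : (L → G) → L → G} {p : P}
    (h : ∀ x, hol (f x) (M.bdryWalk (M.site p)) = hol x (M.bdryWalk (M.site p))) :
    Commute (linkMatterOp f 1) (M.plaqProj p) := by
  rw [plaqProj_eq]
  refine Commute.sum_right _ _ _ fun k _ => Commute.mul_right ?_ ?_
  · rw [holProj_eq_linkDiag]
    exact linkMatterOp_mul_linkDiag _ fun x => by rw [h]
  · simp [Commute, SemiconjBy, matterOp, linkMatterOp_mul]

theorem linkDiag_commute_plaqProj (φ : (L → G) → ℂ) (p : P) :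
    Commute (linkDiag κ φ) (M.plaqProj p) := by
  rw [plaqProj_eq]
  refine Commute.sum_right _ _ _ fun k _ => Commute.mul_right ?_ ?_
  · rw [holProj_eq_linkDiag]
    exact linkDiag_commute _ _
  · rw [matterOp]
    exact (linkMatterOp_mul_linkDiag _ fun x => rfl).symm

/-- Only the action at the site matters: with `c = g` if `v` is the vertex of the site and `c = 1`
otherwise, both the holonomy and the flux of the matter are conjugated by `c`. Conjugation permutes
the terms of `B_p`. -/
theorem vertexOp_commute_plaqProj (v : V) (g : G) (p : P) :
    Commute (M.vertexOp v g) (M.plaqProj p) := by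
  let c : G := if M.dsrc (M.site p) = v then g else 1
  rw [plaqProj_eq, Commute, SemiconjBy, Finset.mul_sum, Finset.sum_mul]
  refine Fintype.sum_equiv (MulAut.conj c).toEquiv _ _ fun h => ?_
  have h1 : M.vertexOp v g * M.holProj p h⁻¹ =
      M.holProj p (MulAut.conj c h)⁻¹ * M.vertexOp v g := by
    rw [holProj_eq_linkDiag, holProj_eq_linkDiag, vertexOp]
    refine linkMatterOp_mul_linkDiag _ fun x => ?_
    rw [M.hol_gauge v g x (M.isPath_bdryWalk _), MulAut.conj_apply]
    congr 1
    refine propext ?_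
    change _ ↔ c * _ * c⁻¹ = _
    constructor
    · intro h
      rw [h]
      group
    · intro h
      have := congrArg (fun a => c⁻¹ * a * c) h
      simpa [mul_assoc] using this
  have h2 : M.vertexOp v g * matterOp p ((M.matter p).B h) =
      matterOp p ((M.matter p).B (MulAut.conj c h)) * M.vertexOp v g := by
    simp only [vertexOp, matterOp, linkMatterOp_mul, Function.comp_id, Function.id_comp]
    congr 1
    funext q
    by_cases hq : q = p
    · subst hq
      simp only [Function.update_self, MulAut.conj_apply, c]
      split_ifs
      · exact (M.matter q).A_mul_B _ _
      · simp
    · simp [hq]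
  rw [show (MulAut.conj c).toEquiv h = MulAut.conj c h from rfl]
  rw [← mul_assoc, h1, mul_assoc, h2, mul_assoc]

theorem vertexProj_commute_plaqProj (v : V) (p : P) :
    Commute (M.vertexProj v) (M.plaqProj p) :=
  Commute.smul_left (Commute.sum_left _ _ _ fun g _ => M.vertexOp_commute_plaqProj v g p) _

end Model

end Model

end DoublyGauged

noncomputable section

/-! ### Geometry of the cut: fluxes, spine and twists. -/

namespace DoublyGauged

/-- Both lists are strictly increasing with the same members. This lets paths along the cut be
extended one plaquette at a time. -/
theorem filter_finRange_eq_append {n : ℕ} {q q' : Fin n → Prop} [DecidablePred q]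
    [DecidablePred q'] (j : Fin n) (h : ∀ k, q k ↔ q' k ∨ k = j) (h' : ∀ k, q' k → k < j) :
    (List.finRange n).filter (fun k => q k) = (List.finRange n).filter (fun k => q' k) ++ [j] := by
  have hs := List.pairwise_lt_finRange n
  refine List.Pairwise.eq_of_mem_iff (r := (· < ·)) (hs.filter _) ?_ fun k => ?_
  · rw [List.pairwise_append]
    refine ⟨hs.filter _, List.pairwise_singleton _ _, fun a ha k hk => ?_⟩
    obtain rfl := List.mem_singleton.1 hk
    exact h' a (by simpa using ha)
  · simp [h]

section Cut

variable {G V L P : Type*} [Group G] [Fintype V] [Fintype L] [Fintype P] [DecidableEq L]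

namespace IntervalCut

variable {Λ : DiskLattice V L P} {b : Finset V} (c : IntervalCut Λ b)

theorem dsrc_spoke_mem (i : Fin (c.n + 1)) : Λ.dsrc (c.spoke i) ∈ b :=
  ((c.exists_spoke_iff _).1 ⟨i, rfl⟩).1

theorem dtgt_spoke_notMem (i : Fin (c.n + 1)) : Λ.dtgt (c.spoke i) ∉ b :=
  ((c.exists_spoke_iff _).1 ⟨i, rfl⟩).2

theorem spoke_eq_of_link_eq {d : Dart L} {i : Fin (c.n + 1)} (h : (c.spoke i).1 = d.1) :
    d = c.spoke i ∨ d = rev (c.spoke i) := by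
  obtain ⟨ℓ, s⟩ := d
  generalize c.spoke i = e at h ⊢
  obtain ⟨ℓ', s'⟩ := e
  obtain rfl : ℓ' = ℓ := h
  cases s <;> cases s' <;> simp [rev]

theorem spoke_link_injective : Function.Injective fun i => (c.spoke i).1 := by
  intro i j h
  rcases c.spoke_eq_of_link_eq (d := c.spoke j) h with h | h
  · exact c.spoke_injective h.symm
  · have := c.dsrc_spoke_mem j
    rw [h, DiskLattice.dsrc_rev] at this
    exact (c.dtgt_spoke_notMem i this).elim

theorem spoke_ne_of_mem {d : Dart L} (h : Λ.dsrc d ∈ b ∧ Λ.dtgt d ∈ b) (i : Fin (c.n + 1)) :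
    (c.spoke i).1 ≠ d.1 := by
  intro h'
  rcases c.spoke_eq_of_link_eq h' with rfl | rfl
  · exact c.dtgt_spoke_notMem i h.2
  · rw [DiskLattice.dsrc_rev] at h
    exact c.dtgt_spoke_notMem i h.1

theorem spoke_ne_of_notMem {d : Dart L} (h : Λ.dsrc d ∉ b ∧ Λ.dtgt d ∉ b) (i : Fin (c.n + 1)) :
    (c.spoke i).1 ≠ d.1 := by
  intro h'
  rcases c.spoke_eq_of_link_eq h' with rfl | rfl
  · exact h.1 (c.dsrc_spoke_mem i)
  · rw [DiskLattice.dtgt_rev] at h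
    exact h.2 (c.dsrc_spoke_mem i)

theorem isPath_outer_inner (i : Fin c.n) :
    Λ.IsPath (Λ.dtgt (c.spoke i.castSucc)) (c.outer i) (Λ.dtgt (c.spoke i.succ)) ∧
      Λ.IsPath (Λ.dsrc (c.spoke i.succ)) (c.inner i) (Λ.dsrc (c.spoke i.castSucc)) := by
  have h := Λ.isPath_bdryWalk (c.spoke i.castSucc)
  rw [c.walk] at h
  obtain ⟨-, h⟩ := h
  obtain ⟨v, h1, h2, h3⟩ := Λ.isPath_append.1 h
  rw [DiskLattice.dsrc_rev] at h2
  rw [DiskLattice.dtgt_rev] at h3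
  exact ⟨h2 ▸ h1, h3⟩

/-- A plaquette that meets `b` and its complement is one of those that the cut crosses. -/
theorem exists_plaq_eq {p : P} {d d' : Dart L} (hd : Λ.face d = some p) (hd' : Λ.face d' = some p)
    (h : Λ.dsrc d ∈ b) (h' : Λ.dsrc d' ∉ b) : ∃ i, c.plaq i = p := by
  by_contra hne
  -- Walk around the face from a corner in `b`. The first dart that leaves `b` would be a spoke with
  -- `p` to its left; the last spoke has the exterior there, so `p` would be one of the crossed
  -- plaquettes.
  refine h' (Λ.face_induction (q := fun e => Λ.face e = some p ∧ Λ.dsrc e ∈ b)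
    (fun e he => ⟨by rw [Λ.face_next, he.1], ?_⟩) (hd.trans hd'.symm) ⟨hd, h⟩).2
  rw [Λ.dsrc_next]
  by_contra hb
  obtain ⟨i, rfl⟩ := (c.exists_spoke_iff e).2 ⟨he.2, hb⟩
  rcases Fin.eq_castSucc_or_eq_last i with ⟨j, rfl⟩ | rfl
  · rw [c.face_spoke] at he
    exact hne ⟨j, Option.some_injective _ he.1⟩
  · rw [c.face_last] at he
    simp at he

/-- The parallel transport from the outer end of the `i + 1`-st spoke to that of the `i`-th, through
the region. -/
def flux (x : L → G) (i : Fin c.n) : G :=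
  (dartVal x (c.spoke i.succ))⁻¹ * hol x (c.inner i) * dartVal x (c.spoke i.castSucc)

theorem hol_bdryWalk_spoke (x : L → G) (i : Fin c.n) :
    hol x (Λ.bdryWalk (c.spoke i.castSucc)) = dartVal x (c.spoke i.castSucc) * hol x (c.outer i) *
      (dartVal x (c.spoke i.succ))⁻¹ * hol x (c.inner i) := by
  rw [c.walk, hol_cons, hol_append, hol_cons, dartVal_rev]
  group

/-- This separates the flatness of a crossed plaquette into a quantity of the region, the flux, and
a quantity outside it, the holonomy of `outer i`. -/
theorem hol_bdryWalk_spoke_eq_one_iff (x : L → G) (i : Fin c.n) :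
    hol x (Λ.bdryWalk (c.spoke i.castSucc)) = 1 ↔ c.flux x i = (hol x (c.outer i))⁻¹ := by
  have : hol x (Λ.bdryWalk (c.spoke i.castSucc)) = dartVal x (c.spoke i.castSucc) *
      (hol x (c.outer i) * c.flux x i) * (dartVal x (c.spoke i.castSucc))⁻¹ := by
    rw [hol_bdryWalk_spoke, flux]
    group
  rw [this, mul_inv_eq_one, mul_eq_left, mul_eq_one_iff_inv_eq, eq_comm]

/-- The part of the spine between the first spoke and the `i`-th. -/
def spinePath (i : Fin (c.n + 1)) : List (Dart L) :=
  ((List.finRange c.n).filter fun k => k.castSucc < i).flatMap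
    fun k => ((c.inner k).map rev).reverse

/-- The path-ordered product along the spine from the first spoke to the `i`-th. -/
def spineHol (x : L → G) (i : Fin (c.n + 1)) : G := hol x (c.spinePath i)

theorem spineHol_zero (x : L → G) : c.spineHol x 0 = 1 := by
  have : (List.finRange c.n).filter (fun k => k.castSucc < 0) = [] := by
    rw [List.filter_eq_nil_iff]
    simp
  rw [spineHol, spinePath, this, List.flatMap_nil, hol_nil]

theorem spineHol_succ (x : L → G) (i : Fin c.n) :
    c.spineHol x i.succ = c.spineHol x i.castSucc * (hol x (c.inner i))⁻¹ := by
  have : c.spinePath i.succ = c.spinePath i.castSucc ++ ((c.inner i).map rev).reverse := by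
    simp only [spinePath]
    rw [filter_finRange_eq_append (q' := fun k : Fin c.n => k.castSucc < i.castSucc) i,
      List.flatMap_append, List.flatMap_singleton]
    · intro k
      simp only [Fin.lt_def, Fin.ext_iff, Fin.val_castSucc, Fin.val_succ]
      omega
    · intro k hk
      simpa using hk
  rw [spineHol, this, hol_append, hol_reverse, spineHol]

theorem hol_outerPath_self (x : L → G) (i : Fin (c.n + 1)) : hol x (c.outerPath i i) = 1 := by
  have : (List.finRange c.n).filter (fun k => i ≤ k.castSucc ∧ k.castSucc < i) = [] := by
    rw [List.filter_eq_nil_iff]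
    intro k _
    simp only [decide_eq_true_eq, not_and, not_lt]
    exact id
  rw [outerPath, this, List.flatMap_nil, hol_nil]

theorem hol_outerPath_succ (x : L → G) {i : Fin (c.n + 1)} {j : Fin c.n} (hij : i ≤ j.castSucc) :
    hol x (c.outerPath i j.succ) = hol x (c.outerPath i j.castSucc) * hol x (c.outer j) := by
  rw [← hol_append]
  congr 1
  simp only [outerPath]
  rw [filter_finRange_eq_append (q' := fun k : Fin c.n => i ≤ k.castSucc ∧ k.castSucc < j.castSucc)
    j, List.flatMap_append, List.flatMap_singleton]
  · intro k
    simp only [Fin.lt_def, Fin.le_def, Fin.ext_iff, Fin.val_castSucc, Fin.val_succ] at hij ⊢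
    omega
  · intro k hk
    simpa using hk.2

theorem hol_outerPath (x : L → G) {i j : Fin (c.n + 1)} (h : i ≤ j) :
    hol x (c.outerPath 0 j) = hol x (c.outerPath 0 i) * hol x (c.outerPath i j) := by
  induction j using Fin.induction with
  | zero =>
    obtain rfl : i = 0 := by simpa using h
    rw [hol_outerPath_self, mul_one]
  | succ j ih =>
    rcases h.eq_or_lt with rfl | h
    · rw [hol_outerPath_self, mul_one]
    · have h := Fin.le_castSucc_iff.2 h
      rw [c.hol_outerPath_succ x (Fin.zero_le _), c.hol_outerPath_succ x h, ih h, mul_assoc]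

theorem spineHol_congr {x y : L → G} (h : ∀ i, ∀ d ∈ c.inner i, x d.1 = y d.1)
    (i : Fin (c.n + 1)) : c.spineHol x i = c.spineHol y i := by
  induction i using Fin.induction with
  | zero => simp only [spineHol_zero]
  | succ i ih =>
    rw [spineHol_succ, spineHol_succ, ih,hol_congr (h i)]

open Classical in
/-- The map of the basis labels that underlies the ribbon operators. -/
def twist (w : G) (x : L → G) : L → G := fun ℓ =>
  if h : ∃ i, (c.spoke i).1 = ℓ then
    let a := (c.spineHol x h.choose)⁻¹ * w * c.spineHol x h.choose
    -- For a spoke that points against its link, left multiplication of the spoke by `a` is right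
    -- multiplication of the link by `a⁻¹`.
    if (c.spoke h.choose).2 then a * x ℓ else x ℓ * a⁻¹
  else x ℓ

theorem twist_of_ne (w : G) (x : L → G) {ℓ : L} (h : ∀ i, (c.spoke i).1 ≠ ℓ) :
    c.twist w x ℓ = x ℓ := by
  rw [twist, dif_neg]
  simpa using h

theorem dartVal_twist (w : G) (x : L → G) (i : Fin (c.n + 1)) :
    dartVal (c.twist w x) (c.spoke i) =
      (c.spineHol x i)⁻¹ * w * c.spineHol x i * dartVal x (c.spoke i) := by
  have h : ∃ j, (c.spoke j).1 = (c.spoke i).1 := ⟨i, rfl⟩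
  have hi : h.choose = i := c.spoke_link_injective h.choose_spec
  simp only [dartVal, twist, dif_pos h, hi]
  split_ifs <;> simp [mul_assoc]

theorem eq_twist_iff (w : G) (x y : L → G) : y = c.twist w x ↔
    (∀ i, dartVal y (c.spoke i) =
      (c.spineHol x i)⁻¹ * w * c.spineHol x i * dartVal x (c.spoke i)) ∧
      ∀ ℓ, (∀ i, (c.spoke i).1 ≠ ℓ) → y ℓ = x ℓ := by
  constructor
  · rintro rfl
    exact ⟨c.dartVal_twist w x, fun ℓ h => c.twist_of_ne w x h⟩
  · rintro ⟨h1, h2⟩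
    funext ℓ
    by_cases h : ∃ i, (c.spoke i).1 = ℓ
    · obtain ⟨i, rfl⟩ := h
      have := (h1 i).trans (c.dartVal_twist w x i).symm
      simp only [dartVal] at this
      split_ifs at this
      · exact this
      · exact inv_injective this
    · push Not at h
      rw [h2 ℓ h, c.twist_of_ne w x h]

theorem hol_twist (w : G) (x : L → G) {ρ : List (Dart L)}
    (h : ∀ d ∈ ρ, ∀ i, (c.spoke i).1 ≠ d.1) : hol (c.twist w x) ρ = hol x ρ :=
  hol_congr fun d hd => c.twist_of_ne w x (h d hd)

/-- The factors on two consecutive spokes differ by conjugation with the inner path between them, so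
the twist conjugates the holonomy of the crossed plaquette by the factor on its first spoke. -/
theorem hol_twist_bdryWalk_spoke (w : G) (x : L → G) (i : Fin c.n) :
    hol (c.twist w x) (Λ.bdryWalk (c.spoke i.castSucc)) = 1 ↔
      hol x (Λ.bdryWalk (c.spoke i.castSucc)) = 1 := by
  let a := (c.spineHol x i.castSucc)⁻¹ * w * c.spineHol x i.castSucc
  have : hol (c.twist w x) (Λ.bdryWalk (c.spoke i.castSucc)) =
      a * hol x (Λ.bdryWalk (c.spoke i.castSucc)) * a⁻¹ := by
    simp only [hol_bdryWalk_spoke, dartVal_twist,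
      c.hol_twist w x fun d hd => c.spoke_ne_of_mem (c.inner_mem i d hd),
      c.hol_twist w x fun d hd => c.spoke_ne_of_notMem (c.outer_notMem i d hd), spineHol_succ, a]
    group
  rw [this, mul_inv_eq_one, mul_eq_left]

end IntervalCut

end Cut

end DoublyGauged

end

noncomputable section

namespace DoublyGauged

/-! ### Gauge transformations of the cut links, and the constraints of the region. -/

variable {G V L P : Type*} [Group G] [Fintype G] [DecidableEq G] [Fintype V] [DecidableEq V]
  [Fintype L] [DecidableEq L] [Fintype P] [DecidableEq P] {κ : P → Type*}
  [∀ p, Fintype (κ p)] [∀ p, DecidableEq (κ p)]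

/-- A gauge parameter, set to `1` on `b`. -/
def outsideGauge (b : Finset V) (g : V → G) : V → G := fun v => if v ∈ b then 1 else g v

theorem outsideGauge_mul (b : Finset V) (g h : V → G) :
    outsideGauge b (g * h) = outsideGauge b g * outsideGauge b h := by
  funext v
  simp only [outsideGauge, Pi.mul_apply]
  split_ifs <;> simp

theorem outsideGauge_one (b : Finset V) : outsideGauge b (1 : V → G) = 1 := by
  funext v
  simp [outsideGauge]

theorem noncommProd_mul_of_forall {ι R : Type*} [Monoid R] (s : Finset ι) (f : ι → R) (comm)
    {X : R} (h : ∀ i ∈ s, f i * X = X) : s.noncommProd f comm * X = X := by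
  refine Finset.noncommProd_induction s f comm (fun Y => Y * X = X) (fun Y Z hY hZ => ?_)
    (one_mul X) h
  rw [mul_assoc, hZ, hY]

theorem mul_noncommProd_of_mem {ι R : Type*} [DecidableEq ι] [Monoid R] (s : Finset ι) (f : ι → R)
    (comm) {X : R} {i : ι} (hi : i ∈ s) (h : X * f i = f i) :
    X * s.noncommProd f comm = s.noncommProd f comm := by
  rw [← Finset.mul_noncommProd_erase _ hi, ← mul_assoc, h]

theorem noncommProd_isHermitian {ι n : Type*} [Fintype n] [DecidableEq n] (s : Finset ι)
    (f : ι → Matrix n n ℂ) (comm) (h : ∀ i ∈ s, (f i).IsHermitian) :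
    (s.noncommProd f comm).IsHermitian := by
  induction s using Finset.cons_induction with
  | empty => simp
  | cons a s ha ih =>
    rw [Finset.noncommProd_cons, Matrix.IsHermitian, Matrix.conjTranspose_mul,
      (h a (Finset.mem_cons_self _ _)).eq, (ih _ fun i hi => h i (Finset.mem_cons_of_mem hi)).eq]
    refine (Finset.noncommProd_commute _ _ _ _ fun i hi => ?_).eq.symm
    exact comm (Finset.mem_cons_self _ _) (Finset.mem_cons_of_mem hi)
      (by rintro rfl; exact ha hi)

theorem mem_bulk_inter {ι : Type*} [Fintype ι] [DecidableEq ι] {s t : Finset ι} {i : ι} :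
    i ∈ sᶜ ∩ t ↔ i ∈ t ∧ i ∉ s := by
  rw [Finset.mem_inter, Finset.mem_compl, and_comm]

namespace Model

variable (M : Model G V L P κ)

theorem dart_link_mem_regionLinks {b : Finset V} (d : Dart L) :
    d.1 ∈ M.regionLinks b ↔ M.dsrc d ∈ b ∨ M.dtgt d ∈ b := by
  obtain ⟨ℓ, _ | _⟩ := d <;>
    simp [regionLinks, DiskLattice.dsrc, DiskLattice.dtgt, dartSrc, dartTgt, or_comm]

theorem mem_regionPlaqs {b : Finset V} {p : P} :
    p ∈ M.regionPlaqs b ↔ ∀ d, M.face d = some p → M.dsrc d ∈ b := by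
  simp [regionPlaqs]

theorem mem_of_mem_bdryWalk {b : Finset V} {p : P} (h : ∀ d, M.face d = some p → M.dsrc d ∈ b)
    {d : Dart L} (hd : d ∈ M.bdryWalk (M.site p)) : M.dsrc d ∈ b ∧ M.dtgt d ∈ b := by
  have hf := (M.face_of_mem_bdryWalk hd).trans (M.face_site p)
  exact ⟨h d hf, M.dsrc_next d ▸ h _ ((M.face_next d).trans hf)⟩

theorem notMem_of_mem_bdryWalk {b : Finset V} {p : P} (h : ∀ d, M.face d = some p → M.dsrc d ∉ b)
    {d : Dart L} (hd : d ∈ M.bdryWalk (M.site p)) : M.dsrc d ∉ b ∧ M.dtgt d ∉ b := by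
  have hf := (M.face_of_mem_bdryWalk hd).trans (M.face_site p)
  exact ⟨h d hf, M.dsrc_next d ▸ h _ ((M.face_next d).trans hf)⟩

theorem hol_gaugeOn_outsideGauge {b : Finset V} {S : Finset L} (g : V → G) (x : L → G)
    {ρ : List (Dart L)} (h : ∀ d ∈ ρ, M.dsrc d ∈ b ∧ M.dtgt d ∈ b) :
    hol (M.gaugeOn S (outsideGauge b g) x) ρ = hol x ρ := by
  refine hol_congr fun d hd => ?_
  have hb : M.src d.1 ∈ b ∧ M.tgt d.1 ∈ b := by
    have := h _ hd
    obtain ⟨ℓ, _ | _⟩ := d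
    · exact this.symm
    · exact this
  simp [DiskLattice.gaugeOn, outsideGauge, hb]

/-- The gauge transformation by `g` outside `b`, restricted to the cut links. -/
def cutOp (b : Finset V) (g : V → G) : Matrix (Config G L κ) (Config G L κ) ℂ :=
  linkMatterOp (M.gaugeOn (M.regionLinks b) (outsideGauge b g)) 1

theorem cutOp_mul (b : Finset V) (g h : V → G) :
    M.cutOp b g * M.cutOp b h = M.cutOp b (g * h) := by
  simp only [cutOp, linkMatterOp_mul, outsideGauge_mul]
  congr 1
  · funext x
    rw [DiskLattice.gaugeOn_mul, Function.comp_apply]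
  · funext p
    simp

theorem cutOp_one (b : Finset V) : M.cutOp b 1 = 1 := by
  rw [← linkMatterOp_one, cutOp, outsideGauge_one]
  congr 1
  funext x
  rw [DiskLattice.gaugeOn_one, id]

theorem cutOp_inv_mul (b : Finset V) (g : V → G) : M.cutOp b g⁻¹ * M.cutOp b g = 1 := by
  rw [cutOp_mul, inv_mul_cancel, cutOp_one]

theorem cutOp_conjTranspose (b : Finset V) (g : V → G) :
    (M.cutOp b g).conjTranspose = M.cutOp b g⁻¹ := by
  refine linkMatterOp_conjTranspose (fun x y => ?_) fun p => ?_
  · constructor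
    · rintro rfl
      rw [← DiskLattice.gaugeOn_mul, ← outsideGauge_mul, inv_mul_cancel, outsideGauge_one,
        DiskLattice.gaugeOn_one]
    · rintro rfl
      rw [← DiskLattice.gaugeOn_mul, ← outsideGauge_mul, mul_inv_cancel, outsideGauge_one,
        DiskLattice.gaugeOn_one]
  · simp

theorem gaugeOn_linkMatterOp_mem_localAlgebra {S : Finset L} {T : Finset P} (g : V → G)
    {N : ∀ p, Matrix (κ p) (κ p) ℂ} (hN : ∀ p ∉ T, N p = 1) :
    linkMatterOp (M.gaugeOn S g) N ∈ localAlgebra κ S T := by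
  refine linkMatterOp_mem_localAlgebra (fun x ℓ hℓ => M.gaugeOn_apply_of_notMem g x hℓ)
    (fun x y h ℓ hℓ => ?_) hN
  simp only [DiskLattice.gaugeOn, h ℓ hℓ]

theorem cutOp_mem_localAlgebra (b : Finset V) (g : V → G) :
    M.cutOp b g ∈ localAlgebra κ (M.regionLinks b) (M.regionPlaqs b) :=
  M.gaugeOn_linkMatterOp_mem_localAlgebra _ fun _ _ => rfl

theorem cutOp_commute_vertexProj {b : Finset V} (g : V → G) {v : V} (hv : v ∈ b) :
    Commute (M.cutOp b g) (M.vertexProj v) := by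
  refine Commute.smul_right (Commute.sum_right _ _ _ fun a _ => ?_) _
  simp only [Commute, SemiconjBy, cutOp, vertexOp, linkMatterOp_mul]
  congr 1
  · funext x
    simp only [Function.comp_apply, gauge_eq_gaugeOn]
    refine M.gaugeOn_comm _ _ (fun u => ?_) x
    by_cases hu : u ∈ b
    · simp [outsideGauge, hu]
    · rw [Pi.mulSingle_eq_of_ne (by rintro rfl; exact hu hv)]
      exact Commute.one_right _
  · funext p
    simp

theorem cutOp_commute_plaqProj {b : Finset V} (g : V → G) {p : P} (hp : p ∈ M.regionPlaqs b) :
    Commute (M.cutOp b g) (M.plaqProj p) :=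
  M.linkMatterOp_commute_plaqProj fun x => M.hol_gaugeOn_outsideGauge g x fun _ hd =>
    M.mem_of_mem_bdryWalk (M.mem_regionPlaqs.1 hp) hd

/-! ### Products of constraints -/

/-- The product of the Gauss projectors of the bulk vertices in `b`. -/
def regionGauss (b : Finset V) : Matrix (Config G L κ) (Config G L κ) ℂ :=
  (M.Vbdryᶜ ∩ b).noncommProd M.vertexProj fun _ _ _ _ h => M.vertexProj_commute h

/-- The product of the flatness projectors of the bulk plaquettes of the region. -/
def regionFlat (b : Finset V) : Matrix (Config G L κ) (Config G L κ) ℂ :=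
  (M.Pbdryᶜ ∩ M.regionPlaqs b).noncommProd M.plaqProj fun _ _ _ _ h => M.plaqProj_commute h

theorem commute_regionGauss {b : Finset V} {X : Matrix (Config G L κ) (Config G L κ) ℂ}
    (h : ∀ v ∈ b, v ∉ M.Vbdry → Commute X (M.vertexProj v)) : Commute X (M.regionGauss b) :=
  Finset.noncommProd_commute _ _ _ _ fun v hv => h v (mem_bulk_inter.1 hv).1 (mem_bulk_inter.1 hv).2

theorem commute_regionFlat {b : Finset V} {X : Matrix (Config G L κ) (Config G L κ) ℂ}
    (h : ∀ p ∈ M.regionPlaqs b, p ∉ M.Pbdry → Commute X (M.plaqProj p)) :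
    Commute X (M.regionFlat b) :=
  Finset.noncommProd_commute _ _ _ _ fun p hp => h p (mem_bulk_inter.1 hp).1 (mem_bulk_inter.1 hp).2

/-- The product of all constraints of the region. -/
def regionProj (b : Finset V) : Matrix (Config G L κ) (Config G L κ) ℂ :=
  M.regionGauss b * M.regionFlat b

theorem commute_regionProj {b : Finset V} {X : Matrix (Config G L κ) (Config G L κ) ℂ}
    (hA : ∀ v ∈ b, v ∉ M.Vbdry → Commute X (M.vertexProj v))
    (hB : ∀ p ∈ M.regionPlaqs b, p ∉ M.Pbdry → Commute X (M.plaqProj p)) :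
    Commute X (M.regionProj b) :=
  (M.commute_regionGauss hA).mul_right (M.commute_regionFlat hB)

theorem vertexProj_commute' (v w : V) : Commute (M.vertexProj v) (M.vertexProj w) := by
  by_cases h : v = w
  · exact h ▸ Commute.refl _
  · exact M.vertexProj_commute h

theorem plaqProj_commute' (p q : P) : Commute (M.plaqProj p) (M.plaqProj q) := by
  by_cases h : p = q
  · exact h ▸ Commute.refl _
  · exact M.plaqProj_commute h

theorem vertexProj_commute_regionProj (b : Finset V) (v : V) :
    Commute (M.vertexProj v) (M.regionProj b) :=
  M.commute_regionProj (fun w _ _ => M.vertexProj_commute' v w)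
    fun p _ _ => M.vertexProj_commute_plaqProj v p

theorem plaqProj_commute_regionProj (b : Finset V) (p : P) :
    Commute (M.plaqProj p) (M.regionProj b) :=
  M.commute_regionProj (fun w _ _ => (M.vertexProj_commute_plaqProj w p).symm)
    fun q _ _ => M.plaqProj_commute' p q

theorem vertexProj_mul_regionProj {b : Finset V} {v : V} (hv : v ∈ b) (hv' : v ∉ M.Vbdry) :
    M.vertexProj v * M.regionProj b = M.regionProj b := by
  rw [regionProj, ← mul_assoc]
  congr 1
  exact mul_noncommProd_of_mem _ _ _ (mem_bulk_inter.2 ⟨hv, hv'⟩) (M.vertexProj_mul_self v)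

theorem plaqProj_mul_regionProj {b : Finset V} {p : P} (hp : p ∈ M.regionPlaqs b)
    (hp' : p ∉ M.Pbdry) : M.plaqProj p * M.regionProj b = M.regionProj b := by
  have hc : Commute (M.plaqProj p) (M.regionGauss b) :=
    M.commute_regionGauss fun v _ _ => (M.vertexProj_commute_plaqProj v p).symm
  rw [regionProj, ← mul_assoc, hc.eq, mul_assoc]
  congr 1
  exact mul_noncommProd_of_mem _ _ _ (mem_bulk_inter.2 ⟨hp, hp'⟩) (M.plaqProj_mul_self p)

theorem regionProj_mul_of_forall {b : Finset V} {X : Matrix (Config G L κ) (Config G L κ) ℂ}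
    (hA : ∀ v ∈ b, v ∉ M.Vbdry → M.vertexProj v * X = X)
    (hB : ∀ p ∈ M.regionPlaqs b, p ∉ M.Pbdry → M.plaqProj p * X = X) : M.regionProj b * X = X := by
  have h1 : M.regionGauss b * X = X := noncommProd_mul_of_forall _ _ _ fun v hv =>
    hA v (mem_bulk_inter.1 hv).1 (mem_bulk_inter.1 hv).2
  have h2 : M.regionFlat b * X = X := noncommProd_mul_of_forall _ _ _ fun p hp =>
    hB p (mem_bulk_inter.1 hp).1 (mem_bulk_inter.1 hp).2
  rw [regionProj, mul_assoc, h2, h1]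

theorem regionProj_mul_self (b : Finset V) : M.regionProj b * M.regionProj b = M.regionProj b :=
  M.regionProj_mul_of_forall (fun _ h h' => M.vertexProj_mul_regionProj h h')
    fun _ h h' => M.plaqProj_mul_regionProj h h'

theorem regionProj_isHermitian (b : Finset V) : (M.regionProj b).IsHermitian := by
  have h1 : (M.regionGauss b).IsHermitian :=
    noncommProd_isHermitian _ _ _ fun v _ => M.vertexProj_isHermitian v
  have h2 : (M.regionFlat b).IsHermitian :=
    noncommProd_isHermitian _ _ _ fun p _ => M.plaqProj_isHermitian p
  rw [regionProj, Matrix.IsHermitian, Matrix.conjTranspose_mul, h1.eq, h2.eq]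
  exact (M.commute_regionGauss fun v _ _ =>
    (M.commute_regionFlat fun p _ _ => M.vertexProj_commute_plaqProj v p).symm).eq

/-- The operator `AB`. -/
def physProj : Matrix (Config G L κ) (Config G L κ) ℂ := M.gaussProj * M.flatProj

theorem commute_gaussProj {X : Matrix (Config G L κ) (Config G L κ) ℂ}
    (h : ∀ v ∉ M.Vbdry, Commute X (M.vertexProj v)) : Commute X M.gaussProj :=
  Finset.noncommProd_commute _ _ _ _ fun v hv => h v (Finset.mem_compl.1 hv)

theorem commute_flatProj {X : Matrix (Config G L κ) (Config G L κ) ℂ}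
    (h : ∀ p ∉ M.Pbdry, Commute X (M.plaqProj p)) : Commute X M.flatProj :=
  Finset.noncommProd_commute _ _ _ _ fun p hp => h p (Finset.mem_compl.1 hp)

theorem vertexOp_mul_physProj {v : V} (hv : v ∉ M.Vbdry) (g : G) :
    M.vertexOp v g * M.physProj = M.physProj := by
  rw [physProj, ← mul_assoc]
  congr 1
  exact mul_noncommProd_of_mem _ _ _ (Finset.mem_compl.2 hv) (M.vertexOp_mul_vertexProj v g)

theorem plaqProj_mul_physProj {p : P} (hp : p ∉ M.Pbdry) :
    M.plaqProj p * M.physProj = M.physProj := by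
  have hc : Commute (M.plaqProj p) M.gaussProj :=
    M.commute_gaussProj fun v _ => (M.vertexProj_commute_plaqProj v p).symm
  rw [physProj, ← mul_assoc, hc.eq, mul_assoc]
  congr 1
  exact mul_noncommProd_of_mem _ _ _ (Finset.mem_compl.2 hp) (M.plaqProj_mul_self p)

theorem regionProj_mul_physProj (b : Finset V) : M.regionProj b * M.physProj = M.physProj :=
  M.regionProj_mul_of_forall
    (fun v _ hv => M.vertexProj_mul_of_forall v fun g => M.vertexOp_mul_physProj hv g)
    fun _ _ hp => M.plaqProj_mul_physProj hp

theorem regionProj_commute_physProj (b : Finset V) : Commute (M.regionProj b) M.physProj :=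
  (M.commute_gaussProj fun v _ => (M.vertexProj_commute_regionProj b v).symm).mul_right
    (M.commute_flatProj fun p _ => (M.plaqProj_commute_regionProj b p).symm)

theorem mem_preAlgebra_iff {b : Finset V} {O : Matrix (Config G L κ) (Config G L κ) ℂ} :
    O ∈ M.preAlgebra b ↔ O ∈ localAlgebra κ (M.regionLinks b) (M.regionPlaqs b) ∧
      Commute O M.gaussProj ∧ Commute O M.flatProj := by
  rw [preAlgebra, Algebra.mem_inf, Subalgebra.mem_centralizer_iff]
  simp only [Set.mem_insert_iff, Set.mem_singleton_iff, forall_eq_or_imp, forall_eq]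
  exact and_congr_right fun _ => ⟨fun h => ⟨h.1.symm, h.2.symm⟩, fun h => ⟨h.1.symm, h.2.symm⟩⟩

theorem commute_physProj_of_mem_preAlgebra {b : Finset V}
    {O : Matrix (Config G L κ) (Config G L κ) ℂ} (h : O ∈ M.preAlgebra b) :
    Commute O M.physProj := by
  rw [mem_preAlgebra_iff] at h
  exact h.2.1.mul_right h.2.2

/-- The plaquettes that bear a constraint and no matter have trivial holonomy. -/
def IsFlat (x : L → G) : Prop :=
  ∀ d p, M.face d = some p → p ∉ M.Pbdry → (M.matter p).IsTrivial → hol x (M.bdryWalk d) = 1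

theorem isFlat_of_physProj_ne_zero {x' x : Config G L κ} (h : M.physProj x' x ≠ 0) :
    M.IsFlat x'.1 := by
  intro d p hd hp hm
  rw [M.hol_bdryWalk_eq_one_iff x'.1 (hd.trans (M.face_site p).symm)]
  by_contra hne
  refine h ?_
  rw [← M.plaqProj_mul_physProj hp, M.plaqProj_eq_of_isTrivial hm, linkDiag, Matrix.diagonal_mul,
    if_neg hne, zero_mul]

/-- Operators with the same columns at the flat labels agree on the physical states. -/
theorem mul_physProj_congr {X Y : Matrix (Config G L κ) (Config G L κ) ℂ}
    (h : ∀ x' x, M.IsFlat x.1 → X x' x = Y x' x) : X * M.physProj = Y * M.physProj := by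
  ext x' x
  rw [Matrix.mul_apply, Matrix.mul_apply]
  refine Finset.sum_congr rfl fun y _ => ?_
  by_cases hy : M.physProj y x = 0
  · rw [hy, mul_zero, mul_zero]
  · rw [h x' y (M.isFlat_of_physProj_ne_zero hy)]

theorem IsContractible.hol_eq_one {M : Model G V L P κ} {ρ : List (Dart L)}
    (h : M.IsContractible ρ) {x : L → G} (hx : M.IsFlat x) : hol x ρ = 1 := by
  have hlift : ∀ σ : List (Dart L), FreeGroup.lift x (FreeGroup.mk σ) = hol x σ := by
    intro σ
    rw [FreeGroup.lift_mk, hol]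
    congr 1
    refine List.map_congr_left fun d _ => ?_
    obtain ⟨ℓ, _ | _⟩ := d <;> simp [dartVal]
  have hle : Subgroup.normalClosure {r : FreeGroup L | ∃ d p, M.face d = some p ∧ p ∉ M.Pbdry ∧
      (M.matter p).IsTrivial ∧ r = FreeGroup.mk (M.bdryWalk d)} ≤ (FreeGroup.lift x).ker := by
    refine Subgroup.normalClosure_le_normal ?_
    rintro _ ⟨d, p, h1, h2, h3, rfl⟩
    rw [SetLike.mem_coe, MonoidHom.mem_ker, hlift]
    exact hx d p h1 h2 h3
  have := hle h
  rwa [MonoidHom.mem_ker, hlift] at this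

end Model

/-! ### Action of outside gauge transformations on the fluxes. -/

namespace IntervalCut

variable {Λ : DiskLattice V L P} {b : Finset V} (c : IntervalCut Λ b)

/-- The action of the gauge transformations outside `b` on the fluxes of the cut. -/
def fluxAct (g : V → G) (k : Fin c.n → G) : Fin c.n → G := fun i =>
  g (Λ.dtgt (c.spoke i.succ)) * k i * (g (Λ.dtgt (c.spoke i.castSucc)))⁻¹

theorem fluxAct_mul (g h : V → G) (k : Fin c.n → G) :
    c.fluxAct (g * h) k = c.fluxAct g (c.fluxAct h k) := by
  funext i
  simp [fluxAct, mul_assoc]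

theorem fluxAct_one (k : Fin c.n → G) : c.fluxAct 1 k = k := by
  funext i
  simp [fluxAct]

theorem fluxAct_inv_eq_iff (g : V → G) (k k' : Fin c.n → G) :
    c.fluxAct g⁻¹ k = k' ↔ k = c.fluxAct g k' := by
  constructor
  · rintro rfl
    rw [← fluxAct_mul, mul_inv_cancel, fluxAct_one]
  · rintro rfl
    rw [← fluxAct_mul, inv_mul_cancel, fluxAct_one]

theorem fluxAct_injective (g : V → G) : Function.Injective (c.fluxAct g) := by
  intro k k' h
  rw [← fluxAct_inv_eq_iff, ← fluxAct_mul, inv_mul_cancel, fluxAct_one] at h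
  exact h

theorem fluxAct_const (u : G) : c.fluxAct (fun _ => u) 1 = 1 := by
  funext i
  simp [fluxAct]

/-- With trivial flux, invariance at the `i`-th plaquette says that `g` agrees at the two outer ends
there. So the stabilizer of the trivial fluxes consists of the `g` that are constant along the cut.
-/
theorem eq_const_of_fluxAct_one {g : V → G} (h : c.fluxAct g 1 = 1) (i : Fin (c.n + 1)) :
    g (Λ.dtgt (c.spoke i)) = g (Λ.dtgt (c.spoke 0)) := by
  induction i using Fin.induction with
  | zero => rfl
  | succ i ih =>
    rw [← ih]
    have := congrFun h i
    simpa [fluxAct, mul_inv_eq_one] using this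

theorem spineHol_mul_dartVal_succ (x : L → G) (i : Fin c.n) :
    c.spineHol x i.succ * dartVal x (c.spoke i.succ) =
      c.spineHol x i.castSucc * dartVal x (c.spoke i.castSucc) * (c.flux x i)⁻¹ := by
  rw [spineHol_succ, flux]
  group

end IntervalCut

/-! ### Cut gauge transformations and flux projectors as operators. -/

namespace Model

variable (M : Model G V L P κ) {b : Finset V} (c : IntervalCut M.toDiskLattice b)

theorem spoke_mem_regionLinks (i : Fin (c.n + 1)) : (c.spoke i).1 ∈ M.regionLinks b :=
  (M.dart_link_mem_regionLinks _).2 (Or.inl (c.dsrc_spoke_mem i))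

theorem dartVal_cutGauge (g : V → G) (x : L → G) (i : Fin (c.n + 1)) :
    dartVal (M.gaugeOn (M.regionLinks b) (outsideGauge b g) x) (c.spoke i) =
      dartVal x (c.spoke i) * (g (M.dtgt (c.spoke i)))⁻¹ := by
  rw [M.dartVal_gaugeOn _ _ (M.spoke_mem_regionLinks c i), outsideGauge, outsideGauge,
    if_pos (c.dsrc_spoke_mem i), if_neg (c.dtgt_spoke_notMem i), one_mul]

theorem cutGauge_of_ne (g : V → G) (x : L → G) {ℓ : L} (h : ∀ i, (c.spoke i).1 ≠ ℓ) :
    M.gaugeOn (M.regionLinks b) (outsideGauge b g) x ℓ = x ℓ := by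
  by_cases hℓ : ℓ ∈ M.regionLinks b
  · have h1 : M.src ℓ ∈ b ∧ M.tgt ℓ ∈ b := by
      by_contra hne
      have hs : ∀ d : Dart L, d.1 = ℓ → ¬(M.dsrc d ∈ b ∧ M.dtgt d ∉ b) := by
        rintro d rfl hd
        obtain ⟨i, rfl⟩ := (c.exists_spoke_iff d).2 hd
        exact h i rfl
      have h1 := hs (ℓ, true) rfl
      have h2 := hs (ℓ, false) rfl
      simp only [DiskLattice.dsrc, DiskLattice.dtgt, dartSrc, dartTgt, if_true,
        Bool.false_eq_true, if_false] at h1 h2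
      simp only [regionLinks, Finset.mem_filter, Finset.mem_univ, true_and] at hℓ
      tauto
    simp [DiskLattice.gaugeOn, outsideGauge, h1]
  · exact M.gaugeOn_apply_of_notMem _ _ hℓ

theorem flux_cutGauge (g : V → G) (x : L → G) :
    c.flux (M.gaugeOn (M.regionLinks b) (outsideGauge b g) x) = c.fluxAct g (c.flux x) := by
  funext i
  rw [IntervalCut.flux, dartVal_cutGauge, dartVal_cutGauge,
    M.hol_gaugeOn_outsideGauge g x (c.inner_mem i), IntervalCut.fluxAct, IntervalCut.flux]
  group

/-- A link of the region that is not a spoke has both ends in `b`, where the gauge parameter is set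
to `1`; so only the values at the outer ends of the spokes count. -/
theorem cutOp_congr {g h : V → G}
    (hgh : ∀ i, g (M.dtgt (c.spoke i)) = h (M.dtgt (c.spoke i))) : M.cutOp b g = M.cutOp b h := by
  rw [cutOp, cutOp]
  congr 1
  funext x ℓ
  by_cases hℓ : ∃ i, (c.spoke i).1 = ℓ
  · obtain ⟨i, rfl⟩ := hℓ
    have := (M.dartVal_cutGauge c g x i).trans
      ((congrArg _ (congrArg _ (hgh i))).trans (M.dartVal_cutGauge c h x i).symm)
    simp only [dartVal] at this
    split_ifs at this
    · exact this
    · exact inv_injective this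
  · push Not at hℓ
    rw [M.cutGauge_of_ne c g x hℓ, M.cutGauge_of_ne c h x hℓ]

/-- On labels whose fluxes it preserves, a gauge transformation of the cut links acts as a
twist. -/
theorem cutGauge_eq_twist {g : V → G} {x : L → G} (h : c.fluxAct g (c.flux x) = c.flux x) :
    M.gaugeOn (M.regionLinks b) (outsideGauge b g) x =
      c.twist (dartVal x (c.spoke 0) * (g (M.dtgt (c.spoke 0)))⁻¹ *
        (dartVal x (c.spoke 0))⁻¹) x := by
  rw [IntervalCut.eq_twist_iff]
  refine ⟨fun i => ?_, fun ℓ hℓ => M.cutGauge_of_ne c g x hℓ⟩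
  rw [dartVal_cutGauge, mul_assoc, mul_assoc, eq_inv_mul_iff_mul_eq]
  -- With `s`, `d` and `a` the spine product, the spoke value and the gauge parameter at the `i`-th
  -- outer end, the claim is `s d a⁻¹ = w s d`. From one spoke to the next, `s d` is multiplied on
  -- the right by the inverse flux and, by invariance of the fluxes, `a` is conjugated by the flux;
  -- both sides change alike.
  induction i using Fin.induction with
  | zero => simp [IntervalCut.spineHol_zero]
  | succ i ih =>
    have h1 := congrFun h i
    rw [IntervalCut.fluxAct] at h1
    have h2 : (g (M.dtgt (c.spoke i.succ)))⁻¹ =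
        c.flux x i * (g (M.dtgt (c.spoke i.castSucc)))⁻¹ * (c.flux x i)⁻¹ := by
      rw [mul_inv_eq_iff_eq_mul] at h1
      rw [inv_eq_iff_eq_inv, mul_inv_rev, mul_inv_rev, inv_inv, inv_inv, ← mul_assoc,
        eq_mul_inv_iff_mul_eq]
      exact h1
    rw [← mul_assoc, c.spineHol_mul_dartVal_succ, h2]
    rw [← mul_assoc] at ih
    calc _ = c.spineHol x i.castSucc * dartVal x (c.spoke i.castSucc) *
          (g (M.dtgt (c.spoke i.castSucc)))⁻¹ * (c.flux x i)⁻¹ := by group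
      _ = _ := by
        rw [ih]
        group

/-- The projector onto given fluxes of the cut. -/
def fluxProj (k : Fin c.n → G) : Matrix (Config G L κ) (Config G L κ) ℂ :=
  linkDiag κ fun x => if c.flux x = k then 1 else 0

theorem flux_congr {x y : L → G} (h : ∀ ℓ ∈ M.regionLinks b, x ℓ = y ℓ) : c.flux x = c.flux y := by
  funext i
  rw [IntervalCut.flux, IntervalCut.flux, dartVal_congr (h _ (M.spoke_mem_regionLinks c _)),
    dartVal_congr (h _ (M.spoke_mem_regionLinks c _)),
    hol_congr fun d hd => h d.1 ((M.dart_link_mem_regionLinks d).2 (Or.inl (c.inner_mem i d hd).1))]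

theorem fluxProj_mem_localAlgebra (k : Fin c.n → G) :
    M.fluxProj c k ∈ localAlgebra κ (M.regionLinks b) (M.regionPlaqs b) :=
  linkDiag_mem_localAlgebra _ fun x y h => by rw [M.flux_congr c h]

theorem fluxProj_mul (k k' : Fin c.n → G) :
    M.fluxProj c k * M.fluxProj c k' = if k = k' then M.fluxProj c k else 0 := by
  rw [fluxProj, fluxProj, linkDiag_mul]
  split_ifs with h
  · subst h
    congr 1
    funext x
    split_ifs <;> simp
  · have : (fun x : L → G => (if c.flux x = k then (1 : ℂ) else 0) * if c.flux x = k' then 1 else 0) =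
        fun _ => 0 := by
      funext x
      split_ifs with h1 h2
      · exact (h (h1.symm.trans h2)).elim
      all_goals simp
    rw [this, linkDiag, Matrix.diagonal_zero]

theorem sum_fluxProj : ∑ k, M.fluxProj c k = 1 := by
  ext x' x
  simp only [Matrix.sum_apply, fluxProj, linkDiag, Matrix.diagonal_apply, Matrix.one_apply]
  split_ifs <;> simp

theorem fluxProj_conjTranspose (k : Fin c.n → G) :
    (M.fluxProj c k).conjTranspose = M.fluxProj c k := by
  rw [fluxProj, linkDiag, Matrix.diagonal_conjTranspose]
  congr 1
  funext x
  simp [apply_ite]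

theorem cutOp_mul_fluxProj (g : V → G) (k : Fin c.n → G) :
    M.cutOp b g * M.fluxProj c k = M.fluxProj c (c.fluxAct g k) * M.cutOp b g := by
  refine linkMatterOp_mul_linkDiag _ fun x => ?_
  rw [flux_cutGauge]
  simp only [(c.fluxAct_injective g).eq_iff]

theorem fluxProj_mul_cutOp (g : V → G) (k : Fin c.n → G) :
    M.fluxProj c k * M.cutOp b g = M.cutOp b g * M.fluxProj c (c.fluxAct g⁻¹ k) := by
  rw [cutOp_mul_fluxProj, ← c.fluxAct_mul, mul_inv_cancel, c.fluxAct_one]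

/-! ### Locality of the constraints -/

/-- These three cases match the three ways a constraint meets the region: inside it, split by the
cut, or local outside. -/
theorem plaq_cases (p : P) : p ∈ M.regionPlaqs b ∨ (∃ i, c.plaq i = p) ∨
    (p ∉ M.regionPlaqs b ∧ ∀ d, M.face d = some p → M.dsrc d ∉ b) := by
  by_cases h : p ∈ M.regionPlaqs b
  · exact Or.inl h
  · refine Or.inr ?_
    by_contra hne
    rw [not_or] at hne
    refine hne.2 ⟨h, fun d hd hdb => hne.1 ?_⟩
    rw [mem_regionPlaqs] at h
    push Not at h
    obtain ⟨d', hd', hdb'⟩ := h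
    exact c.exists_plaq_eq hd hd' hdb hdb'

theorem plaqProj_plaq (hmatter : ∀ i, (M.matter (c.plaq i)).IsTrivial) (i : Fin c.n) :
    M.plaqProj (c.plaq i) =
      linkDiag κ fun x => if c.flux x i = (hol x (c.outer i))⁻¹ then 1 else 0 := by
  rw [M.plaqProj_eq_of_isTrivial (hmatter i)]
  congr 1
  funext x
  simp only [← c.hol_bdryWalk_spoke_eq_one_iff,
    M.hol_bdryWalk_eq_one_iff x ((M.face_site _).trans (c.face_spoke i).symm)]

/-- All links at `v` belong to the region. A plaquette outside the region with its site at `v` must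
be crossed by the cut, and there the matter is trivial. -/
theorem vertexProj_mem_localAlgebra (hmatter : ∀ i, (M.matter (c.plaq i)).IsTrivial) {v : V}
    (hv : v ∈ b) : M.vertexProj v ∈ localAlgebra κ (M.regionLinks b) (M.regionPlaqs b) := by
  refine Subalgebra.smul_mem _ (Subalgebra.sum_mem _ fun g _ => ?_) _
  refine linkMatterOp_mem_localAlgebra (fun x ℓ hℓ => ?_) (fun x y h ℓ hℓ => ?_) fun p hp => ?_
  · simp only [regionLinks, Finset.mem_filter, Finset.mem_univ, true_and, not_or] at hℓ
    have h1 : M.src ℓ ≠ v := by rintro rfl; exact hℓ.1 hv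
    have h2 : M.tgt ℓ ≠ v := by rintro rfl; exact hℓ.2 hv
    simp [gauge, h1, h2]
  · simp only [gauge, h ℓ hℓ]
  · split_ifs with h
    · rcases M.plaq_cases c p with h1 | ⟨i, rfl⟩ | h1
      · exact (hp h1).elim
      · exact (hmatter i).2.1 g
      · exact (h1.2 _ (M.face_site p) (h ▸ hv)).elim
    · rfl

theorem matterOp_mem_localAlgebra {S : Finset L} {T : Finset P} {p : P} (hp : p ∈ T)
    (N : Matrix (κ p) (κ p) ℂ) : (matterOp p N : Matrix (Config G L κ) _ ℂ) ∈ localAlgebra κ S T := by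
  refine linkMatterOp_mem_localAlgebra (fun _ _ _ => rfl) (fun _ _ h => h) fun q hq => ?_
  rw [Function.update_of_ne (by rintro rfl; exact hq hp), Pi.one_apply]

theorem plaqProj_mem_localAlgebra {S : Finset L} {T : Finset P} {p : P} (hp : p ∈ T)
    (h : ∀ d ∈ M.bdryWalk (M.site p), d.1 ∈ S) : M.plaqProj p ∈ localAlgebra κ S T := by
  rw [plaqProj_eq]
  refine Subalgebra.sum_mem _ fun k _ => Subalgebra.mul_mem _ ?_ (matterOp_mem_localAlgebra hp _)
  rw [holProj_eq_linkDiag]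
  exact linkDiag_mem_localAlgebra _ fun x y hxy => by rw [hol_congr fun d hd => hxy d.1 (h d hd)]

theorem plaqProj_mem_localAlgebra_of_mem {p : P} (hp : p ∈ M.regionPlaqs b) :
    M.plaqProj p ∈ localAlgebra κ (M.regionLinks b) (M.regionPlaqs b) :=
  M.plaqProj_mem_localAlgebra hp fun d hd => (M.dart_link_mem_regionLinks d).2
    (Or.inl (M.mem_of_mem_bdryWalk (M.mem_regionPlaqs.1 hp) hd).1)

theorem plaqProj_mem_localAlgebra_compl {p : P} (hp : p ∉ M.regionPlaqs b)
    (h : ∀ d, M.face d = some p → M.dsrc d ∉ b) :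
    M.plaqProj p ∈ localAlgebra κ (M.regionLinks b)ᶜ (M.regionPlaqs b)ᶜ :=
  M.plaqProj_mem_localAlgebra (Finset.mem_compl.2 hp) fun d hd => by
    rw [Finset.mem_compl, dart_link_mem_regionLinks, not_or]
    exact M.notMem_of_mem_bdryWalk h hd

theorem regionProj_mem_localAlgebra (hmatter : ∀ i, (M.matter (c.plaq i)).IsTrivial) :
    M.regionProj b ∈ localAlgebra κ (M.regionLinks b) (M.regionPlaqs b) :=
  Subalgebra.mul_mem _
    (Submonoid.noncommProd_mem (localAlgebra κ _ _).toSubmonoid _ _ _ fun _ hv =>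
      M.vertexProj_mem_localAlgebra c hmatter (mem_bulk_inter.1 hv).1)
    (Submonoid.noncommProd_mem (localAlgebra κ _ _).toSubmonoid _ _ _ fun _ hp =>
      M.plaqProj_mem_localAlgebra_of_mem (mem_bulk_inter.1 hp).1)

theorem cutOp_commute_regionProj (g : V → G) : Commute (M.cutOp b g) (M.regionProj b) :=
  M.commute_regionProj (fun _ hv _ => M.cutOp_commute_vertexProj g hv)
    fun _ hp _ => M.cutOp_commute_plaqProj g hp

/-- A flux is a transport between two points outside `b`, so gauge transformations in `b` cancel
along it. -/
theorem flux_gauge {v : V} (hv : v ∈ b) (g : G) (x : L → G) : c.flux (M.gauge v g x) = c.flux x := by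
  have hne : ∀ i, M.dtgt (c.spoke i) ≠ v := by
    rintro i rfl
    exact c.dtgt_spoke_notMem i hv
  funext i
  rw [IntervalCut.flux, M.dartVal_gauge, M.dartVal_gauge, M.hol_gauge v g x (c.isPath_outer_inner i).2,
    if_neg (hne _), if_neg (hne _), IntervalCut.flux]
  group

theorem fluxProj_commute_regionProj (k : Fin c.n → G) :
    Commute (M.fluxProj c k) (M.regionProj b) := by
  refine M.commute_regionProj (fun v hv _ => ?_) fun p _ _ => M.linkDiag_commute_plaqProj _ p
  refine Commute.smul_right (Commute.sum_right _ _ _ fun a _ => ?_) _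
  refine (linkMatterOp_mul_linkDiag (κ := κ) _ fun x => ?_).symm
  rw [M.flux_gauge c hv]

/-- A Gauss operator outside `b` is the product of its action on the cut links and of one that is
local outside the region. -/
theorem exists_vertexOp_eq {v : V} (hv : v ∉ b) (a : G) :
    ∃ C ∈ localAlgebra κ (M.regionLinks b)ᶜ (M.regionPlaqs b)ᶜ,
      M.vertexOp v a = M.cutOp b (Pi.mulSingle v a) * C := by
  refine ⟨linkMatterOp (M.gaugeOn (M.regionLinks b)ᶜ (Pi.mulSingle v a))
    (fun p => if M.dsrc (M.site p) = v then (M.matter p).A a else 1),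
    M.gaugeOn_linkMatterOp_mem_localAlgebra _ fun p hp => ?_, ?_⟩
  · rw [Finset.mem_compl, not_not] at hp
    refine if_neg ?_
    rintro rfl
    exact hv (M.mem_regionPlaqs.1 hp _ (M.face_site p))
  · have : outsideGauge b (Pi.mulSingle v a) = Pi.mulSingle v a := by
      funext u
      by_cases hu : u ∈ b
      · rw [outsideGauge, if_pos hu, Pi.mulSingle_eq_of_ne (by rintro rfl; exact hv hu)]
      · rw [outsideGauge, if_neg hu]
    rw [cutOp, this, linkMatterOp_mul, vertexOp]
    congr 1
    · funext x
      rw [Function.comp_apply, M.gaugeOn_compl, gauge_eq_gaugeOn]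
    · funext p
      rw [Pi.one_apply, one_mul]

/-- Gauss's law at the outer ends, used to undo a transformation of the cut links by an operator
that commutes with everything local in the region. -/
theorem exists_cutOp_mul_physProj (hends : ∀ i, M.dtgt (c.spoke i) ∉ M.Vbdry) (g : V → G) :
    ∃ C ∈ localAlgebra κ (M.regionLinks b)ᶜ (M.regionPlaqs b)ᶜ,
      M.cutOp b g * C * M.physProj = M.physProj := by
  -- The parameters with this property are closed under products, because the outside factors
  -- commute with `cutOp`. So it is enough to treat parameters supported at one vertex: Gauss's law
  -- handles an outer end, and any other vertex does not affect the cut.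
  let H : Submonoid (V → G) :=
    { carrier := {g | ∃ C ∈ localAlgebra κ (M.regionLinks b)ᶜ (M.regionPlaqs b)ᶜ,
        M.cutOp b g * C * M.physProj = M.physProj}
      one_mem' := ⟨1, Subalgebra.one_mem _, by rw [cutOp_one, mul_one, one_mul]⟩
      mul_mem' := by
        rintro g h ⟨C, hC, hgC⟩ ⟨D, hD, hhD⟩
        refine ⟨C * D, Subalgebra.mul_mem _ hC hD, ?_⟩
        have hc := commute_of_mem_localAlgebra (M.cutOp_mem_localAlgebra b h) hC
        calc M.cutOp b (g * h) * (C * D) * M.physProj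
            = M.cutOp b g * (M.cutOp b h * C) * D * M.physProj := by
              rw [← cutOp_mul]
              noncomm_ring
          _ = M.cutOp b g * C * (M.cutOp b h * D * M.physProj) := by
              rw [hc.eq]
              noncomm_ring
          _ = _ := by rw [hhD, hgC] }
  refine Submonoid.pi_mem_of_mulSingle_mem (H := H) g fun v => ?_
  by_cases hv : ∃ i, M.dtgt (c.spoke i) = v
  · obtain ⟨i, rfl⟩ := hv
    obtain ⟨C, hC, h⟩ := M.exists_vertexOp_eq (c.dtgt_spoke_notMem i) (g (M.dtgt (c.spoke i)))
    exact ⟨C, hC, by rw [← h, M.vertexOp_mul_physProj (hends i)]⟩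
  · push Not at hv
    refine ⟨1, Subalgebra.one_mem _, ?_⟩
    rw [M.cutOp_congr c (h := 1), cutOp_one, mul_one, one_mul]
    intro i
    rw [Pi.mulSingle_eq_of_ne (hv i), Pi.one_apply]

/-- On physical states the fluxes of the cut can be read off outside the region. -/
theorem exists_fluxProj_mul_physProj (hbulk : ∀ i, c.plaq i ∉ M.Pbdry)
    (hmatter : ∀ i, (M.matter (c.plaq i)).IsTrivial) (k : Fin c.n → G) :
    ∃ C ∈ localAlgebra κ (M.regionLinks b)ᶜ (M.regionPlaqs b)ᶜ,
      M.fluxProj c k * M.physProj = C * M.physProj := by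
  refine ⟨linkDiag κ fun x => if (fun i => (hol x (c.outer i))⁻¹) = k then 1 else 0,
    linkDiag_mem_localAlgebra _ fun x y h => ?_, M.mul_physProj_congr fun x' x hx => ?_⟩
  · have : ∀ i, hol x (c.outer i) = hol y (c.outer i) := fun i => hol_congr fun d hd => by
      refine h d.1 ?_
      rw [Finset.mem_compl, dart_link_mem_regionLinks, not_or]
      exact c.outer_notMem i d hd
    simp only [this]
  · have : c.flux x.1 = fun i => (hol x.1 (c.outer i))⁻¹ := by
      funext i
      rw [← c.hol_bdryWalk_spoke_eq_one_iff]
      exact hx _ _ (c.face_spoke i) (hbulk i) (hmatter i)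
    by_cases h1 : x' = x
    · subst h1
      simp only [fluxProj, linkDiag, Matrix.diagonal_apply_eq, this]
    · simp only [fluxProj, linkDiag, Matrix.diagonal_apply_ne _ h1]

end Model

/-! ### The class operators -/

-- The two averages agree because every element of the class is hit equally often. The sum over the
-- whole group is what gauge averages produce.
open Classical in
theorem average_conjClass {W : Type*} [AddCommGroup W] [Module ℂ W] (f : G → W) (h : G) :
    ((Finset.univ.filter fun w => IsConj h w).card : ℂ)⁻¹ •
        ∑ w ∈ Finset.univ.filter (fun w => IsConj h w), f w =
      (Fintype.card G : ℂ)⁻¹ • ∑ u, f (u * h * u⁻¹) := by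
  set s := Finset.univ.filter fun w => IsConj h w with hs
  have hG : (Fintype.card G : ℂ) ≠ 0 := Nat.cast_ne_zero.2 Fintype.card_ne_zero
  have hcard : (s.card : ℂ) ≠ 0 := by
    rw [Nat.cast_ne_zero, Finset.card_ne_zero]
    exact ⟨h, Finset.mem_filter.2 ⟨Finset.mem_univ h, IsConj.refl h⟩⟩
  have h1 : ∀ u : G, ∑ w ∈ s, f w = ∑ w ∈ s, f (u * w * u⁻¹) := by
    intro u
    have hconj : ∀ w v : G, w ∈ s → v * w * v⁻¹ ∈ s := by
      intro w v hw
      simp only [hs, Finset.mem_filter, Finset.mem_univ, true_and] at hw ⊢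
      exact hw.trans (isConj_iff.2 ⟨v, rfl⟩)
    refine Finset.sum_bij' (fun w _ => u⁻¹ * w * u) (fun w _ => u * w * u⁻¹)
      (fun w hw => by simpa using hconj w u⁻¹ hw) (fun w hw => hconj w u hw) ?_ ?_ ?_ <;>
    · intro w hw
      simp [mul_assoc]
  have h2 : ∀ w ∈ s, ∑ u, f (u * w * u⁻¹) = ∑ u, f (u * h * u⁻¹) := by
    intro w hw
    simp only [hs, Finset.mem_filter, Finset.mem_univ, true_and] at hw
    obtain ⟨v, rfl⟩ := isConj_iff.1 hw
    exact Fintype.sum_equiv (Equiv.mulRight v) _ _ fun u => by simp [mul_assoc]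
  have h3 : (Fintype.card G : ℂ) • ∑ w ∈ s, f w = (s.card : ℂ) • ∑ u, f (u * h * u⁻¹) := by
    calc (Fintype.card G : ℂ) • ∑ w ∈ s, f w = ∑ u : G, ∑ w ∈ s, f (u * w * u⁻¹) := by
          rw [← Finset.sum_congr rfl fun u _ => h1 u, Finset.sum_const, Finset.card_univ,
            Nat.cast_smul_eq_nsmul]
      _ = _ := by
          rw [Finset.sum_comm, Finset.sum_congr rfl h2, Finset.sum_const, Nat.cast_smul_eq_nsmul]
  rw [inv_smul_eq_iff₀ hcard, smul_comm, ← h3, smul_smul, inv_mul_cancel₀ hG, one_smul]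

namespace Model

variable (M : Model G V L P κ) {b : Finset V} (c : IntervalCut M.toDiskLattice b)

/-- The operator that underlies the ribbon operators. -/
def twistOp (w : G) : Matrix (Config G L κ) (Config G L κ) ℂ := linkMatterOp (c.twist w) 1

/-- Summing over `g` removes the projection onto a spine product and leaves a permutation-like
operator that acts on links only. -/
theorem sum_op_ribbon (w : G) : ∑ g, (c.ribbon.op w g : Matrix (Config G L κ) _ ℂ) =
    M.twistOp c w := by
  ext x' x
  have hiff := c.eq_twist_iff w x.1 x'.1
  have h2 : ∏ p, (1 : ∀ p, Matrix (κ p) (κ p) ℂ) p (x'.2 p) (x.2 p) =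
      if x'.2 = x.2 then 1 else 0 := by
    simp only [Pi.one_apply, Matrix.one_apply, Finset.prod_ite_zero, Finset.prod_const_one,
      Finset.mem_univ, true_implies, funext_iff]
  rw [Matrix.sum_apply, twistOp, linkMatterOp, Matrix.of_apply, h2]
  simp only [Ribbon.op, Matrix.of_apply]
  by_cases h : x'.1 = c.twist w x.1 ∧ x'.2 = x.2
  · rw [if_pos h.1, if_pos h.2, Finset.sum_eq_single (hol x.1 c.ribbon.fullSpine)]
    · exact if_pos ⟨rfl, (hiff.1 h.1).1, (hiff.1 h.1).2, h.2⟩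
    · intro g _ hg
      exact if_neg fun hh => hg hh.1.symm
    · simp
  · rw [Finset.sum_eq_zero]
    · split_ifs with h3 h4
      · exact (h ⟨h3, h4⟩).elim
      all_goals rfl
    · intro g _
      exact if_neg fun hh => h ⟨hiff.2 ⟨hh.2.1, hh.2.2.1⟩, hh.2.2.2⟩

theorem classOp_ribbon (h : G) : c.ribbon.classOp κ h =
    (Fintype.card G : ℂ)⁻¹ • ∑ u, M.twistOp c (u * h * u⁻¹) := by
  rw [← average_conjClass, Ribbon.classOp]
  simp only [← sum_op_ribbon]

theorem twistOp_mem_localAlgebra (w : G) :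
    M.twistOp c w ∈ localAlgebra κ (M.regionLinks b) (M.regionPlaqs b) := by
  refine linkMatterOp_mem_localAlgebra (fun x ℓ hℓ => c.twist_of_ne w x ?_)
    (fun x y h ℓ hℓ => ?_) fun _ _ => rfl
  · rintro i rfl
    exact hℓ (M.spoke_mem_regionLinks c i)
  · have : ∀ i, c.spineHol x i = c.spineHol y i := c.spineHol_congr fun i d hd =>
      h d.1 ((M.dart_link_mem_regionLinks d).2 (Or.inl (c.inner_mem i d hd).1))
    simp only [IntervalCut.twist, this, h ℓ hℓ]

theorem spineHol_gauge (v : V) (g : G) (x : L → G) (i : Fin (c.n + 1)) :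
    c.spineHol (M.gauge v g x) i = (if M.dsrc (c.spoke 0) = v then g else 1) * c.spineHol x i *
      (if M.dsrc (c.spoke i) = v then g else 1)⁻¹ := by
  induction i using Fin.induction with
  | zero => simp [IntervalCut.spineHol_zero]
  | succ i ih =>
    rw [c.spineHol_succ, c.spineHol_succ, ih, M.hol_gauge v g x (c.isPath_outer_inner i).2]
    group

/-- The parameter `w` sits at the first vertex of the spine and is transported from there to every
spoke, so a gauge transformation can only conjugate it, and only at that vertex. Averages over
conjugates are therefore gauge invariant. -/
theorem gauge_twist (v : V) (g w : G) (x : L → G) :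
    M.gauge v g (c.twist w x) = c.twist ((if M.dsrc (c.spoke 0) = v then g else 1) * w *
      (if M.dsrc (c.spoke 0) = v then g else 1)⁻¹) (M.gauge v g x) := by
  rw [IntervalCut.eq_twist_iff]
  refine ⟨fun i => ?_, fun ℓ hℓ => ?_⟩
  · rw [dartVal_gauge, dartVal_gauge, spineHol_gauge, IntervalCut.dartVal_twist]
    group
  · simp only [gauge, c.twist_of_ne w x hℓ]

theorem classOp_commute_vertexProj (h : G) (v : V) :
    Commute (c.ribbon.classOp κ h) (M.vertexProj v) := by
  refine Commute.smul_right (Commute.sum_right _ _ _ fun g _ => ?_) _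
  rw [classOp_ribbon]
  refine Commute.smul_left ?_ _
  let e : G := if M.dsrc (c.spoke 0) = v then g else 1
  rw [Commute, SemiconjBy, Finset.sum_mul, Finset.mul_sum, eq_comm]
  refine Fintype.sum_equiv (Equiv.mulLeft e) _ _ fun u => ?_
  simp only [twistOp, vertexOp, linkMatterOp_mul]
  congr 1
  · funext x
    rw [Function.comp_apply, Function.comp_apply, gauge_twist]
    simp only [Equiv.coe_mulLeft, mul_inv_rev, mul_assoc, e]
  · funext p
    simp

theorem classOp_commute_plaqProj (hmatter : ∀ i, (M.matter (c.plaq i)).IsTrivial) (h : G) (p : P) :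
    Commute (c.ribbon.classOp κ h) (M.plaqProj p) := by
  rw [M.classOp_ribbon]
  refine Commute.smul_left (Commute.sum_left _ _ _ fun u _ => ?_) _
  rcases M.plaq_cases c p with hp | ⟨i, rfl⟩ | hp
  · exact M.linkMatterOp_commute_plaqProj fun x => c.hol_twist _ x fun d hd =>
      c.spoke_ne_of_mem (M.mem_of_mem_bdryWalk (M.mem_regionPlaqs.1 hp) hd)
  · rw [M.plaqProj_eq_of_isTrivial (hmatter i)]
    refine linkMatterOp_mul_linkDiag _ fun x => ?_
    have hface := (M.face_site (c.plaq i)).trans (c.face_spoke i).symm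
    simp only [M.hol_bdryWalk_eq_one_iff _ hface, c.hol_twist_bdryWalk_spoke]
  · exact M.linkMatterOp_commute_plaqProj fun x => c.hol_twist _ x fun d hd =>
      c.spoke_ne_of_notMem (M.notMem_of_mem_bdryWalk hp.2 hd)

theorem classOp_mem_preAlgebra (hmatter : ∀ i, (M.matter (c.plaq i)).IsTrivial) (h : G) :
    c.ribbon.classOp κ h ∈ M.preAlgebra b := by
  rw [mem_preAlgebra_iff]
  refine ⟨?_, M.commute_gaussProj fun v _ => M.classOp_commute_vertexProj c h v,
    M.commute_flatProj fun p _ => M.classOp_commute_plaqProj c hmatter h p⟩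
  rw [M.classOp_ribbon]
  exact Subalgebra.smul_mem _ (Subalgebra.sum_mem _ fun u _ => M.twistOp_mem_localAlgebra c _) _

/-! ### Fluxes of flat labels -/

/-- Flatness of the crossed plaquettes turns each flux into an inverse outer holonomy. These are
differences of the potential `t i`, the transport outside from the first outer end to the `i`-th.
One vertex may be the outer end of several spokes; contractibility of the loop between them makes
`t` a function of the vertex. -/
theorem exists_flux_eq (hbulk : ∀ i, c.plaq i ∉ M.Pbdry)
    (hmatter : ∀ i, (M.matter (c.plaq i)).IsTrivial) (hdisk : M.Unpinched c) {x : L → G}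
    (hx : M.IsFlat x) : ∃ g : V → G, c.flux x = c.fluxAct g 1 := by
  classical
  let t : Fin (c.n + 1) → G := fun i => hol x (c.outerPath 0 i)
  have hlt : ∀ i j, i < j → M.dtgt (c.spoke i) = M.dtgt (c.spoke j) → t i = t j := by
    intro i j hij h
    have h1 := (hdisk i j hij h).hol_eq_one hx
    simp only [t]
    rw [c.hol_outerPath x hij.le, h1, mul_one]
  have heq : ∀ i j, M.dtgt (c.spoke i) = M.dtgt (c.spoke j) → t i = t j := by
    intro i j h
    rcases lt_trichotomy i j with hij | rfl | hij
    · exact hlt i j hij h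
    · rfl
    · exact (hlt j i hij h.symm).symm
  let g : V → G := fun v => if h : ∃ i, M.dtgt (c.spoke i) = v then (t h.choose)⁻¹ else 1
  have hg : ∀ i, g (M.dtgt (c.spoke i)) = (t i)⁻¹ := by
    intro i
    have h : ∃ j, M.dtgt (c.spoke j) = M.dtgt (c.spoke i) := ⟨i, rfl⟩
    simp only [g, dif_pos h]
    rw [heq _ _ h.choose_spec]
  refine ⟨g, funext fun i => ?_⟩
  have h1 : hol x (M.bdryWalk (c.spoke i.castSucc)) = 1 :=
    hx _ _ (c.face_spoke i) (hbulk i) (hmatter i)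
  rw [c.hol_bdryWalk_spoke_eq_one_iff] at h1
  have h2 : t i.succ = t i.castSucc * hol x (c.outer i) :=
    c.hol_outerPath_succ x (Fin.zero_le _)
  rw [IntervalCut.fluxAct, hg, hg, h1, h2, Pi.one_apply]
  group

/-- The `g` with `g·1 = k` form a coset of the stabilizer of the trivial fluxes, whence the
cardinality. Constants lie in this stabilizer, so the coset is stable under right multiplication by
any constant `u`, and averaging over `u` makes `y * g v` uniform on `G`. -/
theorem sum_ite_fluxAct {k : Fin c.n → G} (hk : ∃ g : V → G, k = c.fluxAct g 1) (y : G)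
    (v : V) (φ : G → ℂ) : ∑ g : V → G, (if k = c.fluxAct g 1 then φ (y * g v) else 0) =
      ((Finset.univ.filter fun g : V → G => c.fluxAct g 1 = 1).card : ℂ) *
        ((Fintype.card G : ℂ)⁻¹ * ∑ u, φ u) := by
  have hG : (Fintype.card G : ℂ) ≠ 0 := Nat.cast_ne_zero.2 Fintype.card_ne_zero
  have h1 : ∀ u : G, ∑ g : V → G, (if k = c.fluxAct g 1 then φ (y * g v) else 0) =
      ∑ g : V → G, (if k = c.fluxAct g 1 then φ (y * g v * u) else 0) := by
    intro u
    refine (Fintype.sum_equiv (Equiv.mulRight fun _ : V => u) _ _ fun g => ?_).symm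
    simp only [Equiv.coe_mulRight, c.fluxAct_mul, c.fluxAct_const, Pi.mul_apply, mul_assoc]
  have h2 : ∑ g : V → G, (if k = c.fluxAct g 1 then (1 : ℂ) else 0) =
      (Finset.univ.filter fun g : V → G => c.fluxAct g 1 = 1).card := by
    obtain ⟨g₀, rfl⟩ := hk
    rw [← Finset.sum_boole]
    refine Fintype.sum_equiv (Equiv.mulLeft g₀⁻¹) _ _ fun g => ?_
    simp only [Equiv.coe_mulLeft, c.fluxAct_mul, c.fluxAct_inv_eq_iff]
    simp only [eq_comm]
  have h3 : (Fintype.card G : ℂ) *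
      ∑ g : V → G, (if k = c.fluxAct g 1 then φ (y * g v) else 0) =
      ((Finset.univ.filter fun g : V → G => c.fluxAct g 1 = 1).card : ℂ) * ∑ u, φ u := by
    rw [← h2, Finset.sum_mul, ← nsmul_eq_mul, ← Finset.card_univ, ← Finset.sum_const,
      Finset.sum_congr rfl fun u _ => h1 u, Finset.sum_comm]
    refine Finset.sum_congr rfl fun g _ => ?_
    split_ifs
    · rw [one_mul]
      exact Fintype.sum_equiv (Equiv.mulLeft (y * g v)) _ _ fun u => rfl
    · simp
  rw [mul_left_comm, ← h3, inv_mul_cancel_left₀ hG]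

/-- On physical states a class operator is, up to normalization, an average of gauge
transformations of the cut links. -/
theorem sum_cutOp_mul_fluxProj (hbulk : ∀ i, c.plaq i ∉ M.Pbdry)
    (hmatter : ∀ i, (M.matter (c.plaq i)).IsTrivial) (hdisk : M.Unpinched c) (h : G) :
    (∑ g : V → G, M.cutOp b (g * (fun _ => h) * g⁻¹) * M.fluxProj c (c.fluxAct g 1)) * M.physProj =
      ((Finset.univ.filter fun g : V → G => c.fluxAct g 1 = 1).card : ℂ) •
        (c.ribbon.classOp κ h⁻¹ * M.physProj) := by
  rw [← smul_mul_assoc]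
  refine M.mul_physProj_congr fun x' x hx => ?_
  have key := M.sum_ite_fluxAct c (M.exists_flux_eq c hbulk hmatter hdisk hx)
    (dartVal x.1 (c.spoke 0)) (M.dtgt (c.spoke 0)) fun u => M.twistOp c (u * h⁻¹ * u⁻¹) x' x
  rw [classOp_ribbon, Matrix.smul_apply, Matrix.smul_apply, Matrix.sum_apply, Matrix.sum_apply,
    smul_eq_mul, smul_eq_mul, ← key]
  refine Finset.sum_congr rfl fun g _ => ?_
  rw [fluxProj, linkDiag, Matrix.mul_diagonal]
  -- If the flux is `g·1`, the parameter `g h g⁻¹` fixes it, so the cut transformation is a twist.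
  -- Right multiplication of the first spoke value `y` by `(g h g⁻¹)⁻¹` is left multiplication by
  -- the conjugate of `h⁻¹` by `y g`; this is where the inverse comes from.
  split_ifs with hg
  · rw [mul_one, cutOp, twistOp, linkMatterOp, linkMatterOp, Matrix.of_apply, Matrix.of_apply,
      M.cutGauge_eq_twist c]
    · simp only [Pi.mul_apply, Pi.inv_apply, mul_inv_rev, inv_inv, mul_assoc]
    · rw [hg, ← c.fluxAct_mul]
      rw [show g * (fun _ => h) * g⁻¹ * g = g * fun _ => h by simp [mul_assoc], c.fluxAct_mul,
        c.fluxAct_const]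
  · rw [mul_zero]

/-! ### Averages over the gauge transformations of the cut -/

/-- The part of an operator that preserves the fluxes of the cut. -/
def fluxAvg (X : Matrix (Config G L κ) (Config G L κ) ℂ) : Matrix (Config G L κ) (Config G L κ) ℂ :=
  ∑ k, M.fluxProj c k * X * M.fluxProj c k

theorem fluxProj_commute_fluxAvg (k : Fin c.n → G) (X : Matrix (Config G L κ) (Config G L κ) ℂ) :
    Commute (M.fluxProj c k) (M.fluxAvg c X) := by
  rw [fluxAvg, Commute, SemiconjBy, Finset.mul_sum, Finset.sum_mul]
  refine Finset.sum_congr rfl fun k' _ => ?_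
  rw [← mul_assoc, ← mul_assoc, fluxProj_mul, mul_assoc _ _ (M.fluxProj c k), fluxProj_mul]
  by_cases h : k = k'
  · subst h
    simp
  · rw [if_neg h, if_neg (Ne.symm h)]
    simp

/-- The average of an operator over the gauge transformations of the cut links, after its restriction
to the part that preserves the fluxes. -/
def cutAvg : Matrix (Config G L κ) (Config G L κ) ℂ →ₗ[ℂ] Matrix (Config G L κ) (Config G L κ) ℂ where
  toFun X := (Fintype.card (V → G) : ℂ)⁻¹ • ∑ g, M.cutOp b g * M.fluxAvg c X * M.cutOp b g⁻¹
  map_add' X Y := by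
    rw [← smul_add, ← Finset.sum_add_distrib]
    simp only [fluxAvg, mul_add, add_mul, Finset.sum_add_distrib]
  map_smul' a X := by
    simp only [RingHom.id_apply, fluxAvg, mul_smul_comm, smul_mul_assoc, ← Finset.smul_sum]
    exact smul_comm _ _ _

theorem cutAvg_apply (X : Matrix (Config G L κ) (Config G L κ) ℂ) : M.cutAvg c X =
    (Fintype.card (V → G) : ℂ)⁻¹ • ∑ g, M.cutOp b g * M.fluxAvg c X * M.cutOp b g⁻¹ := rfl

theorem inv_card_smul_sum_const {ι W : Type*} [Fintype ι] [Nonempty ι] [AddCommGroup W] [Module ℂ W]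
    (X : W) : (Fintype.card ι : ℂ)⁻¹ • ∑ _i : ι, X = X := by
  rw [Finset.sum_const, Finset.card_univ, ← Nat.cast_smul_eq_nsmul ℂ, smul_smul, inv_mul_cancel₀,
    one_smul]
  exact Nat.cast_ne_zero.2 Fintype.card_ne_zero

theorem cutAvg_mem_localAlgebra {X : Matrix (Config G L κ) (Config G L κ) ℂ}
    (h : X ∈ localAlgebra κ (M.regionLinks b) (M.regionPlaqs b)) :
    M.cutAvg c X ∈ localAlgebra κ (M.regionLinks b) (M.regionPlaqs b) :=
  Subalgebra.smul_mem _ (Subalgebra.sum_mem _ fun g _ => Subalgebra.mul_mem _ (Subalgebra.mul_mem _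
    (M.cutOp_mem_localAlgebra b g) (Subalgebra.sum_mem _ fun k _ => Subalgebra.mul_mem _
      (Subalgebra.mul_mem _ (M.fluxProj_mem_localAlgebra c k) h) (M.fluxProj_mem_localAlgebra c k)))
    (M.cutOp_mem_localAlgebra b _)) _

theorem cutOp_commute_cutAvg (h : V → G) (X : Matrix (Config G L κ) (Config G L κ) ℂ) :
    Commute (M.cutOp b h) (M.cutAvg c X) := by
  rw [cutAvg_apply]
  refine Commute.smul_right ?_ _
  rw [Commute, SemiconjBy, Finset.mul_sum, Finset.sum_mul]
  refine Fintype.sum_equiv (Equiv.mulLeft h) _ _ fun g => ?_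
  rw [Equiv.coe_mulLeft, mul_assoc _ _ (M.cutOp b h), cutOp_mul, mul_inv_rev, inv_mul_cancel_right,
    ← mul_assoc, ← mul_assoc, cutOp_mul]

/-- The cut transformations permute the flux projectors, so conjugation by them keeps an operator
flux-preserving. This is why the restriction to equal fluxes is made before the gauge average. -/
theorem fluxProj_commute_cutAvg (k : Fin c.n → G) (X : Matrix (Config G L κ) (Config G L κ) ℂ) :
    Commute (M.fluxProj c k) (M.cutAvg c X) := by
  rw [cutAvg_apply]
  refine Commute.smul_right (Commute.sum_right _ _ _ fun g _ => ?_) _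
  rw [Commute, SemiconjBy, ← mul_assoc, ← mul_assoc, fluxProj_mul_cutOp, mul_assoc (M.cutOp b g),
    (M.fluxProj_commute_fluxAvg c _ X).eq, mul_assoc _ _ (M.fluxProj c k), cutOp_mul_fluxProj]
  noncomm_ring

theorem fluxAvg_mul_of_commute {X Y : Matrix (Config G L κ) (Config G L κ) ℂ}
    (h : ∀ k, Commute (M.fluxProj c k) Y) : M.fluxAvg c (X * Y) = M.fluxAvg c X * Y := by
  rw [fluxAvg, fluxAvg, Finset.sum_mul]
  refine Finset.sum_congr rfl fun k _ => ?_
  rw [mul_assoc _ _ Y, (h k).eq]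
  noncomm_ring

theorem mul_fluxAvg_of_commute {X Y : Matrix (Config G L κ) (Config G L κ) ℂ}
    (h : ∀ k, Commute (M.fluxProj c k) Y) : M.fluxAvg c (Y * X) = Y * M.fluxAvg c X := by
  rw [fluxAvg, fluxAvg, Finset.mul_sum]
  refine Finset.sum_congr rfl fun k _ => ?_
  rw [← mul_assoc, (h k).eq]
  noncomm_ring

/-- Together with its left-handed version this says that `cutAvg` is a conditional expectation onto
the commutant of the cut transformations and flux projectors. -/
theorem cutAvg_mul_of_commute {X Y : Matrix (Config G L κ) (Config G L κ) ℂ}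
    (hR : ∀ g, Commute (M.cutOp b g) Y) (hE : ∀ k, Commute (M.fluxProj c k) Y) :
    M.cutAvg c (X * Y) = M.cutAvg c X * Y := by
  rw [cutAvg_apply, cutAvg_apply, smul_mul_assoc, Finset.sum_mul, M.fluxAvg_mul_of_commute c hE]
  refine congrArg _ (Finset.sum_congr rfl fun g _ => ?_)
  rw [mul_assoc _ _ Y, (hR _).eq]
  noncomm_ring

theorem mul_cutAvg_of_commute {X Y : Matrix (Config G L κ) (Config G L κ) ℂ}
    (hR : ∀ g, Commute (M.cutOp b g) Y) (hE : ∀ k, Commute (M.fluxProj c k) Y) :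
    M.cutAvg c (Y * X) = Y * M.cutAvg c X := by
  rw [cutAvg_apply, cutAvg_apply, mul_smul_comm, Finset.mul_sum, M.mul_fluxAvg_of_commute c hE]
  refine congrArg _ (Finset.sum_congr rfl fun g _ => ?_)
  rw [← mul_assoc, (hR _).eq]
  noncomm_ring

theorem cutAvg_one : M.cutAvg c 1 = 1 := by
  have h : M.fluxAvg c 1 = 1 := by
    simp only [fluxAvg, mul_one, fluxProj_mul, if_true, sum_fluxProj]
  simp only [cutAvg_apply, h, mul_one, cutOp_mul, mul_inv_cancel, cutOp_one]
  exact inv_card_smul_sum_const _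

theorem cutAvg_eq_self {Y : Matrix (Config G L κ) (Config G L κ) ℂ}
    (hR : ∀ g, Commute (M.cutOp b g) Y) (hE : ∀ k, Commute (M.fluxProj c k) Y) :
    M.cutAvg c Y = Y := by
  have := M.cutAvg_mul_of_commute c (X := 1) hR hE
  rwa [one_mul, cutAvg_one, one_mul] at this

/-- Averaging does not change the action of a local operator on the physical states. -/
theorem cutAvg_mul_physProj (hbulk : ∀ i, c.plaq i ∉ M.Pbdry)
    (hmatter : ∀ i, (M.matter (c.plaq i)).IsTrivial) (hends : ∀ i, M.dtgt (c.spoke i) ∉ M.Vbdry)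
    {X : Matrix (Config G L κ) (Config G L κ) ℂ}
    (hX : X ∈ localAlgebra κ (M.regionLinks b) (M.regionPlaqs b)) (hc : Commute X M.physProj) :
    M.cutAvg c X * M.physProj = X * M.physProj := by
  have h1 : M.fluxAvg c X * M.physProj = M.physProj * X := by
    -- Next to `physProj`, the right-hand flux projector becomes an outside operator `C`. It passes
    -- through `X`, and turns back into the flux projector on the other side.
    have : ∀ k, M.fluxProj c k * X * M.fluxProj c k * M.physProj =
        M.fluxProj c k * (M.physProj * X) := by
      intro k
      obtain ⟨C, hC, hk⟩ := M.exists_fluxProj_mul_physProj c hbulk hmatter k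
      calc _ = M.fluxProj c k * X * (M.fluxProj c k * M.physProj) := by noncomm_ring
        _ = M.fluxProj c k * (X * C) * M.physProj := by
          rw [hk]
          noncomm_ring
        _ = M.fluxProj c k * C * (X * M.physProj) := by
          rw [(commute_of_mem_localAlgebra hX hC).eq]
          noncomm_ring
        _ = M.fluxProj c k * (C * M.physProj) * X := by
          rw [hc.eq]
          noncomm_ring
        _ = M.fluxProj c k * M.fluxProj c k * (M.physProj * X) := by
          rw [← hk]
          noncomm_ring
        _ = _ := by rw [fluxProj_mul, if_pos rfl]
    rw [fluxAvg, Finset.sum_mul, Finset.sum_congr rfl fun k _ => this k, ← Finset.sum_mul,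
      sum_fluxProj, one_mul]
  have hY : M.fluxAvg c X ∈ localAlgebra κ (M.regionLinks b) (M.regionPlaqs b) :=
    Subalgebra.sum_mem _ fun k _ => Subalgebra.mul_mem _
      (Subalgebra.mul_mem _ (M.fluxProj_mem_localAlgebra c k) hX) (M.fluxProj_mem_localAlgebra c k)
  have h2 : ∀ g, M.cutOp b g * M.fluxAvg c X * M.cutOp b g⁻¹ * M.physProj = M.physProj * X := by
    intro g
    obtain ⟨C, hC, hg⟩ := M.exists_cutOp_mul_physProj c hends g
    -- The same device for the gauge average: on physical states the inverse cut transformation is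
    -- an outside operator, which commutes with the local one.
    have hg' : M.cutOp b g⁻¹ * M.physProj = C * M.physProj := by
      conv_lhs => rw [← hg]
      rw [← mul_assoc, ← mul_assoc, cutOp_inv_mul, one_mul]
    calc _ = M.cutOp b g * M.fluxAvg c X * (M.cutOp b g⁻¹ * M.physProj) := by noncomm_ring
      _ = M.cutOp b g * (M.fluxAvg c X * C) * M.physProj := by
        rw [hg']
        noncomm_ring
      _ = M.cutOp b g * C * (M.fluxAvg c X * M.physProj) := by
        rw [(commute_of_mem_localAlgebra hY hC).eq]
        noncomm_ring
      _ = (M.cutOp b g * C * M.physProj) * X := by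
        rw [h1]
        noncomm_ring
      _ = _ := by rw [hg]
  rw [cutAvg_apply, smul_mul_assoc, Finset.sum_mul, Finset.sum_congr rfl fun g _ => h2 g, hc.eq]
  exact inv_card_smul_sum_const _

/-! ### Operators that commute with the constraints separately -/

/-- The constraints, cut off at the boundary of the region. -/
def cutConstraints : Set (Matrix (Config G L κ) (Config G L κ) ℂ) :=
  Set.range (M.cutOp b) ∪ Set.range (M.fluxProj c) ∪ {M.regionProj b}

theorem forall_cutConstraints {q : Matrix (Config G L κ) (Config G L κ) ℂ → Prop} :
    (∀ x ∈ M.cutConstraints c, q x) ↔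
      (∀ g, q (M.cutOp b g)) ∧ (∀ k, q (M.fluxProj c k)) ∧ q (M.regionProj b) := by
  simp only [cutConstraints, Set.mem_union, or_imp, forall_and, Set.forall_mem_range,
    Set.mem_singleton_iff, forall_eq, and_assoc]

/-- A local operator that commutes with the cut-off constraints becomes a physical operator of the
region after multiplication by the constraints of the region. -/
theorem mul_regionProj_mem_preAlgebra (hmatter : ∀ i, (M.matter (c.plaq i)).IsTrivial)
    {s : Matrix (Config G L κ) (Config G L κ) ℂ}
    (hs : s ∈ localAlgebra κ (M.regionLinks b) (M.regionPlaqs b))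
    (hc : ∀ x ∈ M.cutConstraints c, Commute x s) : s * M.regionProj b ∈ M.preAlgebra b := by
  obtain ⟨hR, hE, hQ⟩ := (M.forall_cutConstraints c).1 hc
  -- Constraints inside the region are absorbed by `regionProj`, with which `s` commutes; nothing is
  -- required of the commutator of `s` with a single one of them.
  have habs : ∀ Y : Matrix (Config G L κ) (Config G L κ) ℂ, Y * M.regionProj b = M.regionProj b →
      Commute Y (M.regionProj b) → Commute (s * M.regionProj b) Y := by
    intro Y h h'
    calc s * M.regionProj b * Y = s * (Y * M.regionProj b) := by rw [mul_assoc, h'.eq]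
      _ = Y * M.regionProj b * s := by rw [h, hQ.eq]
      _ = _ := by rw [mul_assoc, hQ.eq]
  rw [mem_preAlgebra_iff]
  refine ⟨Subalgebra.mul_mem _ hs (M.regionProj_mem_localAlgebra c hmatter),
    M.commute_gaussProj fun v hv => ?_, M.commute_flatProj fun p hp => ?_⟩
  · by_cases hvb : v ∈ b
    · exact habs _ (M.vertexProj_mul_regionProj hvb hv) (M.vertexProj_commute_regionProj b v)
    · refine Commute.mul_left ?_ (M.vertexProj_commute_regionProj b v).symm
      refine Commute.smul_right (Commute.sum_right _ _ _ fun a _ => ?_) _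
      obtain ⟨C, hC, h⟩ := M.exists_vertexOp_eq hvb a
      rw [h]
      exact (hR _).symm.mul_right (commute_of_mem_localAlgebra hs hC)
  · rcases M.plaq_cases c p with hpb | ⟨i, rfl⟩ | hpb
    · exact habs _ (M.plaqProj_mul_regionProj hpb hp) (M.plaqProj_commute_regionProj b p)
    · refine Commute.mul_left ?_ (M.plaqProj_commute_regionProj b _).symm
      -- Once the fluxes are fixed to `k`, the flatness condition only involves links outside the
      -- region, so the constraint is a sum of products of a flux projector and an outside operator.
      have : M.plaqProj (c.plaq i) = ∑ k, M.fluxProj c k *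
          linkDiag κ fun x => if k i = (hol x (c.outer i))⁻¹ then 1 else 0 := by
        calc M.plaqProj (c.plaq i) = ∑ k, M.fluxProj c k * M.plaqProj (c.plaq i) := by
              rw [← Finset.sum_mul, sum_fluxProj, one_mul]
          _ = _ := by
            refine Finset.sum_congr rfl fun k _ => ?_
            rw [M.plaqProj_plaq c hmatter, fluxProj, linkDiag_mul, linkDiag_mul]
            congr 1
            funext x
            by_cases hk : c.flux x = k
            · rw [if_pos hk, hk]
            · rw [if_neg hk, zero_mul, zero_mul]
      rw [this]
      refine Commute.sum_right _ _ _ fun k _ => (hE k).symm.mul_right ?_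
      refine commute_of_mem_localAlgebra hs (linkDiag_mem_localAlgebra _ fun x y h => ?_)
      have : hol x (c.outer i) = hol y (c.outer i) := hol_congr fun d hd => by
        refine h d.1 ?_
        rw [Finset.mem_compl, dart_link_mem_regionLinks, not_or]
        exact c.outer_notMem i d hd
      rw [this]
    · exact Commute.mul_left (commute_of_mem_localAlgebra hs
        (M.plaqProj_mem_localAlgebra_compl hpb.1 hpb.2)) (M.plaqProj_commute_regionProj b p).symm

/-- Every operator of the region acts on the physical states like one that commutes with the cut-off
constraints. -/
theorem exists_commute_cutConstraints (hbulk : ∀ i, c.plaq i ∉ M.Pbdry)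
    (hmatter : ∀ i, (M.matter (c.plaq i)).IsTrivial) (hends : ∀ i, M.dtgt (c.spoke i) ∉ M.Vbdry)
    {O : Matrix (Config G L κ) (Config G L κ) ℂ} (hO : O ∈ M.preAlgebra b) :
    ∃ s ∈ localAlgebra κ (M.regionLinks b) (M.regionPlaqs b),
      (∀ x ∈ M.cutConstraints c, Commute x s) ∧ s * M.physProj = O * M.physProj := by
  have hOp := M.commute_physProj_of_mem_preAlgebra hO
  have hQ := M.regionProj_mul_physProj b
  have hQ' : M.physProj * M.regionProj b = M.physProj := by
    rw [← (M.regionProj_commute_physProj b).eq, hQ]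
  -- Compression by the constraints of the region makes the operator commute with their product, and
  -- does not change its action on physical states.
  let X := M.regionProj b * O * M.regionProj b
  have hXl : X ∈ localAlgebra κ (M.regionLinks b) (M.regionPlaqs b) :=
    Subalgebra.mul_mem _ (Subalgebra.mul_mem _ (M.regionProj_mem_localAlgebra c hmatter)
      ((M.mem_preAlgebra_iff).1 hO).1) (M.regionProj_mem_localAlgebra c hmatter)
  have hX1 : X * M.physProj = O * M.physProj := by
    simp only [X]
    rw [mul_assoc, hQ, mul_assoc, hOp.eq, ← mul_assoc, hQ]
  have hX2 : M.physProj * X = O * M.physProj := by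
    simp only [X]
    rw [← mul_assoc, ← mul_assoc, hQ', ← hOp.eq, mul_assoc, hQ']
  have hRQ := fun g => M.cutOp_commute_regionProj (b := b) g
  have hEQ := fun k => M.fluxProj_commute_regionProj c k
  refine ⟨M.cutAvg c X, M.cutAvg_mem_localAlgebra c hXl,
    (M.forall_cutConstraints c).2 ⟨fun g => M.cutOp_commute_cutAvg c g X,
      fun k => M.fluxProj_commute_cutAvg c k X, ?_⟩, ?_⟩
  · rw [Commute, SemiconjBy, ← M.mul_cutAvg_of_commute c hRQ hEQ,
      ← M.cutAvg_mul_of_commute c hRQ hEQ]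
    refine congrArg _ ?_
    simp only [X]
    rw [mul_assoc _ (M.regionProj b), regionProj_mul_self, ← mul_assoc, ← mul_assoc,
      regionProj_mul_self]
  · rw [M.cutAvg_mul_physProj c hbulk hmatter hends hXl (hX1.trans hX2.symm), hX1]

/-- The span of the products of the cut-off constraints. -/
def cutSpan : Submodule ℂ (Matrix (Config G L κ) (Config G L κ) ℂ) :=
  Submodule.span ℂ {X | ∃ g k, X = M.cutOp b g * M.fluxProj c k ∨
    X = M.cutOp b g * M.fluxProj c k * M.regionProj b}

theorem one_mem_cutSpan : 1 ∈ M.cutSpan c := by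
  rw [← M.sum_fluxProj c]
  refine Submodule.sum_mem _ fun k _ => Submodule.subset_span ⟨1, k, Or.inl ?_⟩
  rw [cutOp_one, one_mul]

/-- Normal ordering: `cutOp` multiplies as a group and moves past flux projectors by permuting them,
while `regionProj` is an idempotent that commutes with both. -/
theorem mul_mem_cutSpan {x y : Matrix (Config G L κ) (Config G L κ) ℂ}
    (hx : x ∈ M.cutConstraints c) (hy : y ∈ M.cutSpan c) : x * y ∈ M.cutSpan c := by
  have hRE : ∀ g k, M.cutOp b g * M.fluxProj c k ∈ M.cutSpan c := fun g k =>
    Submodule.subset_span ⟨g, k, Or.inl rfl⟩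
  have hREQ : ∀ g k, M.cutOp b g * M.fluxProj c k * M.regionProj b ∈ M.cutSpan c := fun g k =>
    Submodule.subset_span ⟨g, k, Or.inr rfl⟩
  have hQ : ∀ g k, Commute (M.regionProj b) (M.cutOp b g * M.fluxProj c k) := fun g k =>
    (M.cutOp_commute_regionProj g).symm.mul_right (M.fluxProj_commute_regionProj c k).symm
  have hE : ∀ k g k', M.fluxProj c k * (M.cutOp b g * M.fluxProj c k') =
      if c.fluxAct g⁻¹ k = k' then M.cutOp b g * M.fluxProj c k' else 0 := by
    intro k g k'
    rw [← mul_assoc, fluxProj_mul_cutOp, mul_assoc, fluxProj_mul]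
    split_ifs with h
    · rw [h]
    · rw [mul_zero]
  induction hy using Submodule.span_induction with
  | zero => simp
  | add y z _ _ hy hz =>
    rw [mul_add]
    exact Submodule.add_mem _ hy hz
  | smul a y _ hy =>
    rw [mul_smul_comm]
    exact Submodule.smul_mem _ _ hy
  | mem y hy =>
    obtain ⟨g, k, hy⟩ := hy
    revert x
    rw [forall_cutConstraints]
    rcases hy with rfl | rfl
    · refine ⟨fun h => ?_, fun k' => ?_, ?_⟩
      · rw [← mul_assoc, cutOp_mul]
        exact hRE _ _
      · rw [hE]
        split_ifs
        · exact hRE _ _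
        · exact Submodule.zero_mem _
      · rw [(hQ g k).eq]
        exact hREQ _ _
    · refine ⟨fun h => ?_, fun k' => ?_, ?_⟩
      · rw [← mul_assoc, ← mul_assoc, cutOp_mul]
        exact hREQ _ _
      · rw [← mul_assoc, hE]
        split_ifs
        · exact hREQ _ _
        · rw [zero_mul]
          exact Submodule.zero_mem _
      · rw [← mul_assoc, (hQ g k).eq, mul_assoc, regionProj_mul_self]
        exact hREQ _ _

/-- The restriction to equal fluxes kills the product unless `g` fixes `k`. The gauge average then
runs over the orbit of the pair `(g, k)`, and only the orbit of the trivial flux is visible on flat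
labels. -/
theorem cutAvg_mul_mul_physProj_mem (hbulk : ∀ i, c.plaq i ∉ M.Pbdry)
    (hmatter : ∀ i, (M.matter (c.plaq i)).IsTrivial) (hdisk : M.Unpinched c)
    (g : V → G) (k : Fin c.n → G) :
    ∃ t ∈ Submodule.span ℂ (Set.range (c.ribbon.classOp (G := G) κ)),
      M.cutAvg c (M.cutOp b g * M.fluxProj c k) * M.physProj = t * M.physProj := by
  have hflux : M.fluxAvg c (M.cutOp b g * M.fluxProj c k) =
      if c.fluxAct g k = k then M.cutOp b g * M.fluxProj c k else 0 := by
    rw [fluxAvg, Finset.sum_eq_single k]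
    · rw [mul_assoc, mul_assoc _ _ (M.fluxProj c k), fluxProj_mul, if_pos rfl, ← mul_assoc,
        fluxProj_mul_cutOp, mul_assoc, fluxProj_mul]
      by_cases h : c.fluxAct g k = k
      · rw [if_pos h, if_pos ((c.fluxAct_inv_eq_iff g k k).2 h.symm), (c.fluxAct_inv_eq_iff g k k).2 h.symm]
      · rw [if_neg h, if_neg fun h' => h ((c.fluxAct_inv_eq_iff g k k).1 h').symm, mul_zero]
    · intro k' _ hk'
      rw [mul_assoc, mul_assoc _ _ (M.fluxProj c k'), fluxProj_mul, if_neg (Ne.symm hk'), mul_zero,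
        mul_zero]
    · simp
  by_cases hgk : c.fluxAct g k = k
  swap
  · refine ⟨0, Submodule.zero_mem _, ?_⟩
    rw [cutAvg_apply, hflux, if_neg hgk]
    simp
  have havg : M.cutAvg c (M.cutOp b g * M.fluxProj c k) = (Fintype.card (V → G) : ℂ)⁻¹ •
      ∑ h : V → G, M.cutOp b (h * g * h⁻¹) * M.fluxProj c (c.fluxAct h k) := by
    rw [cutAvg_apply, hflux, if_pos hgk]
    congr 1
    refine Finset.sum_congr rfl fun h _ => ?_
    rw [← mul_assoc, cutOp_mul, mul_assoc, fluxProj_mul_cutOp, inv_inv, ← mul_assoc, cutOp_mul]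
  rw [havg]
  by_cases hk : ∃ t : V → G, k = c.fluxAct t 1
  · obtain ⟨t, rfl⟩ := hk
    -- Moving the pair `(g, t·1)` back to trivial flux gives `(u, 1)`; as `u` fixes the trivial
    -- fluxes, it is a constant `a` along the cut. The shift `h ↦ h * t` of the summation variable
    -- then replaces `g` by this constant.
    let u : V → G := t⁻¹ * g * t
    have hu : c.fluxAct u 1 = 1 := by
      rw [c.fluxAct_mul, c.fluxAct_mul, hgk, c.fluxAct_inv_eq_iff]
    let a : G := u (M.dtgt (c.spoke 0))
    have hsum : ∑ h : V → G, M.cutOp b (h * g * h⁻¹) * M.fluxProj c (c.fluxAct h (c.fluxAct t 1)) =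
        ∑ h : V → G, M.cutOp b (h * (fun _ => a) * h⁻¹) * M.fluxProj c (c.fluxAct h 1) := by
      refine Fintype.sum_equiv (Equiv.mulRight t) _ _ fun h => ?_
      rw [Equiv.coe_mulRight, c.fluxAct_mul]
      congr 1
      refine M.cutOp_congr c fun i => ?_
      have := c.eq_const_of_fluxAct_one hu i
      simp only [a, Pi.mul_apply, Pi.inv_apply]
      rw [← this]
      simp [u, mul_assoc]
    refine ⟨(Fintype.card (V → G) : ℂ)⁻¹ •
      ((Finset.univ.filter fun g : V → G => c.fluxAct g 1 = 1).card : ℂ) •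
        c.ribbon.classOp κ a⁻¹, Submodule.smul_mem _ _ (Submodule.smul_mem _ _
          (Submodule.subset_span ⟨_, rfl⟩)), ?_⟩
    rw [hsum, smul_mul_assoc, M.sum_cutOp_mul_fluxProj c hbulk hmatter hdisk, smul_mul_assoc,
      smul_mul_assoc]
  -- Fluxes outside the orbit of the trivial ones, and their gauge transforms, never occur on flat
  -- labels, so the average vanishes on physical states.
  · refine ⟨0, Submodule.zero_mem _, ?_⟩
    refine M.mul_physProj_congr fun x' x hx => ?_
    obtain ⟨t, ht⟩ := M.exists_flux_eq c hbulk hmatter hdisk hx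
    rw [Matrix.smul_apply, Matrix.sum_apply, Finset.sum_eq_zero, smul_zero, Matrix.zero_apply]
    intro h _
    rw [fluxProj, linkDiag, Matrix.mul_diagonal, if_neg, mul_zero]
    intro h'
    refine hk ⟨h⁻¹ * t, ?_⟩
    rw [c.fluxAct_mul, ← ht, h', ← c.fluxAct_mul, inv_mul_cancel, c.fluxAct_one]

theorem cutAvg_mul_physProj_mem (hbulk : ∀ i, c.plaq i ∉ M.Pbdry)
    (hmatter : ∀ i, (M.matter (c.plaq i)).IsTrivial) (hdisk : M.Unpinched c)
    {X : Matrix (Config G L κ) (Config G L κ) ℂ} (hX : X ∈ M.cutSpan c) :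
    ∃ t ∈ Submodule.span ℂ (Set.range (c.ribbon.classOp (G := G) κ)),
      M.cutAvg c X * M.physProj = t * M.physProj := by
  induction hX using Submodule.span_induction with
  | zero => exact ⟨0, Submodule.zero_mem _, by rw [map_zero]⟩
  | add X Y _ _ hX hY =>
    obtain ⟨s, hs, hXs⟩ := hX
    obtain ⟨t, ht, hYt⟩ := hY
    exact ⟨s + t, Submodule.add_mem _ hs ht, by rw [map_add, add_mul, add_mul, hXs, hYt]⟩
  | smul a X _ hX =>
    obtain ⟨s, hs, hXs⟩ := hX
    exact ⟨a • s, Submodule.smul_mem _ _ hs, by rw [map_smul, smul_mul_assoc, smul_mul_assoc, hXs]⟩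
  | mem X hX =>
    obtain ⟨g, k, rfl | rfl⟩ := hX
    · exact M.cutAvg_mul_mul_physProj_mem c hbulk hmatter hdisk g k
    · rw [M.cutAvg_mul_of_commute c (fun g => M.cutOp_commute_regionProj g)
        (M.fluxProj_commute_regionProj c), mul_assoc, regionProj_mul_physProj]
      exact M.cutAvg_mul_mul_physProj_mem c hbulk hmatter hdisk g k

/-- On physical states, class operators commute with the operators of the region. -/
theorem classOp_mul_comm_physProj (hbulk : ∀ i, c.plaq i ∉ M.Pbdry)
    (hmatter : ∀ i, (M.matter (c.plaq i)).IsTrivial) (hends : ∀ i, M.dtgt (c.spoke i) ∉ M.Vbdry)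
    (hdisk : M.Unpinched c) (h : G) {O : Matrix (Config G L κ) (Config G L κ) ℂ}
    (hO : O ∈ M.preAlgebra b) :
    c.ribbon.classOp κ h * O * M.physProj = O * c.ribbon.classOp κ h * M.physProj := by
  obtain ⟨s, -, hc, hs⟩ := M.exists_commute_cutConstraints c hbulk hmatter hends hO
  obtain ⟨hR, hE, -⟩ := (M.forall_cutConstraints c).1 hc
  let N := ((Finset.univ.filter fun g : V → G => c.fluxAct g 1 = 1).card : ℂ)
  have hN : N ≠ 0 := by
    rw [Nat.cast_ne_zero, Finset.card_ne_zero]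
    exact ⟨1, by simp [c.fluxAct_one]⟩
  -- `Y` is built from cut-off constraints, so it commutes with `s` exactly, and on physical states
  -- it is a nonzero multiple of the class operator. The value `h⁻¹` compensates the inverse in
  -- `sum_cutOp_mul_fluxProj`.
  let Y := ∑ g : V → G, M.cutOp b (g * (fun _ => h⁻¹) * g⁻¹) * M.fluxProj c (c.fluxAct g 1)
  have hY : Y * M.physProj = N • (c.ribbon.classOp κ h * M.physProj) := by
    have := M.sum_cutOp_mul_fluxProj c hbulk hmatter hdisk h⁻¹
    rwa [inv_inv] at this
  have hYs : Commute Y s := Commute.sum_left _ _ _ fun g _ => (hR _).mul_left (hE _)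
  have hF := M.commute_physProj_of_mem_preAlgebra (M.classOp_mem_preAlgebra c hmatter h)
  have hOp := M.commute_physProj_of_mem_preAlgebra hO
  have hcancel : ∀ A B : Matrix (Config G L κ) (Config G L κ) ℂ, N • A = N • B → A = B :=
    fun A B hAB => smul_right_injective _ hN hAB
  apply hcancel
  calc N • (c.ribbon.classOp κ h * O * M.physProj)
      = N • (c.ribbon.classOp κ h * M.physProj) * O := by
        rw [mul_assoc, hOp.eq, smul_mul_assoc, mul_assoc]
    _ = Y * (O * M.physProj) := by rw [← hY, mul_assoc, hOp.eq]
    _ = s * (Y * M.physProj) := by rw [← hs, ← mul_assoc, hYs.eq, mul_assoc]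
    _ = N • (s * M.physProj * c.ribbon.classOp κ h) := by
        rw [hY, mul_smul_comm, hF.eq, mul_assoc]
    _ = _ := by rw [hs, mul_assoc, ← hF.eq, mul_assoc]

/-- An operator of the region that is central on the physical states acts there like a combination of
class operators. -/
theorem exists_classOp_of_central (hbulk : ∀ i, c.plaq i ∉ M.Pbdry)
    (hmatter : ∀ i, (M.matter (c.plaq i)).IsTrivial) (hends : ∀ i, M.dtgt (c.spoke i) ∉ M.Vbdry)
    (hdisk : M.Unpinched c) {z : Matrix (Config G L κ) (Config G L κ) ℂ}
    (hz : z ∈ M.preAlgebra b)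
    (hzc : ∀ O ∈ M.preAlgebra b, z * O * M.physProj = O * z * M.physProj) :
    ∃ t ∈ Submodule.span ℂ (Set.range (c.ribbon.classOp (G := G) κ)),
      z * M.physProj = t * M.physProj := by
  obtain ⟨s, hsl, hsc, hs⟩ := M.exists_commute_cutConstraints c hbulk hmatter hends hz
  -- The operators that vanish on physical states. Within the commutant of the cut-off constraints
  -- they form a two-sided ideal: stability under right multiplication holds because `r *
  -- regionProj` commutes with `physProj`.
  let J : Submodule ℂ (Matrix (Config G L κ) (Config G L κ) ℂ) :=
    LinearMap.ker (LinearMap.mulRight ℂ M.physProj)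
  have hJ : ∀ y, y ∈ J ↔ y * M.physProj = 0 := fun y => Iff.rfl
  have hQ := M.regionProj_mul_physProj b
  have hzp := M.commute_physProj_of_mem_preAlgebra hz
  have hphys : ∀ r ∈ localAlgebra κ (M.regionLinks b) (M.regionPlaqs b),
      (∀ x ∈ M.cutConstraints c, Commute x r) →
        r * M.physProj = M.physProj * (r * M.regionProj b) := by
    intro r hr hrc
    rw [← (M.commute_physProj_of_mem_preAlgebra
      (M.mul_regionProj_mem_preAlgebra c hmatter hr hrc)).eq, mul_assoc, hQ]
  obtain ⟨z', hz'N, hz'c, hz'J⟩ := exists_local_central_lift (S := M.regionLinks b)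
    (T := M.regionPlaqs b) (M.cutConstraints c)
    ((M.forall_cutConstraints c).2 ⟨M.cutOp_mem_localAlgebra b, M.fluxProj_mem_localAlgebra c,
      M.regionProj_mem_localAlgebra c hmatter⟩)
    ((M.forall_cutConstraints c).2 ⟨fun g => by
        rw [cutOp_conjTranspose]
        exact Or.inl (Or.inl ⟨_, rfl⟩), fun k => by
        rw [fluxProj_conjTranspose]
        exact Or.inl (Or.inr ⟨_, rfl⟩), by
        rw [(M.regionProj_isHermitian b).eq]
        exact Or.inr rfl⟩)
    (M.cutSpan c) (M.one_mem_cutSpan c) (fun x hx y hy => M.mul_mem_cutSpan c hx hy) J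
    (fun r _ _ j hj => by
      rw [hJ] at hj ⊢
      rw [mul_assoc, hj, mul_zero])
    (fun r hr hrc j hj => by
      rw [hJ] at hj ⊢
      rw [mul_assoc, hphys r hr hrc, ← mul_assoc, hj, zero_mul])
    hsl hsc (fun r hr hrc => by
      have hrQ := M.mul_regionProj_mem_preAlgebra c hmatter hr hrc
      rw [hJ, sub_mul, sub_eq_zero]
      calc s * r * M.physProj = s * M.physProj * (r * M.regionProj b) := by
            rw [mul_assoc, hphys r hr hrc, mul_assoc]
        _ = z * (r * M.regionProj b) * M.physProj := by
            rw [hs, mul_assoc, mul_assoc z,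
              ← (M.commute_physProj_of_mem_preAlgebra hrQ).eq]
        _ = r * M.regionProj b * (M.physProj * z) := by rw [hzc _ hrQ, mul_assoc, hzp.eq]
        _ = r * (M.physProj * z) := by rw [mul_assoc, ← mul_assoc _ _ z, hQ]
        _ = _ := by rw [← hzp.eq, ← hs, mul_assoc])
  rw [hJ, sub_mul, sub_eq_zero] at hz'J
  obtain ⟨hR, hE, -⟩ := (M.forall_cutConstraints c).1 hz'c
  obtain ⟨t, ht, htz⟩ := M.cutAvg_mul_physProj_mem c hbulk hmatter hdisk hz'N
  -- The lift commutes with the cut-off constraints, so averaging leaves it unchanged, while for any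
  -- member of `cutSpan` the average is a combination of class operators on physical states.
  rw [M.cutAvg_eq_self c hR hE] at htz
  exact ⟨t, ht, by rw [← hs, hz'J, htz]⟩

/-! ### The physical representation -/

/-- The physical space is the range of `physProj`, so identities in the represented algebra become
matrix identities multiplied by `physProj` on the right. -/
theorem physRep_eq_iff (O O' : M.preAlgebra b) :
    M.physRep b O = M.physRep b O' ↔ O.1 * M.physProj = O'.1 * M.physProj := by
  have happly : ∀ (O : M.preAlgebra b) φ (h : M.physProj.mulVecLin φ ∈ M.physSpace),
      (M.physRep b O ⟨_, h⟩).1 = (O.1 * M.physProj).mulVecLin φ := fun O φ h =>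
    Matrix.mulVec_mulVec _ _ _
  constructor
  · intro h
    refine Matrix.ext_of_mulVec_single fun i => ?_
    generalize (Pi.single i 1 : Config G L κ → ℂ) = φ
    have hφ : M.physProj.mulVecLin φ ∈ M.physSpace := ⟨φ, rfl⟩
    exact (happly O φ hφ).symm.trans ((by rw [h] : (M.physRep b O ⟨_, hφ⟩).1 = _).trans
      (happly O' φ hφ))
  · intro h
    refine LinearMap.ext fun ψ => Subtype.ext ?_
    obtain ⟨_, φ, rfl⟩ := ψ
    exact (happly O φ ⟨φ, rfl⟩).trans ((by rw [h] :
      (O.1 * M.physProj).mulVecLin φ = (O'.1 * M.physProj).mulVecLin φ).trans (happly O' φ ⟨φ, rfl⟩).symm)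

end Model

end DoublyGauged

end

/-! ### The center of the algebra of the region. -/

theorem mainTheorem2 {G V L P : Type*} [Group G] [Fintype G] [DecidableEq G]
    [Fintype V] [DecidableEq V] [Fintype L] [DecidableEq L] [Fintype P] [DecidableEq P]
    {κ : P → Type*} [∀ p, Fintype (κ p)] [∀ p, DecidableEq (κ p)]
    (M : DoublyGauged.Model G V L P κ) (b : Finset V)
    (c : DoublyGauged.IntervalCut M.toDiskLattice b)
    (hbulk : ∀ i, c.plaq i ∉ M.Pbdry)
    (hmatter : ∀ i, (M.matter (c.plaq i)).IsTrivial)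
    (hends : ∀ i, M.dtgt (c.spoke i) ∉ M.Vbdry)
    (hdisk : M.Unpinched c) :
    ∃ hF : ∀ h : G, c.ribbon.classOp κ h ∈ M.preAlgebra b,
      M.regionCenter b =
          Algebra.adjoin ℂ (Set.range fun h => M.physRep b ⟨c.ribbon.classOp κ h, hF h⟩) ∧
        Subalgebra.toSubmodule (M.regionCenter b) =
          Submodule.span ℂ (Set.range fun h => M.physRep b ⟨c.ribbon.classOp κ h, hF h⟩) := by
  have hF : ∀ h : G, c.ribbon.classOp κ h ∈ M.preAlgebra b := M.classOp_mem_preAlgebra c hmatter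
  refine ⟨hF, ?_⟩
  have hmem : ∀ h, M.physRep b ⟨c.ribbon.classOp κ h, hF h⟩ ∈ M.regionCenter b := by
    intro h
    refine ⟨⟨_, rfl⟩, ?_⟩
    refine (Subalgebra.mem_centralizer_iff ℂ).2 ?_
    rintro _ ⟨O, rfl⟩
    change M.physRep b O * _ = _ * M.physRep b O
    rw [← map_mul, ← map_mul, M.physRep_eq_iff]
    exact (M.classOp_mul_comm_physProj c hbulk hmatter hends hdisk h O.2).symm
  have hspan : ∀ t ∈ Submodule.span ℂ (Set.range (c.ribbon.classOp (G := G) κ)),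
      ∃ O : M.preAlgebra b, O.1 = t ∧ M.physRep b O ∈
        Submodule.span ℂ (Set.range fun h => M.physRep b ⟨c.ribbon.classOp κ h, hF h⟩) := by
    intro t ht
    induction ht using Submodule.span_induction with
    | zero =>
      refine ⟨0, rfl, ?_⟩
      rw [map_zero]
      exact Submodule.zero_mem _
    | add s t _ _ hs ht =>
      obtain ⟨O, rfl, hO⟩ := hs
      obtain ⟨O', rfl, hO'⟩ := ht
      refine ⟨O + O', rfl, ?_⟩
      rw [map_add]
      exact Submodule.add_mem _ hO hO'
    | smul a s _ hs =>
      obtain ⟨O, rfl, hO⟩ := hs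
      refine ⟨a • O, rfl, ?_⟩
      rw [map_smul]
      exact Submodule.smul_mem _ _ hO
    | mem s hs =>
      obtain ⟨h, rfl⟩ := hs
      exact ⟨⟨_, hF h⟩, rfl, Submodule.subset_span ⟨h, rfl⟩⟩
  have hle : ∀ Z ∈ M.regionCenter b, Z ∈
      Submodule.span ℂ (Set.range fun h => M.physRep b ⟨c.ribbon.classOp κ h, hF h⟩) := by
    rintro _ ⟨⟨z, rfl⟩, hz⟩
    have hz := (Subalgebra.mem_centralizer_iff ℂ).1 hz
    obtain ⟨t, ht, hzt⟩ := M.exists_classOp_of_central c hbulk hmatter hends hdisk z.2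
      fun O hO => by
        have h := hz _ ⟨⟨O, hO⟩, rfl⟩
        change M.physRep b ⟨O, hO⟩ * M.physRep b z = M.physRep b z * M.physRep b ⟨O, hO⟩ at h
        rw [← map_mul, ← map_mul, M.physRep_eq_iff] at h
        exact h.symm
    obtain ⟨O, rfl, hts⟩ := hspan t ht
    rw [← (M.physRep_eq_iff z O).2 hzt] at hts
    exact hts
  constructor
  · refine le_antisymm (fun Z hZ => Algebra.span_le_adjoin ℂ _ (hle Z hZ)) (Algebra.adjoin_le ?_)
    rintro _ ⟨h, rfl⟩
    exact hmem h
  · refine le_antisymm hle (Submodule.span_le.2 ?_)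
    rintro _ ⟨h, rfl⟩
    exact hmem h
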